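/- Let $(X,d)$ be a locally compact, connected metric space, endowed with a non-zero inner regular Radon measure $\mu$ (a Borel measure that is locally finite and inner regular with respect to compact sets on all Borel sets) with $\operatorname{supp}\mu=X$. For $\rho>0$ let $D_\rho\in[1,\infty]$ be the least number such that $\mu(B(x,2s))\le D_\rho\,\mu(B(x,s))$ for all $x\in X$ and $s\in(0,\rho]$. Let $B_1,B_2$ be (real or complex) Banach spaces; for a set $E\subseteq X$ and $\delta>0$ write $B(E,\delta)=\{x: d(x,E)<\delta\}$ and $\overline B(E,\delta)=\{x: d(x,E)\le\delta\}$. Let $L^\infty_c(\mu;B_1)$ be the space of (classes of) essentially bounded, strongly $\mu$-measurable functions $X\to B_1$ with compact support. For $1<p\le r\le\infty$ put $$\phi(r,p)=\inf_{1<q<p}\Bigl(q'+\frac1{r/q-1}\Bigr)^{(1/p-1/r)/(1-q/r)},$$ and for $1\le r\le p<\infty$ put $\phi(r,p)=\phi(r',p')$, where $'$ denotes conjugate exponents. Let $\kappa>2$, $R>0$ with $D_{3\kappa R}<\infty$, and $r\in(1,\infty]$ (resp. $r\in[1,\infty)$). Let $T$ be a linear operator from $L^\infty_c(\mu;B_1)$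 to the space of (classes of) strongly $\mu$-measurable functions $X\to B_2$, let $K:X\times X\to\mathcal L(B_1;B_2)$ be strongly $(\mu\otimes\mu)$-measurable, and let $A_R,C_R>0$ be such that (a) and (b) hold. (a) For every $\mu$-measurable $E\subseteq X$ with $\operatorname{diam}E<R$, the operator $S=S_E:f\mapsto\chi_E T(\chi_{B(E,R/2)}f)$ (resp. $S=S_E:f\mapsto\chi_{B(E,R/2)}T(\chi_E f)$) on $L^\infty_c(\mu;B_1)$ satisfies: (i) for every open $F\subseteq B(E,R/2)$, $K$ is $(\mu\otimes\mu)$-integrable on $(E\setminus F)\times F$ and, for every $f\in L^\infty_c(\mu;B_1)$ concentrated on $F$, $Sf(x)=\int_F K(x,y)f(y)\,d\mu(y)$ for $\mu$-almost every $x\in E\setminus F$ (resp. $K$ is $(\mu\otimes\mu)$-integrable on $F\times(E\setminus F)$ and, for every $f\in L^\infty_c(\mu;B_1)$ concentrated on $E\setminus F$, $Sf(x)=\int_{E\setminus F}K(x,y)f(y)\,d\mu(y)$ for $\mu$-almost every $x\in F$); (ii) $\|Sf\|_{L^r(\mu;B_2)}\le A_R\|f\|_{L^r(\mu;B_1)}$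 for every $f\in L^\infty_c(\mu;B_1)$ concentrated on $B(E,R/2)$ (resp. on $E$); (iii) for $\mu$-almost every $y$ and $\mu$-almost every $y'$ in $B(E,R/2)$ with $d(y,y')<R$, $\int_{E\setminus B(y,2d(y,y'))}|K(x,y)-K(x,y')|\,d\mu(x)\le C_R$ (resp. $\int_{E\setminus B(y,2d(y,y'))}|K(y,x)-K(y',x)|\,d\mu(x)\le C_R$). (b) For every $f\in L^\infty_c(\mu;B_1)$ and every $\mu$-measurable $E\subseteq X$ with $\operatorname{diam}E<R/4$, $Tf(x)=T(\chi_{\overline B(E,R/3)}f)(x)$ for $\mu$-almost every $x\in E$. Then, for every $p\in(1,r]$ (resp. every $p\in[r,\infty)$) and every $f\in L^\infty_c(\mu;B_1)$, $$\|Tf\|_{L^p(\mu;B_2)}\le 16\,\phi(r,p)\,D_R^{5/p}\,\bigl(D_{3\kappa R}^9A_R+C_R\bigr)\,\|f\|_{L^p(\mu;B_1)}.$$ -/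

import Mathlib

open MeasureTheory Set
open scoped ENNReal NNReal

noncomputable section

namespace LocalCZ

/-- The local doubling constant `D_R`: the least `D ∈ [1, ∞]` such that
`μ (B(x, 2 r)) ≤ D μ (B(x, r))` for all `x` and all `r ∈ (0, R]`. -/
def doublingConst {X : Type*} [MetricSpace X] [MeasurableSpace X] (μ : Measure X) (R : ℝ) :
    ℝ≥0∞ :=
  sInf {D : ℝ≥0∞ | 1 ≤ D ∧ ∀ x : X, ∀ r : ℝ, 0 < r → r ≤ R →
    μ (Metric.ball x (2 * r)) ≤ D * μ (Metric.ball x r)}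

/-- The interpolation constant for `1 < p ≤ r ≤ ∞`:
`inf_{1 < q < p} (q' + 1 / (r / q - 1)) ^ ((1 / p - 1 / r) / (1 - q / r))`, `q' = q / (q - 1)`.
(With `1 < q < p ≤ r` all the subtractions and divisions in `[0, ∞]` have their usual meaning,
with `∞ / q = ∞`, `1 / ∞ = 0` and `q / ∞ = 0` when `r = ∞`.) -/
def phiBelow (r p : ℝ≥0∞) : ℝ≥0∞ :=
  ⨅ q ∈ Ioo (1 : ℝ≥0∞) p,
    (q / (q - 1) + 1 / (r / q - 1)) ^ ((1 / p - 1 / r) / (1 - q / r)).toReal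

open scoped Classical in
/-- `φ(r, p)`: the constant above if `1 < p ≤ r`, and `φ(r', p')` if `r ≤ p < ∞`, where `'`
denotes conjugate exponents. (If `1 < p = r < ∞`, both expressions are `1`.) -/
def phi (r p : ℝ≥0∞) : ℝ≥0∞ :=
  if 1 < p ∧ p ≤ r then phiBelow r p else phiBelow r.conjExponent p.conjExponent

section Functions

variable {X : Type*} [MeasurableSpace X]

/-- Multiplication by the characteristic function of a `μ`-measurable set, on classes of
`μ`-measurable functions. -/
def cut {B : Type*} [NormedAddCommGroup B] {μ : Measure X} (S : Set X)
    (hS : NullMeasurableSet S μ) (f : X →ₘ[μ] B) : X →ₘ[μ] B :=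
  AEEqFun.mk (S.indicator f) (f.aestronglyMeasurable.indicator₀ hS)

theorem coeFn_cut {B : Type*} [NormedAddCommGroup B] {μ : Measure X} (S : Set X)
    (hS : NullMeasurableSet S μ) (f : X →ₘ[μ] B) : cut S hS f =ᵐ[μ] S.indicator f :=
  AEEqFun.coeFn_mk _ _

/-- `f` is concentrated on `S`, that is, `f ∈ χ_S L⁰(μ; B)`. -/
def ConcentratedOn {B : Type*} [NormedAddCommGroup B] {μ : Measure X} (f : X →ₘ[μ] B)
    (S : Set X) : Prop :=
  ∀ᵐ x ∂μ, x ∉ S → f x = 0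

variable [MetricSpace X]

/-- The space `L^∞_c(μ; B)` of (classes of) strongly `μ`-measurable, essentially bounded functions
with compact support. -/
def LinftyC (𝕜 : Type*) [RCLike 𝕜] (B : Type*) [NormedAddCommGroup B] [NormedSpace 𝕜 B]
    (μ : Measure X) : Submodule 𝕜 (X →ₘ[μ] B) where
  carrier := {f | MemLp f ∞ μ ∧ ∃ Q : Set X, IsCompact Q ∧ ConcentratedOn f Q}
  zero_mem' := by
    refine ⟨(MemLp.zero' (p := ∞) (μ := μ) (ε := B)).ae_eq AEEqFun.coeFn_zero.symm, ∅,
      isCompact_empty, ?_⟩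
    filter_upwards [AEEqFun.coeFn_zero (α := X) (β := B) (μ := μ)] with x hx _
    simpa using hx
  add_mem' := by
    rintro f g ⟨hf, Q, hQ, hfQ⟩ ⟨hg, P, hP, hgP⟩
    refine ⟨(hf.add hg).ae_eq (AEEqFun.coeFn_add f g).symm, Q ∪ P, hQ.union hP, ?_⟩
    filter_upwards [AEEqFun.coeFn_add f g, hfQ, hgP] with x hx h1 h2 hxQ
    rw [hx, Pi.add_apply, h1 (fun h => hxQ (Or.inl h)), h2 (fun h => hxQ (Or.inr h)), add_zero]
  smul_mem' := by
    rintro c f ⟨hf, Q, hQ, hfQ⟩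
    refine ⟨(hf.const_smul c).ae_eq (AEEqFun.coeFn_smul c f).symm, Q, hQ, ?_⟩
    filter_upwards [AEEqFun.coeFn_smul c f, hfQ] with x hx h1 hxQ
    rw [hx, Pi.smul_apply, h1 hxQ, smul_zero]

variable {𝕜 : Type*} [RCLike 𝕜]

/-- Multiplication by the characteristic function of a `μ`-measurable set, on `L^∞_c`. -/
def cutC {B : Type*} [NormedAddCommGroup B] [NormedSpace 𝕜 B] {μ : Measure X} (S : Set X)
    (hS : NullMeasurableSet S μ) (f : LinftyC 𝕜 B μ) : LinftyC 𝕜 B μ :=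
  ⟨cut S hS f.1, by
    obtain ⟨f, hf, Q, hQ, hfQ⟩ := f
    refine ⟨(memLp_congr_ae (coeFn_cut S hS f)).2 ?_, Q, hQ, ?_⟩
    · exact hf.mono (hf.1.indicator₀ hS)
        (Filter.Eventually.of_forall fun x => norm_indicator_le_norm_self _ _)
    · filter_upwards [coeFn_cut S hS f, hfQ] with x hx h1 hxQ
      rw [hx]
      by_cases hxS : x ∈ S
      · rw [indicator_of_mem hxS, h1 hxQ]
      · rw [indicator_of_notMem hxS]⟩

theorem nullMeasurableSet_thickening [BorelSpace X] (μ : Measure X) (δ : ℝ) (E : Set X) :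
    NullMeasurableSet (Metric.thickening δ E) μ :=
  Metric.isOpen_thickening.measurableSet.nullMeasurableSet

theorem nullMeasurableSet_cthickening [BorelSpace X] (μ : Measure X) (δ : ℝ) (E : Set X) :
    NullMeasurableSet (Metric.cthickening δ E) μ :=
  Metric.isClosed_cthickening.measurableSet.nullMeasurableSet

variable {B₁ B₂ : Type*} [NormedAddCommGroup B₁] [NormedSpace 𝕜 B₁]
  [NormedAddCommGroup B₂] [NormedSpace ℝ B₂] [NormedSpace 𝕜 B₂]

/-- The local Calderón–Zygmund conditions at scale `R` on the set `E`, with exponent `r` and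
constants `A`, `C`, for an operator `S` acting on functions concentrated on
`B(E, R/2) = {x | d(x, E) < R/2}` and a kernel `K` on `E × B(E, R/2)`. -/
structure Conditions (μ : Measure X) (R : ℝ) (r : ℝ≥0∞) (A C : ℝ≥0) (E : Set X)
    (S : LinftyC 𝕜 B₁ μ → (X →ₘ[μ] B₂)) (K : X → X → B₁ →L[𝕜] B₂) : Prop where
  integrable : ∀ F : Set X, IsOpen F → F ⊆ Metric.thickening (R / 2) E →
    IntegrableOn (Function.uncurry K) ((E \ F) ×ˢ F) (μ.prod μ)
  kernel : ∀ F : Set X, IsOpen F → F ⊆ Metric.thickening (R / 2) E →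
    ∀ f : LinftyC 𝕜 B₁ μ, ConcentratedOn f.1 F →
      ∀ᵐ x ∂μ, x ∈ E \ F → S f x = ∫ y in F, K x y (f.1 y) ∂μ
  bound : ∀ f : LinftyC 𝕜 B₁ μ, ConcentratedOn f.1 (Metric.thickening (R / 2) E) →
    eLpNorm (S f) r μ ≤ A * eLpNorm f.1 r μ
  regularity : ∀ᵐ y ∂μ, ∀ᵐ y' ∂μ, y ∈ Metric.thickening (R / 2) E →
    y' ∈ Metric.thickening (R / 2) E → dist y y' < R →
      ∫⁻ x in E \ Metric.ball y (2 * dist y y'), ‖K x y - K x y'‖ₑ ∂μ ≤ C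

/-- The dual local Calderón–Zygmund conditions at scale `R` on the set `E`, with exponent `r` and
constants `A`, `C`, for an operator `S` acting on functions concentrated on `E` and a kernel `K`
on `B(E, R/2) × E`. -/
structure DualConditions (μ : Measure X) (R : ℝ) (r : ℝ≥0∞) (A C : ℝ≥0) (E : Set X)
    (S : LinftyC 𝕜 B₁ μ → (X →ₘ[μ] B₂)) (K : X → X → B₁ →L[𝕜] B₂) : Prop where
  integrable : ∀ F : Set X, IsOpen F → F ⊆ Metric.thickening (R / 2) E →
    IntegrableOn (Function.uncurry K) (F ×ˢ (E \ F)) (μ.prod μ)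
  kernel : ∀ F : Set X, IsOpen F → F ⊆ Metric.thickening (R / 2) E →
    ∀ f : LinftyC 𝕜 B₁ μ, ConcentratedOn f.1 (E \ F) →
      ∀ᵐ x ∂μ, x ∈ F → S f x = ∫ y in E \ F, K x y (f.1 y) ∂μ
  bound : ∀ f : LinftyC 𝕜 B₁ μ, ConcentratedOn f.1 E →
    eLpNorm (S f) r μ ≤ A * eLpNorm f.1 r μ
  regularity : ∀ᵐ x ∂μ, ∀ᵐ x' ∂μ, x ∈ Metric.thickening (R / 2) E →
    x' ∈ Metric.thickening (R / 2) E → dist x x' < R →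
      ∫⁻ y in E \ Metric.ball x (2 * dist x x'), ‖K x y - K x' y‖ₑ ∂μ ≤ C

end Functions

end LocalCZ

end

/-! The estimate is local. If E has diameter below R/4, hypothesis (b) lets T f on E be computed
from the part of f within R/3 of E, so a bound for the truncated operators of (a) is enough. A
maximal R/10-separated set gives countably many small pieces that cover X and whose
R/3-neighbourhoods overlap at most D_R^5 times, by packing (`DoublingUpTo.exists_partition`);
summing p-th powers costs D_R^(5/p) (`eLpNorm_le_of_local`).

Direct case. The local operator has weak type (r, r) by assumption, and weak type (1, 1) with
constant M = 4 (D^9 A + C) by a Calderón–Zygmund decomposition (`IsLocalCZOperator.weakType_one`).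
This is carried out for an abstract subadditive operator with values in [0, ∞], so that it also
serves the dual case. Balls are selected by a dyadic stopping time and a Vitali covering; when the
stopping radii cannot be forced to be small, the measure of E itself bounds the level set, and this
produces D^9. The mass of f on a piece Q_i is spread over a compact P_i in the i-th of the disjoint
balls, so that the atoms χ_{Q_i} f - c_i χ_{P_i} have mean zero and stay in L^∞_c. No continuity on
infinite sums of atoms is available: only finitely many atoms are removed at a time, and the rest of
f is controlled by the integrability of K off the diagonal, an error that tends to 0. Marcinkiewicz
interpolation bounds the L^q norm by 2 M Φ^(1/q) with Φ = q' + 1/(r/q - 1). A second interpolation,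
between L^q and L^r, loses only a factor 2 and gives 4 M Φ^θ with θ = (1/p - 1/r)/(1 - q/r). The
infimum over q is φ(r, p).

Dual case. The image of g under the transpose need not be represented by a function with values in
the dual of B₁. Only its pointwise norm is needed: the functional f ↦ ∫ g (S f) has a variation that
is absolutely continuous, and its density U g depends subadditively on g
(`exists_variation_density`, `IsTransposeNorm`). U satisfies the abstract conditions with exponent
r', hence an L^q bound; a converse of Hölder's inequality turns this into an L^(q') bound for S, and
interpolation between L^r and L^(q') gives exactly the exponent in φ(r', p'). -/

section

open Filter Topology

set_option linter.unusedSectionVars false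

noncomputable section

namespace LocalCZ

/-! ### Local doubling: ball measures, packing, second countability -/

section Doubling

variable {X : Type*} [MetricSpace X] [MeasurableSpace X] {μ : Measure X}

/-- `μ` is doubling with constant `D` on the balls of radius at most `R`. -/
def DoublingUpTo (μ : Measure X) (R : ℝ) (D : ℝ≥0) : Prop :=
  ∀ x : X, ∀ s : ℝ, 0 < s → s ≤ R → μ (Metric.ball x (2 * s)) ≤ D * μ (Metric.ball x s)

theorem one_le_doublingConst (μ : Measure X) (R : ℝ) : 1 ≤ doublingConst μ R :=
  le_sInf fun _ h => h.1

theorem doublingConst_mono {R R' : ℝ} (h : R ≤ R') : doublingConst μ R ≤ doublingConst μ R' :=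
  sInf_le_sInf fun _ hD => ⟨hD.1, fun x r hr hrR => hD.2 x r hr (hrR.trans h)⟩

theorem DoublingUpTo.ball_two_pow {R : ℝ} {D : ℝ≥0} (hD : DoublingUpTo μ R D) (x : X) {s : ℝ}
    (hs : 0 < s) (k : ℕ) (hk : 2 ^ k * s ≤ 2 * R) :
    μ (Metric.ball x (2 ^ k * s)) ≤ (D : ℝ≥0∞) ^ k * μ (Metric.ball x s) := by
  induction k with
  | zero => simp
  | succ k ih =>
    have h0 : 0 < 2 ^ k * s := by positivity
    have h1 : 2 ^ k * s ≤ R := by rw [pow_succ] at hk; linarith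
    calc μ (Metric.ball x (2 ^ (k + 1) * s)) = μ (Metric.ball x (2 * (2 ^ k * s))) := by
          congr 2; ring
      _ ≤ D * μ (Metric.ball x (2 ^ k * s)) := hD x _ h0 h1
      _ ≤ D * ((D : ℝ≥0∞) ^ k * μ (Metric.ball x s)) := by
          gcongr; exact ih (by linarith)
      _ = _ := by ring

theorem DoublingUpTo.ball_le {R : ℝ} {D : ℝ≥0} (hD : DoublingUpTo μ R D) (x : X) {s t : ℝ}
    (hs : 0 < s) (k : ℕ) (hk : 2 ^ k * s ≤ 2 * R) (ht : t ≤ 2 ^ k * s) :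
    μ (Metric.ball x t) ≤ (D : ℝ≥0∞) ^ k * μ (Metric.ball x s) :=
  (measure_mono (Metric.ball_subset_ball ht)).trans (hD.ball_two_pow x hs k hk)

/-- Local finiteness gives one finite ball at each centre, of a radius that depends on the centre;
finitely many doublings carry finiteness up to radius 2R. -/
theorem DoublingUpTo.ball_lt_top [OpensMeasurableSpace X] [IsLocallyFiniteMeasure μ] {R : ℝ}
    {D : ℝ≥0} (hD : DoublingUpTo μ R D) (hR : 0 < R) (x : X) {t : ℝ} (ht : t ≤ 2 * R) :
    μ (Metric.ball x t) < ∞ := by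
  obtain ⟨ε, hε, hfin⟩ : ∃ ε > 0, μ (Metric.ball x ε) < ∞ := by
    obtain ⟨U, hU, hUfin⟩ := μ.finiteAt_nhds x
    obtain ⟨ε, hε, h⟩ := Metric.mem_nhds_iff.1 hU
    exact ⟨ε, hε, (measure_mono h).trans_lt hUfin⟩
  obtain ⟨k, hk⟩ : ∃ k : ℕ, 2 * R / ε < 2 ^ k := pow_unbounded_of_one_lt _ one_lt_two
  have h1 : 2 * R / 2 ^ k ≤ ε := by
    rw [div_lt_iff₀ hε] at hk
    rw [div_le_iff₀ (by positivity)]; linarith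
  have h2 : 2 ^ k * (2 * R / 2 ^ k) = 2 * R := by field_simp
  refine (hD.ball_le x (s := 2 * R / 2 ^ k) (by positivity) k h2.le (by rw [h2]; exact ht)).trans_lt
    (ENNReal.mul_lt_top (ENNReal.pow_lt_top ENNReal.coe_lt_top)
      ((measure_mono (Metric.ball_subset_ball h1)).trans_lt hfin))

/-- The infimum is attained. On a ball of finite positive measure the quotient of the two measures
is a lower bound for all admissible constants; a null ball has a null double, by any finite
admissible constant. -/
theorem exists_doublingUpTo [OpensMeasurableSpace X] [IsLocallyFiniteMeasure μ] {R : ℝ}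
    (hR : 0 < R) (hfin : doublingConst μ R < ∞) :
    ∃ D : ℝ≥0, doublingConst μ R = D ∧ 1 ≤ D ∧ DoublingUpTo μ R D := by
  lift doublingConst μ R to ℝ≥0 using hfin.ne with D hD
  obtain ⟨D', ⟨h1, h2⟩, h3⟩ := sInf_lt_iff.1 (show doublingConst μ R < ∞ from hD ▸ hfin)
  lift D' to ℝ≥0 using h3.ne
  have hD' : DoublingUpTo μ R D' := h2
  refine ⟨D, rfl, ?_, fun x s hs hsR => ?_⟩
  · have := one_le_doublingConst μ R
    rw [← hD] at this
    exact_mod_cast this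
  · have hb : μ (Metric.ball x s) ≠ ∞ := (hD'.ball_lt_top hR x (by linarith)).ne
    by_cases h0 : μ (Metric.ball x s) = 0
    · have := h2 x s hs hsR
      rw [h0, mul_zero] at this ⊢
      exact this
    · rw [← ENNReal.div_le_iff h0 hb, hD]
      exact le_sInf fun D'' h'' => (ENNReal.div_le_iff h0 hb).2 (h''.2 x s hs hsR)

theorem DoublingUpTo.closedBall_le {R : ℝ} {D : ℝ≥0} (hD : DoublingUpTo μ R D) (x : X) {s t : ℝ}
    (hs : 0 < s) (k : ℕ) (hk : 2 ^ k * s ≤ 2 * R) (ht : t < 2 ^ k * s) :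
    μ (Metric.closedBall x t) ≤ (D : ℝ≥0∞) ^ k * μ (Metric.ball x s) :=
  (measure_mono (Metric.closedBall_subset_ball ht)).trans (hD.ball_two_pow x hs k hk)

theorem DoublingUpTo.isUnifLocDoublingMeasure {R : ℝ} {D : ℝ≥0} (hD : DoublingUpTo μ R D)
    (hR : 0 < R) : IsUnifLocDoublingMeasure μ := by
  refine ⟨⟨D ^ 2, ?_⟩⟩
  filter_upwards [Ioo_mem_nhdsGT (show (0 : ℝ) < R / 2 by positivity)] with ε hε x
  -- The closed ball of radius 2ε lies in the open ball of radius 4ε, two doublings away.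
  refine (hD.closedBall_le x hε.1 2 (by linarith [hε.2]) (by linarith [hε.1])).trans ?_
  push_cast
  gcongr
  exact Metric.ball_subset_closedBall

/-- A set of points at mutual distance at least `2 σ` in a ball is small. -/
theorem DoublingUpTo.card_le [OpensMeasurableSpace X] [IsLocallyFiniteMeasure μ]
    [μ.IsOpenPosMeasure] {R : ℝ} {D : ℝ≥0} (hD : DoublingUpTo μ R D)
    (hR : 0 < R) {σ ρ : ℝ} (hσ : 0 < σ) (k : ℕ) (hk : 2 ^ k * σ ≤ 2 * R) (hρ : 2 * ρ + σ ≤ 2 ^ k * σ)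
    (x : X) (F : Finset X) (hsep : ∀ y ∈ F, ∀ z ∈ F, y ≠ z → 2 * σ ≤ dist y z)
    (hF : ∀ y ∈ F, dist y x < ρ) : (F.card : ℝ≥0∞) ≤ (D : ℝ≥0∞) ^ k := by
  rcases F.eq_empty_or_nonempty with rfl | ⟨y₀, hy₀⟩
  · simp
  have hρ0 : 0 < ρ := dist_nonneg.trans_lt (hF y₀ hy₀)
  have hV0 : μ (Metric.ball x (ρ + σ)) ≠ 0 := (Metric.measure_ball_pos μ x (by linarith)).ne'
  have hVtop : μ (Metric.ball x (ρ + σ)) ≠ ∞ := (hD.ball_lt_top hR x (by linarith)).ne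
  have hdisj : (F : Set X).PairwiseDisjoint (fun y => Metric.ball y σ) := fun y hy z hz hyz =>
    Metric.ball_disjoint_ball (by linarith [hsep y hy z hz hyz])
  have h1 : ∑ y ∈ F, μ (Metric.ball y σ) ≤ μ (Metric.ball x (ρ + σ)) := by
    rw [← measure_biUnion_finset hdisj fun y _ => Metric.isOpen_ball.measurableSet]
    refine measure_mono (iUnion₂_subset fun y hy => Metric.ball_subset_ball' ?_)
    linarith [hF y hy]
  have h2 : ∀ y ∈ F, μ (Metric.ball x (ρ + σ)) ≤ (D : ℝ≥0∞) ^ k * μ (Metric.ball y σ) := by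
    intro y hy
    refine (measure_mono (Metric.ball_subset_ball' (y := y) (ε₂ := 2 ^ k * σ) ?_)).trans
      (hD.ball_two_pow y hσ k hk)
    have := hF y hy
    rw [dist_comm] at this
    linarith
  have h3 : F.card * μ (Metric.ball x (ρ + σ)) ≤ (D : ℝ≥0∞) ^ k * μ (Metric.ball x (ρ + σ)) := by
    calc F.card * μ (Metric.ball x (ρ + σ)) = ∑ y ∈ F, μ (Metric.ball x (ρ + σ)) := by simp
      _ ≤ ∑ y ∈ F, (D : ℝ≥0∞) ^ k * μ (Metric.ball y σ) := Finset.sum_le_sum h2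
      _ = (D : ℝ≥0∞) ^ k * ∑ y ∈ F, μ (Metric.ball y σ) := by rw [Finset.mul_sum]
      _ ≤ _ := by gcongr
  exact (ENNReal.mul_le_mul_iff_left hV0 hVtop).1 h3

/-- The ball is totally bounded: otherwise it would contain arbitrarily large finite ε-separated
sets, against the packing bound. -/
theorem DoublingUpTo.isSeparable_ball [OpensMeasurableSpace X] [IsLocallyFiniteMeasure μ]
    [μ.IsOpenPosMeasure] {R : ℝ} {D : ℝ≥0} (hD : DoublingUpTo μ R D)
    (hR : 0 < R) (x : X) : TopologicalSpace.IsSeparable (Metric.ball x (R / 2)) := by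
  refine TotallyBounded.isSeparable (Metric.totallyBounded_iff.2 fun ε hε => ?_)
  obtain ⟨n, hn⟩ : ∃ n : ℕ, 2 * R / ε < 2 ^ n := pow_unbounded_of_one_lt _ one_lt_two
  set σ := 2 * R / 2 ^ (n + 1) with hσdef
  have hσ : 0 < σ := by positivity
  have hσε : 2 * σ ≤ ε := by
    rw [div_lt_iff₀ hε] at hn
    have : 2 * σ = 2 * R / 2 ^ n := by rw [hσdef, pow_succ]; field_simp
    rw [this, div_le_iff₀ (by positivity)]; linarith
  have hσR : σ ≤ R := by
    rw [hσdef, div_le_iff₀ (by positivity), pow_succ]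
    nlinarith [one_le_pow₀ (M₀ := ℝ) one_le_two (n := n)]
  have hk : 2 ^ (n + 1) * σ = 2 * R := by rw [hσdef]; field_simp
  obtain ⟨N, hN⟩ := exists_nat_gt ((D : ℝ) ^ (n + 1))
  by_contra hcon
  push Not at hcon
  -- build arbitrarily large separated sets
  have key : ∀ m : ℕ, ∃ F : Finset X, F.card = m ∧ (∀ y ∈ F, y ∈ Metric.ball x (R / 2)) ∧
      ∀ y ∈ F, ∀ z ∈ F, y ≠ z → 2 * σ ≤ dist y z := by
    intro m
    induction m with
    | zero => exact ⟨∅, by simp⟩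
    | succ m ih =>
      classical
      obtain ⟨F, hc, hb, hs⟩ := ih
      obtain ⟨y, hy, hyF⟩ := not_subset.1 (hcon (F : Set X) F.finite_toSet)
      simp only [Finset.mem_coe, mem_iUnion, Metric.mem_ball, not_exists, not_lt] at hyF
      have hyn : y ∉ F := fun h => by simpa using hε.trans_le (hyF y h)
      refine ⟨insert y F, by rw [Finset.card_insert_of_notMem hyn, hc], ?_, ?_⟩
      · intro z hz
        rcases Finset.mem_insert.1 hz with rfl | hz
        · exact hy
        · exact hb z hz
      · intro z hz w hw hzw
        rcases Finset.mem_insert.1 hz with h1 | h1 <;> rcases Finset.mem_insert.1 hw with h2 | h2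
        · exact absurd (h1.trans h2.symm) hzw
        · rw [h1]; exact hσε.trans (hyF w h2)
        · rw [h2, dist_comm]; exact hσε.trans (hyF z h1)
        · exact hs z h1 w h2 hzw
  obtain ⟨F, hc, hb, hs⟩ := key N
  have := hD.card_le hR hσ (ρ := R / 2) (n + 1) hk.le (by linarith) x F hs fun y hy => hb y hy
  rw [hc] at this
  have h2 : (N : ℝ≥0) ≤ D ^ (n + 1) := by exact_mod_cast this
  have h3 : (N : ℝ) ≤ (D : ℝ) ^ (n + 1) := by exact_mod_cast h2
  linarith

/-- Iterated R/4-neighbourhoods of a point stay separable, since a countable dense subset of one of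
them is the set of centres of R/2-balls that cover the next. Their union is open and closed, hence
everything. -/
theorem DoublingUpTo.secondCountableTopology [ConnectedSpace X] [OpensMeasurableSpace X]
    [IsLocallyFiniteMeasure μ] [μ.IsOpenPosMeasure] {R : ℝ} {D : ℝ≥0} (hD : DoublingUpTo μ R D)
    (hR : 0 < R) : SecondCountableTopology X := by
  obtain ⟨x₀⟩ := (inferInstance : Nonempty X)
  let V : ℕ → Set X := fun n => (Metric.thickening (R / 4))^[n] {x₀}
  have hV : ∀ n, V (n + 1) = Metric.thickening (R / 4) (V n) := fun n =>
    Function.iterate_succ_apply' _ _ _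
  have hsep : ∀ n, TopologicalSpace.IsSeparable (V n) := by
    intro n
    induction n with
    | zero => exact (countable_singleton x₀).isSeparable
    | succ n ih =>
      obtain ⟨c, hc, hVc⟩ := ih
      have := hc.to_subtype
      refine (TopologicalSpace.IsSeparable.iUnion fun y : c => hD.isSeparable_ball hR y).mono
        fun z hz => ?_
      rw [hV, Metric.mem_thickening_iff] at hz
      obtain ⟨w, hw, hzw⟩ := hz
      obtain ⟨y, hy, hwy⟩ := Metric.mem_closure_iff.1 (hVc hw) (R / 4) (by positivity)
      refine mem_iUnion.2 ⟨⟨y, hy⟩, ?_⟩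
      rw [Metric.mem_ball]
      linarith [dist_triangle z w y]
  have hclopen : IsClopen (⋃ n, V n) := by
    constructor
    · refine isClosed_of_closure_subset fun z hz => ?_
      obtain ⟨w, hw, hzw⟩ := Metric.mem_closure_iff.1 hz (R / 4) (by positivity)
      obtain ⟨n, hn⟩ := mem_iUnion.1 hw
      exact mem_iUnion.2 ⟨n + 1, by rw [hV]; exact Metric.mem_thickening_iff.2 ⟨w, hn, hzw⟩⟩
    · refine Metric.isOpen_iff.2 fun z hz => ?_
      obtain ⟨n, hn⟩ := mem_iUnion.1 hz
      refine ⟨R / 4, by positivity, fun w hw => mem_iUnion.2 ⟨n + 1, ?_⟩⟩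
      rw [hV]
      exact Metric.mem_thickening_iff.2 ⟨z, hn, hw⟩
  have huniv : (⋃ n, V n) = univ :=
    hclopen.eq_univ ⟨x₀, mem_iUnion.2 ⟨0, rfl⟩⟩
  have : TopologicalSpace.SeparableSpace X :=
    TopologicalSpace.isSeparable_univ_iff.1 (huniv ▸ TopologicalSpace.IsSeparable.iUnion hsep)
  exact UniformSpace.secondCountable_of_separable X

end Doubling

/-! ### Truncations of classes of functions and the space L^∞_c -/

section Cut

variable {X : Type*} [MeasurableSpace X] {μ : Measure X} {B : Type*} [NormedAddCommGroup B]

theorem cut_add (S : Set X) (hS : NullMeasurableSet S μ) (f g : X →ₘ[μ] B) :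
    cut S hS (f + g) = cut S hS f + cut S hS g := by
  refine AEEqFun.ext ?_
  filter_upwards [coeFn_cut S hS (f + g), coeFn_cut S hS f, coeFn_cut S hS g,
    AEEqFun.coeFn_add f g, AEEqFun.coeFn_add (cut S hS f) (cut S hS g)] with x h1 h2 h3 h4 h5
  rw [h1, h5, Pi.add_apply, h2, h3]
  by_cases hx : x ∈ S <;> simp [hx, h4]

theorem cut_smul {𝕜 : Type*} [NormedRing 𝕜] [Module 𝕜 B] [IsBoundedSMul 𝕜 B] (S : Set X)
    (hS : NullMeasurableSet S μ) (c : 𝕜) (f : X →ₘ[μ] B) :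
    cut S hS (c • f) = c • cut S hS f := by
  refine AEEqFun.ext ?_
  filter_upwards [coeFn_cut S hS (c • f), coeFn_cut S hS f,
    AEEqFun.coeFn_smul c f, AEEqFun.coeFn_smul c (cut S hS f)] with x h1 h2 h4 h5
  rw [h1, h5, Pi.smul_apply, h2]
  by_cases hx : x ∈ S <;> simp [hx, h4]

theorem ConcentratedOn.mono {f : X →ₘ[μ] B} {S S' : Set X} (h : ConcentratedOn f S)
    (hS : S ⊆ S') : ConcentratedOn f S' := by
  filter_upwards [h] with x hx hxS using hx fun h => hxS (hS h)

theorem ConcentratedOn.cut_eq {f : X →ₘ[μ] B} {S : Set X} (hS : NullMeasurableSet S μ)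
    (h : ConcentratedOn f S) : cut S hS f = f := by
  refine AEEqFun.ext ?_
  filter_upwards [h, coeFn_cut S hS f] with x hx h1
  rw [h1]
  by_cases hxS : x ∈ S
  · simp [hxS]
  · simp [hxS, hx hxS]

theorem concentratedOn_cut {f : X →ₘ[μ] B} {S Y : Set X} (hS : NullMeasurableSet S μ)
    (h : ConcentratedOn f Y) : ConcentratedOn (cut S hS f) (S ∩ Y) := by
  filter_upwards [h, coeFn_cut S hS f] with x hx h1 hxS
  rw [h1]
  by_cases h2 : x ∈ S
  · rw [indicator_of_mem h2]; exact hx fun h3 => hxS ⟨h2, h3⟩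
  · simp [h2]

theorem ConcentratedOn.add {f g : X →ₘ[μ] B} {S : Set X} (hf : ConcentratedOn f S)
    (hg : ConcentratedOn g S) : ConcentratedOn (f + g) S := by
  filter_upwards [hf, hg, AEEqFun.coeFn_add f g] with x h1 h2 h3 hx
  rw [h3, Pi.add_apply, h1 hx, h2 hx, add_zero]

theorem ConcentratedOn.sub {f g : X →ₘ[μ] B} {S : Set X} (hf : ConcentratedOn f S)
    (hg : ConcentratedOn g S) : ConcentratedOn (f - g) S := by
  filter_upwards [hf, hg, AEEqFun.coeFn_sub f g] with x h1 h2 h3 hx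
  rw [h3, Pi.sub_apply, h1 hx, h2 hx, sub_zero]

theorem ConcentratedOn.smul {𝕜 : Type*} [NormedRing 𝕜] [Module 𝕜 B] [IsBoundedSMul 𝕜 B] (c : 𝕜)
    {f : X →ₘ[μ] B} {S : Set X} (hf : ConcentratedOn f S) : ConcentratedOn (c • f) S := by
  filter_upwards [hf, AEEqFun.coeFn_smul c f] with x h1 h3 hx
  rw [h3, Pi.smul_apply, h1 hx, smul_zero]

theorem concentratedOn_zero (S : Set X) : ConcentratedOn (0 : X →ₘ[μ] B) S := by
  filter_upwards [AEEqFun.coeFn_zero (α := X) (β := B) (μ := μ)] with x h1 hx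
  simpa using h1

variable [MetricSpace X] {𝕜 : Type*} [RCLike 𝕜] [NormedSpace 𝕜 B]

theorem coeFn_cutC (S : Set X) (hS : NullMeasurableSet S μ) (f : LinftyC 𝕜 B μ) :
    (cutC S hS f).1 =ᵐ[μ] S.indicator f.1 := coeFn_cut S hS f.1

theorem concentratedOn_cutC {f : LinftyC 𝕜 B μ} {S Y : Set X} (hS : NullMeasurableSet S μ)
    (h : ConcentratedOn f.1 Y) : ConcentratedOn (cutC S hS f).1 (S ∩ Y) := concentratedOn_cut hS h

theorem concentratedOn_cutC_self (f : LinftyC 𝕜 B μ) {S : Set X} (hS : NullMeasurableSet S μ) :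
    ConcentratedOn (cutC S hS f).1 S :=
  (concentratedOn_cut (Y := univ) hS (by simp [ConcentratedOn])).mono inter_subset_left

theorem ConcentratedOn.cutC_eq {f : LinftyC 𝕜 B μ} {S : Set X} (hS : NullMeasurableSet S μ)
    (h : ConcentratedOn f.1 S) : cutC S hS f = f := Subtype.ext (h.cut_eq hS)

theorem cutC_add (S : Set X) (hS : NullMeasurableSet S μ) (f g : LinftyC 𝕜 B μ) :
    cutC S hS (f + g) = cutC S hS f + cutC S hS g := Subtype.ext (cut_add S hS f.1 g.1)

theorem cutC_smul (S : Set X) (hS : NullMeasurableSet S μ) (c : 𝕜) (f : LinftyC 𝕜 B μ) :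
    cutC S hS (c • f) = c • cutC S hS f := Subtype.ext (cut_smul S hS c f.1)

theorem coeFn_addC (f g : LinftyC 𝕜 B μ) : (f + g).1 =ᵐ[μ] fun x => f.1 x + g.1 x :=
  AEEqFun.coeFn_add f.1 g.1

theorem coeFn_subC (f g : LinftyC 𝕜 B μ) : (f - g).1 =ᵐ[μ] fun x => f.1 x - g.1 x :=
  AEEqFun.coeFn_sub f.1 g.1

theorem cutC_add_cutC_compl (S : Set X) (hS : NullMeasurableSet S μ) (f : LinftyC 𝕜 B μ) :
    cutC S hS f + cutC Sᶜ hS.compl f = f := by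
  refine Subtype.ext (AEEqFun.ext ?_)
  filter_upwards [coeFn_addC (cutC S hS f) (cutC Sᶜ hS.compl f), coeFn_cutC S hS f,
    coeFn_cutC Sᶜ hS.compl f] with x h1 h2 h3
  rw [h1, h2, h3]
  by_cases hx : x ∈ S <;> simp [hx]

theorem coeFn_sumC {ι : Type*} (s : Finset ι) (f : ι → LinftyC 𝕜 B μ) :
    (∑ i ∈ s, f i).1 =ᵐ[μ] fun x => ∑ i ∈ s, (f i).1 x := by
  classical
  induction s using Finset.induction_on with
  | empty => simp only [Finset.sum_empty]; exact AEEqFun.coeFn_zero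
  | insert a s ha ih =>
    rw [Finset.sum_insert ha]
    filter_upwards [coeFn_addC (f a) (∑ i ∈ s, f i), ih] with x h1 h2
    rw [h1, h2, Finset.sum_insert ha]

theorem LinftyC.memLp [OpensMeasurableSpace X] [IsFiniteMeasureOnCompacts μ] (f : LinftyC 𝕜 B μ)
    (p : ℝ≥0∞) : MemLp f.1 p μ := by
  obtain ⟨f, hf, Q, hQ, hfQ⟩ := f
  have h1 : f =ᵐ[μ] Q.indicator f := by
    filter_upwards [hfQ] with x hx
    by_cases hxQ : x ∈ Q
    · simp [hxQ]
    · simp [hxQ, hx hxQ]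
  have : MemLp (Q.indicator f) ∞ μ := (memLp_congr_ae h1).1 hf
  refine (memLp_congr_ae h1).2 (this.mono_exponent_of_measure_support_ne_top (s := Q)
    (fun x hx => indicator_of_notMem hx _) hQ.measure_lt_top.ne le_top)

theorem LinftyC.exists_bound (f : LinftyC 𝕜 B μ) : ∃ M : ℝ≥0, ∀ᵐ x ∂μ, ‖f.1 x‖ₑ ≤ M := by
  have := f.2.1.eLpNorm_lt_top
  refine ⟨(eLpNorm f.1 ∞ μ).toNNReal, ?_⟩
  rw [ENNReal.coe_toNNReal this.ne, eLpNorm_exponent_top]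
  exact ae_le_eLpNormEssSup

/-- `c χ_P` as an element of `L^∞_c`, for a compact set `P`. -/
def indC [OpensMeasurableSpace X] (𝕜 : Type*) [RCLike 𝕜] [NormedSpace 𝕜 B] (μ : Measure X)
    (P : Set X) (hP : IsCompact P) (c : B) : LinftyC 𝕜 B μ :=
  ⟨AEEqFun.mk (P.indicator fun _ => c)
    (aestronglyMeasurable_const.indicator hP.isClosed.measurableSet),
    (memLp_congr_ae (AEEqFun.coeFn_mk _ _)).2 (memLp_top_of_bound
      (aestronglyMeasurable_const.indicator hP.isClosed.measurableSet) ‖c‖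
      (Eventually.of_forall fun x => norm_indicator_le_norm_self _ _)), P, hP, by
      filter_upwards [AEEqFun.coeFn_mk (P.indicator fun _ => c) (μ := μ)
        (aestronglyMeasurable_const.indicator hP.isClosed.measurableSet)] with x hx hxP
      rw [hx, indicator_of_notMem hxP]⟩

theorem coeFn_indC [OpensMeasurableSpace X] {P : Set X} (hP : IsCompact P) (c : B) :
    (indC 𝕜 μ P hP c).1 =ᵐ[μ] P.indicator fun _ => c := AEEqFun.coeFn_mk _ _

theorem concentratedOn_indC [OpensMeasurableSpace X] {P : Set X} (hP : IsCompact P) (c : B) :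
    ConcentratedOn (indC 𝕜 μ P hP c).1 P := by
  filter_upwards [coeFn_indC (𝕜 := 𝕜) (μ := μ) hP c] with x hx hxP
  rw [hx, indicator_of_notMem hxP]

end Cut

/-! ### Layer-cake integrals -/

section PowerIntegrals

theorem lintegral_rpow_below_ofReal {s : ℝ} (hs : 0 < s) {a : ℝ} (ha : 0 ≤ a) :
    ∫⁻ t in Ioi (0 : ℝ), (if ENNReal.ofReal t < ENNReal.ofReal a then
      ENNReal.ofReal (t ^ (s - 1)) else 0) = ENNReal.ofReal a ^ s / ENNReal.ofReal s := by
  have h1 : ∫⁻ t in Ioi (0 : ℝ),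
      (if ENNReal.ofReal t < ENNReal.ofReal a then ENNReal.ofReal (t ^ (s - 1)) else 0) =
      ∫⁻ t in Ioo 0 a, ENNReal.ofReal (t ^ (s - 1)) := by
    rw [← lintegral_indicator measurableSet_Ioi, ← lintegral_indicator measurableSet_Ioo]
    congr 1 with t
    by_cases ht : 0 < t
    · by_cases hta : t < a
      · have : ENNReal.ofReal t < ENNReal.ofReal a :=
          (ENNReal.ofReal_lt_ofReal_iff (ht.trans hta)).2 hta
        simp [ht, hta, this]
      · have : ¬ ENNReal.ofReal t < ENNReal.ofReal a :=
          not_lt.2 (ENNReal.ofReal_le_ofReal (not_lt.1 hta))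
        simp [hta, this]
    · simp [ht]
  have h2 : IntegrableOn (fun t : ℝ => t ^ (s - 1)) (Ioc 0 a) := by
    have := intervalIntegral.intervalIntegrable_rpow' (a := 0) (b := a)
      (show -1 < s - 1 by linarith)
    rwa [intervalIntegrable_iff, uIoc_of_le ha] at this
  rw [h1, restrict_Ioo_eq_restrict_Ioc, ← ofReal_integral_eq_lintegral_ofReal h2,
    ← intervalIntegral.integral_of_le ha, integral_rpow (Or.inl (by linarith)),
    sub_add_cancel, Real.zero_rpow hs.ne', sub_zero, ENNReal.ofReal_div_of_pos hs,
    ENNReal.ofReal_rpow_of_nonneg ha hs.le]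
  filter_upwards [ae_restrict_mem measurableSet_Ioc] with t ht
  exact Real.rpow_nonneg ht.1.le _

/-- This is the integral of t^(s-1) over (0, y). For y = ∞ it exceeds every finite number, by
comparison with a finite endpoint whose integral is that number. -/
theorem lintegral_rpow_below {s : ℝ} (hs : 0 < s) (y : ℝ≥0∞) :
    ∫⁻ t in Ioi (0 : ℝ), (if ENNReal.ofReal t < y then ENNReal.ofReal (t ^ (s - 1)) else 0) =
      y ^ s / ENNReal.ofReal s := by
  by_cases hy : y = ∞
  · subst hy
    rw [ENNReal.top_rpow_of_pos hs, ENNReal.top_div_of_ne_top ENNReal.ofReal_ne_top]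
    refine ENNReal.eq_top_of_forall_nnreal_le fun r => ?_
    have h0 : (0 : ℝ) ≤ (r * s) ^ (1 / s) := by positivity
    have := lintegral_rpow_below_ofReal hs h0
    rw [ENNReal.ofReal_rpow_of_nonneg h0 hs.le, ← Real.rpow_mul (by positivity),
      one_div_mul_cancel hs.ne', Real.rpow_one, ← ENNReal.ofReal_div_of_pos hs,
      mul_div_cancel_right₀ _ hs.ne', ENNReal.ofReal_coe_nnreal] at this
    rw [← this]
    refine lintegral_mono fun t => ?_
    dsimp only
    split_ifs with h1 h2
    · exact le_rfl
    · exact absurd ENNReal.ofReal_lt_top h2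
    · exact zero_le
    · exact zero_le
  · rw [← ENNReal.ofReal_toReal hy]
    exact lintegral_rpow_below_ofReal hs ENNReal.toReal_nonneg

theorem lintegral_rpow_above {s b : ℝ} (hs : 0 < s) (hsb : s < b) {y : ℝ≥0∞}
    (hy : y ≠ ∞) :
    ∫⁻ t in Ioi (0 : ℝ), (if ENNReal.ofReal t < y then 0 else
      ENNReal.ofReal (t ^ (- s - 1)) * y ^ b) = y ^ (b - s) / ENNReal.ofReal s := by
  have hb : 0 < b := hs.trans hsb
  by_cases hy0 : y = 0
  · subst hy0
    simp [hb, hsb]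
  rw [← ENNReal.ofReal_toReal hy]
  have ha : 0 < y.toReal := ENNReal.toReal_pos hy0 hy
  generalize y.toReal = a at ha
  have h1 : ∫⁻ t in Ioi (0 : ℝ), (if ENNReal.ofReal t < ENNReal.ofReal a then 0 else
      ENNReal.ofReal (t ^ (- s - 1)) * ENNReal.ofReal a ^ b) =
      ∫⁻ t in Ioi a, ENNReal.ofReal (t ^ (- s - 1)) * ENNReal.ofReal a ^ b := by
    rw [restrict_Ioi_eq_restrict_Ici (a := a), ← lintegral_indicator measurableSet_Ioi,
      ← lintegral_indicator measurableSet_Ici]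
    congr 1 with t
    by_cases hta : a ≤ t
    · have : ¬ ENNReal.ofReal t < ENNReal.ofReal a := not_lt.2 (ENNReal.ofReal_le_ofReal hta)
      simp [ha.trans_le hta, hta, this]
    · have : ENNReal.ofReal t < ENNReal.ofReal a :=
        (ENNReal.ofReal_lt_ofReal_iff ha).2 (not_le.1 hta)
      simp only [indicator, mem_Ioi, this, if_true, mem_Ici, hta, if_false]
      split_ifs <;> rfl
  rw [h1, lintegral_mul_const _ (by fun_prop), ← ofReal_integral_eq_lintegral_ofReal
    (integrableOn_Ioi_rpow_of_lt (by linarith) ha), integral_Ioi_rpow_of_lt (by linarith) ha]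
  · rw [ENNReal.ofReal_rpow_of_pos ha, ENNReal.ofReal_rpow_of_pos ha,
      ← ENNReal.ofReal_div_of_pos hs, ← ENNReal.ofReal_mul]
    · congr 1
      rw [show -s - 1 + 1 = -s by ring, neg_div_neg_eq, div_mul_eq_mul_div, ← Real.rpow_add ha]
      congr 2
      ring
    · rw [show -s - 1 + 1 = -s by ring, neg_div_neg_eq]
      positivity
  · filter_upwards [ae_restrict_mem measurableSet_Ioi] with t ht
    exact Real.rpow_nonneg (ha.trans ht).le _

variable {X : Type*} [MeasurableSpace X] {μ : Measure X}

/-- Integrate an inequality between integrals over a parameter in `(0, ∞)`. -/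
theorem lintegral_lintegral_Ioi_le [SFinite μ] {v F : X → ℝ≥0∞} (hv : AEMeasurable v μ)
    (hF : AEMeasurable F μ) {g h : ℝ → ℝ≥0∞ → ℝ≥0∞} (hg : Measurable (Function.uncurry g))
    (hh : Measurable (Function.uncurry h))
    (hle : ∀ t : ℝ, 0 < t → ∫⁻ x, g t (v x) ∂μ ≤ ∫⁻ x, h t (F x) ∂μ) :
    ∫⁻ x, (∫⁻ t in Ioi (0 : ℝ), g t (v x)) ∂μ ≤ ∫⁻ x, (∫⁻ t in Ioi (0 : ℝ), h t (F x)) ∂μ := by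
  have key : ∀ (w : X → ℝ≥0∞) (_ : AEMeasurable w μ) (k : ℝ → ℝ≥0∞ → ℝ≥0∞)
      (_ : Measurable (Function.uncurry k)), ∫⁻ x, (∫⁻ t in Ioi (0 : ℝ), k t (w x)) ∂μ =
      ∫⁻ t in Ioi (0 : ℝ), ∫⁻ x, k t (w x) ∂μ := by
    intro w hw k hk
    refine lintegral_lintegral_swap ?_
    exact hk.comp_aemeasurable (measurable_snd.aemeasurable.prodMk hw.comp_fst)
  rw [key v hv g hg, key F hF h hh]
  exact setLIntegral_mono' measurableSet_Ioi fun t ht => hle t ht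

end PowerIntegrals

/-! ### Marcinkiewicz interpolation between weak types (1, 1) and (r, r) -/

section Interpolation

variable {X : Type*} [MeasurableSpace X] [MetricSpace X] {𝕜 : Type*} [RCLike 𝕜]
  {B : Type*} [NormedAddCommGroup B] [NormedSpace 𝕜 B] {μ : Measure X}

/-- Weak type `(r, r)` with constant `A`, for an operator on functions concentrated on `Y`. -/
def HasWeakType (U : LinftyC 𝕜 B μ → X → ℝ≥0∞) (Y : Set X) (r : ℝ≥0∞) (A : ℝ≥0) : Prop :=
  ∀ f : LinftyC 𝕜 B μ, ConcentratedOn f.1 Y →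
    (r = ∞ → ∀ᵐ x ∂μ, U f x ≤ A * eLpNorm f.1 ∞ μ) ∧
    (r ≠ ∞ → ∀ t : ℝ≥0, t ≠ 0 → (t : ℝ≥0∞) ^ r.toReal * μ {x | (t : ℝ≥0∞) < U f x} ≤
      (A : ℝ≥0∞) ^ r.toReal * ∫⁻ x, ‖f.1 x‖ₑ ^ r.toReal ∂μ)

theorem HasWeakType.mono {U : LinftyC 𝕜 B μ → X → ℝ≥0∞} {Y Y' : Set X} {r : ℝ≥0∞} {A A' : ℝ≥0}
    (h : HasWeakType U Y r A) (hY : Y' ⊆ Y) (hA : A ≤ A') : HasWeakType U Y' r A' := by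
  intro f hf
  obtain ⟨h1, h2⟩ := h f (hf.mono hY)
  refine ⟨fun hr => ?_, fun hr t ht => (h2 hr t ht).trans (by gcongr)⟩
  filter_upwards [h1 hr] with x hx
  exact hx.trans (by gcongr)

/-- The operator `U` is subadditive on functions concentrated on `Y`. -/
def SubadditiveOn (U : LinftyC 𝕜 B μ → X → ℝ≥0∞) (Y : Set X) : Prop :=
  ∀ f g : LinftyC 𝕜 B μ, ConcentratedOn f.1 Y → ConcentratedOn g.1 Y →
    ∀ᵐ x ∂μ, U (f + g) x ≤ U f x + U g x

theorem measurable_enorm_coeFn (f : LinftyC 𝕜 B μ) : Measurable fun x => ‖f.1 x‖ₑ :=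
  (AEEqFun.stronglyMeasurable f.1).enorm

theorem lintegral_enorm_cutC_rpow {S : Set X} (hS : MeasurableSet S) (f : LinftyC 𝕜 B μ)
    {r : ℝ} (hr : 0 < r) : ∫⁻ x, ‖(cutC S hS.nullMeasurableSet f).1 x‖ₑ ^ r ∂μ =
      ∫⁻ x in S, ‖f.1 x‖ₑ ^ r ∂μ := by
  rw [← lintegral_indicator hS]
  refine lintegral_congr_ae ?_
  filter_upwards [coeFn_cutC S hS.nullMeasurableSet f] with x hx
  rw [hx]
  by_cases h : x ∈ S <;> simp [h, hr]

theorem lintegral_enorm_cutC {S : Set X} (hS : MeasurableSet S) (f : LinftyC 𝕜 B μ) :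
    ∫⁻ x, ‖(cutC S hS.nullMeasurableSet f).1 x‖ₑ ∂μ = ∫⁻ x in S, ‖f.1 x‖ₑ ∂μ := by
  simpa using lintegral_enorm_cutC_rpow hS f one_pos

/-- The constant of the Marcinkiewicz interpolation theorem. -/
def marcinkiewiczConst (r q : ℝ≥0∞) : ℝ≥0∞ := q / (q - 1) + 1 / (r / q - 1)

/-- f is cut where 2 M |f| exceeds t, and each part is allotted the level t/2. Weak type (1, 1) is
applied to the large part and weak type (r, r) to the small part; cutting at the scaled height lets
both terms be expressed in 2 M |f|. -/
theorem marcinkiewicz_level {U : LinftyC 𝕜 B μ → X → ℝ≥0∞} {Y : Set X} {r : ℝ≥0∞} {M : ℝ≥0}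
    (hM : 0 < M) (hadd : SubadditiveOn U Y)
    (h1 : ∀ f : LinftyC 𝕜 B μ, ConcentratedOn f.1 Y → ∀ t : ℝ≥0, t ≠ 0 →
      t * μ {x | (t : ℝ≥0∞) < U f x} ≤ M * ∫⁻ x, ‖f.1 x‖ₑ ∂μ)
    (hr1 : 1 < r) (hr : HasWeakType U Y r M)
    (f : LinftyC 𝕜 B μ) (hf : ConcentratedOn f.1 Y) {t : ℝ} (ht : 0 < t) :
    μ {x | ENNReal.ofReal t < U f x} ≤
      ENNReal.ofReal (t⁻¹) * ∫⁻ x, (if ENNReal.ofReal t < 2 * M * ‖f.1 x‖ₑ then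
        2 * M * ‖f.1 x‖ₑ else 0) ∂μ +
      (if r = ∞ then 0 else ENNReal.ofReal (t ^ (- r.toReal)) *
        ∫⁻ x, (if ENNReal.ofReal t < 2 * M * ‖f.1 x‖ₑ then 0 else
          (2 * M * ‖f.1 x‖ₑ) ^ r.toReal) ∂μ) := by
  have hF : Measurable fun x => 2 * (M : ℝ≥0∞) * ‖f.1 x‖ₑ := (measurable_enorm_coeFn f).const_mul _
  set S : Set X := {x | ENNReal.ofReal t < 2 * M * ‖f.1 x‖ₑ} with hSdef
  have hS : MeasurableSet S := measurableSet_lt measurable_const hF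
  set f₀ := cutC S hS.nullMeasurableSet f with hf₀
  set f₁ := cutC Sᶜ hS.nullMeasurableSet.compl f with hf₁
  have hc₀ : ConcentratedOn f₀.1 Y := (concentratedOn_cutC _ hf).mono inter_subset_right
  have hc₁ : ConcentratedOn f₁.1 Y := (concentratedOn_cutC _ hf).mono inter_subset_right
  have hsum : f₀ + f₁ = f := cutC_add_cutC_compl S hS.nullMeasurableSet f
  lift t to ℝ≥0 using ht.le
  simp only [ENNReal.ofReal_coe_nnreal] at *
  have ht0 : t ≠ 0 := fun h => by simp [h] at ht
  have ht' : (t : ℝ≥0∞) ≠ 0 := by exact_mod_cast ht0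
  have ht2 : (t / 2 : ℝ≥0) ≠ 0 := by positivity
  have hhalf : ((t / 2 : ℝ≥0) : ℝ≥0∞) + (t / 2 : ℝ≥0) = t := by
    rw [← ENNReal.coe_add, add_halves]
  have hsub : μ {x | (t : ℝ≥0∞) < U f x} ≤ μ {x | ((t / 2 : ℝ≥0) : ℝ≥0∞) < U f₀ x} +
      μ {x | ((t / 2 : ℝ≥0) : ℝ≥0∞) < U f₁ x} := by
    refine (measure_mono_ae ?_).trans (measure_union_le _ _)
    filter_upwards [hadd f₀ f₁ hc₀ hc₁] with x hx hxt
    rw [hsum] at hx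
    by_contra hcon
    have h2 : ¬ (x ∈ {x | ((t / 2 : ℝ≥0) : ℝ≥0∞) < U f₀ x} ∪
      {x | ((t / 2 : ℝ≥0) : ℝ≥0∞) < U f₁ x}) := hcon
    simp only [mem_union, mem_ofPred_eq, not_or, not_lt] at h2
    have h3 : U f x ≤ t := hx.trans ((add_le_add h2.1 h2.2).trans hhalf.le)
    exact absurd hxt (not_lt.2 h3)
  refine hsub.trans (add_le_add ?_ ?_)
  · have h2 := h1 f₀ hc₀ (t / 2) ht2
    rw [lintegral_enorm_cutC hS] at h2
    have h3 : ∫⁻ x, (if (t : ℝ≥0∞) < 2 * M * ‖f.1 x‖ₑ then 2 * M * ‖f.1 x‖ₑ else 0) ∂μ =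
        2 * M * ∫⁻ x in S, ‖f.1 x‖ₑ ∂μ := by
      rw [← lintegral_const_mul _ (measurable_enorm_coeFn f), ← lintegral_indicator hS]
      refine lintegral_congr fun x => ?_
      simp [indicator, hSdef]
    have ht2' : ((t / 2 : ℝ≥0) : ℝ≥0∞) ≠ 0 := by exact_mod_cast ht2
    have h4 : (2 : ℝ≥0∞) * (t / 2 : ℝ≥0) = t := by rw [two_mul, hhalf]
    rw [h3, ENNReal.ofReal_inv_of_pos ht, ENNReal.ofReal_coe_nnreal, ← ENNReal.div_eq_inv_mul,
      ENNReal.le_div_iff_mul_le (Or.inl ht') (Or.inl ENNReal.coe_ne_top), mul_comm, ← h4, mul_assoc,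
      mul_assoc]
    gcongr
  · split_ifs with htop
    · have h2 := (hr f₁ hc₁).1 htop
      suffices ∀ᵐ x ∂μ, ¬ ((t / 2 : ℝ≥0) : ℝ≥0∞) < U f₁ x by
        simpa only [ae_iff, not_not, nonpos_iff_eq_zero] using this
      -- For r = ∞ the cut makes the image of the small part at most t/2, so that this part
      -- contributes nothing.
      have h3 : (M : ℝ≥0∞) * eLpNorm f₁.1 ∞ μ ≤ (t / 2 : ℝ≥0) := by
        have : eLpNorm f₁.1 ∞ μ ≤ ((t / 2 / M : ℝ≥0) : ℝ≥0∞) := by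
          rw [eLpNorm_exponent_top]
          refine eLpNormEssSup_le_of_ae_enorm_bound ?_
          filter_upwards [coeFn_cutC Sᶜ hS.nullMeasurableSet.compl f] with x hx
          rw [hf₁, hx]
          by_cases hxS : x ∈ S
          · simp [hxS]
          · rw [indicator_of_mem (show x ∈ Sᶜ from hxS)]
            have h5 : 2 * (M : ℝ≥0∞) * ‖f.1 x‖ₑ ≤ t := by
              rw [hSdef] at hxS; exact not_lt.1 hxS
            have h6 : ‖f.1 x‖ₑ = ((‖f.1 x‖₊ : ℝ≥0) : ℝ≥0∞) := rfl
            rw [h6] at h5 ⊢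
            have h7 : 2 * M * ‖f.1 x‖₊ ≤ t := by exact_mod_cast h5
            rw [ENNReal.coe_le_coe, le_div_iff₀ hM, le_div_iff₀ two_pos]
            linarith [h7]
        calc (M : ℝ≥0∞) * eLpNorm f₁.1 ∞ μ ≤ M * ((t / 2 / M : ℝ≥0) : ℝ≥0∞) := by gcongr
          _ = _ := by
            rw [← ENNReal.coe_mul, mul_div_cancel₀ _ hM.ne']
      filter_upwards [h2] with x hx
      simpa using hx.trans h3
    · have h2 := (hr f₁ hc₁).2 htop (t / 2) ht2
      have hrpos : 0 < r.toReal := ENNReal.toReal_pos (zero_lt_one.trans hr1).ne' htop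
      rw [lintegral_enorm_cutC_rpow hS.compl f hrpos] at h2
      have h3 : ∫⁻ x, (if (t : ℝ≥0∞) < 2 * M * ‖f.1 x‖ₑ then 0 else
          (2 * M * ‖f.1 x‖ₑ) ^ r.toReal) ∂μ =
          2 ^ r.toReal * (M ^ r.toReal * ∫⁻ x in Sᶜ, ‖f.1 x‖ₑ ^ r.toReal ∂μ) := by
        rw [← lintegral_const_mul _ ((measurable_enorm_coeFn f).pow_const _),
          ← lintegral_const_mul _ (((measurable_enorm_coeFn f).pow_const _).const_mul _),
          ← lintegral_indicator hS.compl]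
        refine lintegral_congr fun x => ?_
        by_cases hx : x ∈ S
        · have hx' : (t : ℝ≥0∞) < 2 * M * ‖f.1 x‖ₑ := by rw [hSdef] at hx; exact hx
          simp [hx, hx']
        · have hx' : ¬ (t : ℝ≥0∞) < 2 * M * ‖f.1 x‖ₑ := by rw [hSdef] at hx; exact hx
          simp only [hx', if_false, indicator, mem_compl_iff, hx, not_false_iff, if_true]
          rw [ENNReal.mul_rpow_of_nonneg _ _ hrpos.le, ENNReal.mul_rpow_of_nonneg _ _ hrpos.le,
            mul_assoc]
      have h4 : (2 : ℝ≥0∞) ^ r.toReal * ((t / 2 : ℝ≥0) : ℝ≥0∞) ^ r.toReal =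
          (t : ℝ≥0∞) ^ r.toReal := by
        rw [← ENNReal.mul_rpow_of_nonneg _ _ hrpos.le, two_mul, hhalf]
      rw [h3, ← ENNReal.ofReal_rpow_of_pos ht, ENNReal.ofReal_coe_nnreal, ENNReal.rpow_neg,
        ← ENNReal.div_eq_inv_mul,
        ENNReal.le_div_iff_mul_le (Or.inl (by positivity)) (Or.inl (by simp [hrpos.le])),
        mul_comm, ← h4, mul_assoc]
      gcongr

/-- The level estimate is multiplied by t^(q-1) and integrated in t. The range 2 M |f| > t yields
1/(q-1), the complementary range 1/(r-q). -/
theorem marcinkiewicz_aux [SFinite μ] {U : LinftyC 𝕜 B μ → X → ℝ≥0∞} {Y : Set X} {r : ℝ≥0∞}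
    {M : ℝ≥0} (hM : 0 < M) (hmeas : ∀ f, AEMeasurable (U f) μ) (hadd : SubadditiveOn U Y)
    (h1 : ∀ f : LinftyC 𝕜 B μ, ConcentratedOn f.1 Y → ∀ t : ℝ≥0, t ≠ 0 →
      t * μ {x | (t : ℝ≥0∞) < U f x} ≤ M * ∫⁻ x, ‖f.1 x‖ₑ ∂μ)
    (hr : HasWeakType U Y r M) {q : ℝ} (hq : 1 < q) (hqr : ENNReal.ofReal q < r)
    (f : LinftyC 𝕜 B μ) (hf : ConcentratedOn f.1 Y) :
    ∫⁻ x, U f x ^ q / ENNReal.ofReal q ∂μ ≤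
      ∫⁻ x, ((2 * M * ‖f.1 x‖ₑ) ^ q / ENNReal.ofReal (q - 1) + (if r = ∞ then 0 else
        (2 * M * ‖f.1 x‖ₑ) ^ q / ENNReal.ofReal (r.toReal - q))) ∂μ := by
  have hr1 : 1 < r := (ENNReal.one_lt_ofReal.2 hq).trans hqr
  have hq0 : 0 < q := by linarith
  have hF : Measurable fun x => 2 * (M : ℝ≥0∞) * ‖f.1 x‖ₑ := (measurable_enorm_coeFn f).const_mul _
  let g : ℝ → ℝ≥0∞ → ℝ≥0∞ := fun t y =>
    if ENNReal.ofReal t < y then ENNReal.ofReal (t ^ (q - 1)) else 0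
  let h : ℝ → ℝ≥0∞ → ℝ≥0∞ := fun t y =>
    (if ENNReal.ofReal t < y then ENNReal.ofReal (t ^ (q - 1 - 1)) else 0) * y +
      if r = ∞ then 0 else
        (if ENNReal.ofReal t < y then 0 else
          ENNReal.ofReal (t ^ (-(r.toReal - q) - 1)) * y ^ r.toReal)
  have hlt : MeasurableSet {a : ℝ × ℝ≥0∞ | ENNReal.ofReal a.1 < a.2} :=
    measurableSet_lt (by fun_prop) (by fun_prop)
  have hg : Measurable (Function.uncurry g) := Measurable.ite hlt (by fun_prop) (by fun_prop)
  have hh : Measurable (Function.uncurry h) := by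
    refine ((Measurable.ite hlt (by fun_prop) (by fun_prop)).mul measurable_snd).add ?_
    by_cases htop : r = ∞
    · simp [htop]
    · simp only [htop, if_false]
      exact Measurable.ite hlt (by fun_prop) (by fun_prop)
  have key := lintegral_lintegral_Ioi_le (hmeas f) hF.aemeasurable hg hh ?_
  · have hgi : ∀ y, ∫⁻ t in Ioi (0 : ℝ), g t y = y ^ q / ENNReal.ofReal q :=
      lintegral_rpow_below hq0
    have hhi : ∀ y, y ≠ ∞ → ∫⁻ t in Ioi (0 : ℝ), h t y = y ^ q / ENNReal.ofReal (q - 1) +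
        (if r = ∞ then 0 else y ^ q / ENNReal.ofReal (r.toReal - q)) := by
      intro y hy
      have hm : Measurable fun t : ℝ =>
          (if ENNReal.ofReal t < y then ENNReal.ofReal (t ^ (q - 1 - 1)) else 0) :=
        Measurable.ite (measurableSet_lt (by fun_prop) measurable_const) (by fun_prop)
          (by fun_prop)
      rw [lintegral_add_left (hm.mul_const y), lintegral_mul_const _ hm,
        lintegral_rpow_below (by linarith : 0 < q - 1)]
      congr 1
      · rw [ENNReal.mul_div_right_comm.symm]
        congr 1
        rcases eq_or_ne y 0 with rfl | hy0
        · simp [hq0]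
        · nth_rewrite 2 [← ENNReal.rpow_one y]
          rw [← ENNReal.rpow_add _ _ hy0 hy, sub_add_cancel]
      · by_cases htop : r = ∞
        · simp [htop]
        · simp only [htop, if_false]
          have : q < r.toReal := by
            rwa [← ENNReal.ofReal_lt_iff_lt_toReal hq0.le htop]
          rw [lintegral_rpow_above (by linarith) (by linarith) hy, sub_sub_cancel]
    simp only [hgi] at key
    refine key.trans (le_of_eq (lintegral_congr fun x => hhi _ ?_))
    exact ENNReal.mul_ne_top (by finiteness) enorm_ne_top
  · intro t ht
    have hl := marcinkiewicz_level hM hadd h1 hr1 hr f hf ht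
    have h3 : ∫⁻ x, g t (U f x) ∂μ =
        ENNReal.ofReal (t ^ (q - 1)) * μ {x | ENNReal.ofReal t < U f x} := by
      have hn : NullMeasurableSet {x | ENNReal.ofReal t < U f x} μ :=
        nullMeasurableSet_lt aemeasurable_const (hmeas f)
      rw [← lintegral_indicator_const₀ hn]
      refine lintegral_congr fun x => ?_
      simp [g, indicator]
    rw [h3]
    refine (mul_le_mul_right hl _).trans ?_
    have hlt' : MeasurableSet {x | ENNReal.ofReal t < 2 * M * ‖f.1 x‖ₑ} :=
      measurableSet_lt measurable_const hF
    have hma : Measurable fun x => (if ENNReal.ofReal t < 2 * M * ‖f.1 x‖ₑ then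
        ENNReal.ofReal (t ^ (q - 1 - 1)) else 0) * (2 * M * ‖f.1 x‖ₑ) :=
      (Measurable.ite hlt' measurable_const measurable_const).mul hF
    rw [mul_add, lintegral_add_left hma]
    refine add_le_add (le_of_eq ?_) (le_of_eq ?_)
    · rw [← mul_assoc, ← ENNReal.ofReal_mul (by positivity), ← lintegral_const_mul]
      · refine lintegral_congr fun x => ?_
        split_ifs with hx
        · congr 2
          rw [Real.rpow_sub_one ht.ne' (q - 1), div_eq_mul_inv]
        · simp
      · exact Measurable.ite hlt' hF measurable_const
    · by_cases htop : r = ∞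
      · simp [htop]
      · simp only [htop, if_false]
        rw [← mul_assoc, ← ENNReal.ofReal_mul (by positivity), ← lintegral_const_mul]
        · refine lintegral_congr fun x => ?_
          split_ifs with hx
          · simp
          · congr 2
            rw [← Real.rpow_add ht]
            congr 1
            ring
        · exact Measurable.ite hlt' measurable_const (hF.pow_const _)

/-- **Marcinkiewicz interpolation** between weak type `(1, 1)` and weak type `(r, r)`. -/
theorem marcinkiewicz [SFinite μ] {U : LinftyC 𝕜 B μ → X → ℝ≥0∞} {Y : Set X} {r : ℝ≥0∞}
    {M : ℝ≥0} (hM : 0 < M) (hmeas : ∀ f, AEMeasurable (U f) μ) (hadd : SubadditiveOn U Y)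
    (h1 : ∀ f : LinftyC 𝕜 B μ, ConcentratedOn f.1 Y → ∀ t : ℝ≥0, t ≠ 0 →
      t * μ {x | (t : ℝ≥0∞) < U f x} ≤ M * ∫⁻ x, ‖f.1 x‖ₑ ∂μ)
    (hr : HasWeakType U Y r M) {q : ℝ} (hq : 1 < q) (hqr : ENNReal.ofReal q < r)
    (f : LinftyC 𝕜 B μ) (hf : ConcentratedOn f.1 Y) :
    ∫⁻ x, U f x ^ q ∂μ ≤ marcinkiewiczConst r (ENNReal.ofReal q) *
      ((2 * M) ^ q * ∫⁻ x, ‖f.1 x‖ₑ ^ q ∂μ) := by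
  have key := marcinkiewicz_aux hM hmeas hadd h1 hr hq hqr f hf
  have hq0 : 0 < q := by linarith
  have hqe : ENNReal.ofReal q ≠ 0 := by simpa using hq0
  have hm : Measurable fun x => (2 * (M : ℝ≥0∞) * ‖f.1 x‖ₑ) ^ q :=
    ((measurable_enorm_coeFn f).const_mul _).pow_const _
  have hI : ∫⁻ x, (2 * (M : ℝ≥0∞) * ‖f.1 x‖ₑ) ^ q ∂μ = (2 * M) ^ q * ∫⁻ x, ‖f.1 x‖ₑ ^ q ∂μ := by
    rw [← lintegral_const_mul _ ((measurable_enorm_coeFn f).pow_const _)]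
    refine lintegral_congr fun x => ?_
    rw [ENNReal.mul_rpow_of_nonneg _ _ hq0.le]
  rw [← hI]
  simp only [div_eq_mul_inv] at key
  rw [lintegral_mul_const'' _ ((hmeas f).pow_const q), ← div_eq_mul_inv,
    ENNReal.div_le_iff hqe ENNReal.ofReal_ne_top] at key
  refine key.trans (le_of_eq ?_)
  rw [lintegral_add_left (hm.mul_const _), lintegral_mul_const _ hm, marcinkiewiczConst, add_mul,
    add_mul]
  congr 1
  · rw [← ENNReal.ofReal_one, ← ENNReal.ofReal_sub _ zero_le_one, div_eq_mul_inv]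
    ring
  · by_cases htop : r = ∞
    · simp [htop, ENNReal.top_div_of_ne_top]
    · have hlt : q < r.toReal := by
        rwa [← ENNReal.ofReal_lt_iff_lt_toReal hq0.le htop]
      simp only [htop, if_false]
      rw [lintegral_mul_const _ hm, ← ENNReal.ofReal_toReal htop]
      rw [ENNReal.toReal_ofReal (by positivity), ← ENNReal.ofReal_div_of_pos hq0,
        ← ENNReal.ofReal_one,
        ← ENNReal.ofReal_sub _ zero_le_one, ← ENNReal.ofReal_div_of_pos
          (by rw [sub_pos, one_lt_div hq0]; exact hlt), mul_assoc,
        ← ENNReal.ofReal_inv_of_pos (by linarith), ← ENNReal.ofReal_mul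
          (by rw [inv_nonneg]; linarith), mul_comm]
      congr 2
      have : r.toReal - q ≠ 0 := by linarith
      field_simp

end Interpolation

/-! ### Interpolation between two strong types, with the sharp power of the constants -/

section StrongInterpolation

/-- The function `min (y ^ a) (t ^ (a - b) * y ^ b)`, for `a < b ≤ ∞`. -/
def minPow (a : ℝ) (b : ℝ≥0∞) (t : ℝ) (y : ℝ≥0∞) : ℝ≥0∞ :=
  (if ENNReal.ofReal t < y then y ^ a else 0) +
    if b = ∞ then 0 else
      if ENNReal.ofReal t < y then 0 else ENNReal.ofReal (t ^ (a - b.toReal)) * y ^ b.toReal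

theorem measurable_minPow (a : ℝ) (b : ℝ≥0∞) : Measurable (Function.uncurry (minPow a b)) := by
  have hlt : MeasurableSet {a : ℝ × ℝ≥0∞ | ENNReal.ofReal a.1 < a.2} :=
    measurableSet_lt (by fun_prop) (by fun_prop)
  refine (Measurable.ite hlt (by fun_prop) (by fun_prop)).add ?_
  by_cases htop : b = ∞
  · simp [htop]
  · simp only [htop, if_false]
    exact Measurable.ite hlt (by fun_prop) (by fun_prop)

/-- Homogeneity: the integral is a multiple of y^p. The value c = 1/(p-a) + 1/(b-p), without its
second term when b = ∞, is immaterial, since it cancels in every comparison. -/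
theorem lintegral_minPow {a p : ℝ} {b : ℝ≥0∞} (ha : 0 < a) (hap : a < p)
    (hpb : ENNReal.ofReal p < b) :
    ∃ c : ℝ≥0∞, c ≠ 0 ∧ c ≠ ∞ ∧ ∀ y : ℝ≥0∞, ∫⁻ t in Ioi (0 : ℝ),
      ENNReal.ofReal (t ^ (p - a - 1)) * minPow a b t y = c * y ^ p := by
  have hp : 0 < p := ha.trans hap
  refine ⟨(ENNReal.ofReal (p - a))⁻¹ + if b = ∞ then 0 else (ENNReal.ofReal (b.toReal - p))⁻¹,
    ?_, ?_, fun y => ?_⟩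
  · simp
  · refine ENNReal.add_ne_top.2 ⟨by simpa using hap, ?_⟩
    split_ifs with h
    · simp
    · have : p < b.toReal := by rwa [← ENNReal.ofReal_lt_iff_lt_toReal hp.le h]
      simpa using this
  · have hm : Measurable fun t : ℝ =>
        (if ENNReal.ofReal t < y then ENNReal.ofReal (t ^ (p - a - 1)) else 0) :=
      Measurable.ite (measurableSet_lt (by fun_prop) measurable_const) (by fun_prop)
        (by fun_prop)
    have h1 : ∫⁻ t in Ioi (0 : ℝ), (if ENNReal.ofReal t < y then
        ENNReal.ofReal (t ^ (p - a - 1)) else 0) * y ^ a = (ENNReal.ofReal (p - a))⁻¹ * y ^ p := by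
      rw [lintegral_mul_const _ hm, lintegral_rpow_below (by linarith), ENNReal.div_eq_inv_mul,
        mul_assoc, ← ENNReal.rpow_add_of_nonneg _ _ (by linarith) ha.le, sub_add_cancel]
    have h2 : ∫⁻ t in Ioi (0 : ℝ), ENNReal.ofReal (t ^ (p - a - 1)) * minPow a b t y =
        ∫⁻ t in Ioi (0 : ℝ), ((if ENNReal.ofReal t < y then
          ENNReal.ofReal (t ^ (p - a - 1)) else 0) * y ^ a + if b = ∞ then 0 else
            if ENNReal.ofReal t < y then 0 else
              ENNReal.ofReal (t ^ (-(b.toReal - p) - 1)) * y ^ b.toReal) := by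
      refine setLIntegral_congr_fun measurableSet_Ioi fun t (ht : 0 < t) => ?_
      dsimp only [minPow]
      rw [mul_add]
      congr 1
      · split_ifs <;> simp
      · split_ifs
        · simp
        · simp
        · rw [← mul_assoc, ← ENNReal.ofReal_mul (by positivity), ← Real.rpow_add ht]
          congr 3
          ring
    rw [h2, lintegral_add_left (hm.mul_const _), h1, add_mul]
    by_cases htop : b = ∞
    · simp [htop]
    · have hlt : p < b.toReal := by rwa [← ENNReal.ofReal_lt_iff_lt_toReal hp.le htop]
      simp only [htop, if_false]
      by_cases hy : y = ∞
      · subst hy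
        simp [hp]
      · rw [lintegral_rpow_above (by linarith) (by linarith) hy, sub_sub_cancel,
          ENNReal.div_eq_inv_mul]

theorem minPow_le_left {a : ℝ} {b : ℝ≥0∞} (hab : ENNReal.ofReal a < b)
    (ha : 0 < a) {t : ℝ} (ht : 0 < t) (y : ℝ≥0∞) : minPow a b t y ≤ y ^ a := by
  unfold minPow
  by_cases hty : ENNReal.ofReal t < y
  · simp [hty]
  by_cases htop : b = ∞
  · simp [htop, hty]
  simp only [hty, htop, if_false, zero_add]
  have hlt : a < b.toReal := by rwa [← ENNReal.ofReal_lt_iff_lt_toReal ha.le htop]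
  have h1 : y ^ (b.toReal - a) ≤ ENNReal.ofReal t ^ (b.toReal - a) :=
    ENNReal.rpow_le_rpow (not_lt.1 hty) (by linarith)
  calc ENNReal.ofReal (t ^ (a - b.toReal)) * y ^ b.toReal
      = ENNReal.ofReal (t ^ (a - b.toReal)) * (y ^ (b.toReal - a) * y ^ a) := by
        rw [← ENNReal.rpow_add_of_nonneg _ _ (by linarith) ha.le, sub_add_cancel]
    _ ≤ ENNReal.ofReal (t ^ (a - b.toReal)) * (ENNReal.ofReal t ^ (b.toReal - a) * y ^ a) := by
        gcongr
    _ = y ^ a := by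
        rw [← mul_assoc, ENNReal.ofReal_rpow_of_pos ht, ← ENNReal.ofReal_mul (by positivity),
          ← Real.rpow_add ht]
        simp

theorem minPow_le_right {a : ℝ} {b : ℝ≥0∞} (hab : ENNReal.ofReal a < b) (hb : b ≠ ∞)
    (ha : 0 < a) {t : ℝ} (ht : 0 < t) (y : ℝ≥0∞) :
    minPow a b t y ≤ ENNReal.ofReal (t ^ (a - b.toReal)) * y ^ b.toReal := by
  unfold minPow
  simp only [hb, if_false]
  split_ifs with hty
  · have hlt : a < b.toReal := by rwa [← ENNReal.ofReal_lt_iff_lt_toReal ha.le hb]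
    have h1 : ENNReal.ofReal t ^ (b.toReal - a) ≤ y ^ (b.toReal - a) :=
      ENNReal.rpow_le_rpow hty.le (by linarith)
    calc y ^ a + 0 = ENNReal.ofReal (t ^ (a - b.toReal)) *
          (ENNReal.ofReal t ^ (b.toReal - a) * y ^ a) := by
          rw [← mul_assoc, ENNReal.ofReal_rpow_of_pos ht, ← ENNReal.ofReal_mul (by positivity),
            ← Real.rpow_add ht]
          simp
      _ ≤ ENNReal.ofReal (t ^ (a - b.toReal)) * (y ^ (b.toReal - a) * y ^ a) := by gcongr
      _ = _ := by
        rw [← ENNReal.rpow_add_of_nonneg _ _ (by linarith) ha.le, sub_add_cancel]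
  · simp

/-- A comparison of the truncated powers at every t integrates to a comparison of p-th powers with
the same α and β. Hence the interpolation below has no constant that degenerates as p approaches an
endpoint. -/
theorem lintegral_rpow_le_of_minPow {X : Type*} [MeasurableSpace X] {μ : Measure X} [SFinite μ]
    {v F : X → ℝ≥0∞} (hv : AEMeasurable v μ) (hF : AEMeasurable F μ) {a p : ℝ} {b : ℝ≥0∞}
    (ha : 0 < a) (hap : a < p) (hpb : ENNReal.ofReal p < b) {α β : ℝ≥0∞} (hα : α ≠ ∞)
    (hβ : β ≠ ∞)
    (h : ∀ t : ℝ, 0 < t → α * ∫⁻ x, minPow a b t (v x) ∂μ ≤ β * ∫⁻ x, minPow a b t (F x) ∂μ) :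
    α * ∫⁻ x, v x ^ p ∂μ ≤ β * ∫⁻ x, F x ^ p ∂μ := by
  obtain ⟨c, hc0, hctop, hc⟩ := lintegral_minPow ha hap hpb
  have hm : ∀ γ : ℝ≥0∞, Measurable (Function.uncurry fun (t : ℝ) (y : ℝ≥0∞) =>
      γ * (ENNReal.ofReal (t ^ (p - a - 1)) * minPow a b t y)) := fun γ => by
    refine Measurable.const_mul (Measurable.mul ?_ (measurable_minPow a b)) γ
    fun_prop
  have hmt : ∀ t, Measurable fun y => minPow a b t y := fun t =>
    (measurable_minPow a b).comp measurable_prodMk_left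
  have hmy : ∀ y, Measurable fun t => minPow a b t y := fun y =>
    (measurable_minPow a b).comp measurable_prodMk_right
  have key := lintegral_lintegral_Ioi_le hv hF (hm α) (hm β) fun t ht => by
    rw [lintegral_const_mul' _ _ hα, lintegral_const_mul' _ _ ENNReal.ofReal_ne_top,
      lintegral_const_mul' _ _ hβ, lintegral_const_mul' _ _ ENNReal.ofReal_ne_top,
      mul_left_comm, mul_left_comm β]
    exact mul_le_mul_right (h t ht) _
  simp only [lintegral_const_mul' _ _ hα, lintegral_const_mul' _ _ hβ, hc,
    lintegral_const_mul' _ _ hctop] at key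
  rw [mul_left_comm, mul_left_comm β] at key
  exact (ENNReal.mul_le_mul_iff_right hc0 hctop).1 key

theorem lintegral_minPow_eq {X : Type*} [MeasurableSpace X] {μ : Measure X}
    {a t : ℝ} {b : ℝ≥0∞} (hb : b ≠ ∞) {F : X → ℝ≥0∞} (hF : Measurable F) :
    ∫⁻ x, minPow a b t (F x) ∂μ = ∫⁻ x in {x | ENNReal.ofReal t < F x}, F x ^ a ∂μ +
      ENNReal.ofReal (t ^ (a - b.toReal)) *
        ∫⁻ x in {x | ENNReal.ofReal t < F x}ᶜ, F x ^ b.toReal ∂μ := by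
  have hS : MeasurableSet {x | ENNReal.ofReal t < F x} := measurableSet_lt measurable_const hF
  rw [← lintegral_const_mul' _ _ ENNReal.ofReal_ne_top, ← lintegral_indicator hS,
    ← lintegral_indicator hS.compl, ← lintegral_add_left ((hF.pow_const _).indicator hS)]
  refine lintegral_congr fun x => ?_
  by_cases hx : ENNReal.ofReal t < F x <;> simp [minPow, indicator, hb, hx]

variable {X : Type*} [MeasurableSpace X] [MetricSpace X] {𝕜 : Type*} [RCLike 𝕜]
  {B : Type*} [NormedAddCommGroup B] [NormedSpace 𝕜 B] {μ : Measure X}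

/-- Interpolation between strong type `(a, a)` and strong type `(b, b)`, with `b < ∞`. -/
theorem strong_interpolation [SFinite μ] {U : LinftyC 𝕜 B μ → X → ℝ≥0∞} {Y : Set X}
    (hmeas : ∀ f, AEMeasurable (U f) μ) (hadd : SubadditiveOn U Y) {a p b : ℝ} (ha : 0 < a)
    (hap : a < p) (hpb : p < b) {α κ : ℝ≥0} (hκ : 0 < κ)
    (hUa : ∀ f : LinftyC 𝕜 B μ, ConcentratedOn f.1 Y →
      ∫⁻ x, U f x ^ a ∂μ ≤ α * ∫⁻ x, ‖f.1 x‖ₑ ^ a ∂μ)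
    (hUb : ∀ f : LinftyC 𝕜 B μ, ConcentratedOn f.1 Y →
      ∫⁻ x, U f x ^ b ∂μ ≤ α * κ ^ (b - a) * ∫⁻ x, ‖f.1 x‖ₑ ^ b ∂μ)
    (f : LinftyC 𝕜 B μ) (hf : ConcentratedOn f.1 Y) :
    κ ^ a * ∫⁻ x, (U f x / 2 / κ) ^ p ∂μ ≤ α * ∫⁻ x, ‖f.1 x‖ₑ ^ p ∂μ := by
  have hb : 0 < b := by linarith
  have hbtop : ENNReal.ofReal b ≠ ∞ := ENNReal.ofReal_ne_top
  have hbr : (ENNReal.ofReal b).toReal = b := ENNReal.toReal_ofReal hb.le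
  have hκ0 : (κ : ℝ≥0∞) ≠ 0 := by exact_mod_cast hκ.ne'
  have hF := measurable_enorm_coeFn f
  have hab : ENNReal.ofReal a < ENNReal.ofReal b :=
    (ENNReal.ofReal_lt_ofReal_iff hb).2 (by linarith)
  refine lintegral_rpow_le_of_minPow (b := ENNReal.ofReal b)
    (((hmeas f).div_const _).div_const _) hF.aemeasurable ha hap
    ((ENNReal.ofReal_lt_ofReal_iff hb).2 hpb)
    (ENNReal.rpow_ne_top_of_nonneg ha.le ENNReal.coe_ne_top) ENNReal.coe_ne_top fun t ht => ?_
  rw [lintegral_minPow_eq hbtop hF, hbr]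
  set S : Set X := {x | ENNReal.ofReal t < ‖f.1 x‖ₑ} with hSdef
  have hS : MeasurableSet S := measurableSet_lt measurable_const hF
  set f₀ := cutC S hS.nullMeasurableSet f with hf₀
  set f₁ := cutC Sᶜ hS.nullMeasurableSet.compl f with hf₁
  have hc₀ : ConcentratedOn f₀.1 Y := (concentratedOn_cutC _ hf).mono inter_subset_right
  have hc₁ : ConcentratedOn f₁.1 Y := (concentratedOn_cutC _ hf).mono inter_subset_right
  have hsum : f₀ + f₁ = f := cutC_add_cutC_compl S hS.nullMeasurableSet f
  have h0 := hUa f₀ hc₀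
  have h1 := hUb f₁ hc₁
  rw [lintegral_enorm_cutC_rpow hS f ha] at h0
  rw [lintegral_enorm_cutC_rpow hS.compl f hb] at h1
  set τ : ℝ≥0∞ := ENNReal.ofReal (t ^ (a - b)) with hτ
  -- One of the two parts carries at least half of U f. If it is f₀, the minimum is bounded by its
  -- branch y^a; if it is f₁, by its branch t^(a-b) y^b.
  have hpt : ∀ᵐ x ∂μ, (κ : ℝ≥0∞) ^ a * minPow a (ENNReal.ofReal b) t (U f x / 2 / κ) ≤
      U f₀ x ^ a + τ * κ ^ (a - b) * U f₁ x ^ b := by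
    filter_upwards [hadd f₀ f₁ hc₀ hc₁] with x hx
    rw [hsum] at hx
    have hcases : U f x / 2 ≤ U f₀ x ∨ U f x / 2 ≤ U f₁ x := by
      by_contra! hcon
      have := (ENNReal.add_lt_add hcon.1 hcon.2).trans_eq (ENNReal.add_halves _)
      exact absurd hx (not_le.2 this)
    have hdiv : ∀ s : ℝ, 0 ≤ s → (U f x / 2 / κ) ^ s = κ ^ (-s) * (U f x / 2) ^ s := by
      intro s hs
      rw [ENNReal.div_rpow_of_nonneg _ _ hs, ENNReal.rpow_neg, ENNReal.div_eq_inv_mul]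
    rcases hcases with h2 | h2
    · calc (κ : ℝ≥0∞) ^ a * minPow a (ENNReal.ofReal b) t (U f x / 2 / κ)
          ≤ κ ^ a * (U f x / 2 / κ) ^ a := by gcongr; exact minPow_le_left hab ha ht _
        _ = (U f x / 2) ^ a := by
          rw [hdiv a ha.le, ← mul_assoc, ← ENNReal.rpow_add _ _ hκ0 ENNReal.coe_ne_top]
          simp
        _ ≤ U f₀ x ^ a := by gcongr
        _ ≤ _ := le_self_add
    · calc (κ : ℝ≥0∞) ^ a * minPow a (ENNReal.ofReal b) t (U f x / 2 / κ)
          ≤ κ ^ a * (τ * (U f x / 2 / κ) ^ b) := by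
            gcongr
            have := minPow_le_right hab hbtop ha ht (U f x / 2 / κ)
            rwa [hbr] at this
        _ = τ * κ ^ (a - b) * (U f x / 2) ^ b := by
          rw [hdiv b hb.le, sub_eq_add_neg, ENNReal.rpow_add _ _ hκ0 ENNReal.coe_ne_top]
          ring
        _ ≤ τ * κ ^ (a - b) * U f₁ x ^ b := by gcongr
        _ ≤ _ := le_add_self
  have hκt : (κ : ℝ≥0∞) ^ (a - b) ≠ ∞ := ENNReal.rpow_ne_top_of_ne_zero hκ0 ENNReal.coe_ne_top
  calc (κ : ℝ≥0∞) ^ a * ∫⁻ x, minPow a (ENNReal.ofReal b) t (U f x / 2 / κ) ∂μ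
      = ∫⁻ x, (κ : ℝ≥0∞) ^ a * minPow a (ENNReal.ofReal b) t (U f x / 2 / κ) ∂μ := by
        rw [lintegral_const_mul' _ _ (ENNReal.rpow_ne_top_of_nonneg ha.le ENNReal.coe_ne_top)]
    _ ≤ ∫⁻ x, (U f₀ x ^ a + τ * κ ^ (a - b) * U f₁ x ^ b) ∂μ := lintegral_mono_ae hpt
    _ = ∫⁻ x, U f₀ x ^ a ∂μ + τ * κ ^ (a - b) * ∫⁻ x, U f₁ x ^ b ∂μ := by
        rw [lintegral_add_left' ((hmeas f₀).pow_const _), lintegral_const_mul' _ _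
          (ENNReal.mul_ne_top ENNReal.ofReal_ne_top hκt)]
    _ ≤ α * ∫⁻ x in S, ‖f.1 x‖ₑ ^ a ∂μ + τ * κ ^ (a - b) *
          (α * κ ^ (b - a) * ∫⁻ x in Sᶜ, ‖f.1 x‖ₑ ^ b ∂μ) := by gcongr
    _ = _ := by
        have : (κ : ℝ≥0∞) ^ (a - b) * κ ^ (b - a) = 1 := by
          rw [← ENNReal.rpow_add _ _ hκ0 ENNReal.coe_ne_top]; simp
        rw [mul_add]
        congr 1
        calc _ = ((κ : ℝ≥0∞) ^ (a - b) * κ ^ (b - a)) *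
              (α * (τ * ∫⁻ x in Sᶜ, ‖f.1 x‖ₑ ^ b ∂μ)) := by ring
          _ = _ := by rw [this, one_mul]

/-- Interpolation between strong type `(a, a)` and strong type `(∞, ∞)`. -/
theorem strong_interpolation_top [SFinite μ] {U : LinftyC 𝕜 B μ → X → ℝ≥0∞} {Y : Set X}
    (hmeas : ∀ f, AEMeasurable (U f) μ) (hadd : SubadditiveOn U Y) {a p : ℝ} (ha : 0 < a)
    (hap : a < p) {α κ : ℝ≥0} (hκ : 0 < κ)
    (hUa : ∀ f : LinftyC 𝕜 B μ, ConcentratedOn f.1 Y →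
      ∫⁻ x, U f x ^ a ∂μ ≤ α * ∫⁻ x, ‖f.1 x‖ₑ ^ a ∂μ)
    (hUb : ∀ f : LinftyC 𝕜 B μ, ConcentratedOn f.1 Y →
      ∀ᵐ x ∂μ, U f x ≤ κ * eLpNorm f.1 ∞ μ)
    (f : LinftyC 𝕜 B μ) (hf : ConcentratedOn f.1 Y) :
    κ ^ a * ∫⁻ x, (U f x / 2 / κ) ^ p ∂μ ≤ α * ∫⁻ x, ‖f.1 x‖ₑ ^ p ∂μ := by
  have hκ0 : (κ : ℝ≥0∞) ≠ 0 := by exact_mod_cast hκ.ne'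
  have hF := measurable_enorm_coeFn f
  refine lintegral_rpow_le_of_minPow (b := ∞)
    (((hmeas f).div_const _).div_const _) hF.aemeasurable ha hap ENNReal.ofReal_lt_top
    (ENNReal.rpow_ne_top_of_nonneg ha.le ENNReal.coe_ne_top) ENNReal.coe_ne_top fun t ht => ?_
  set S : Set X := {x | ENNReal.ofReal t < ‖f.1 x‖ₑ} with hSdef
  have hS : MeasurableSet S := measurableSet_lt measurable_const hF
  set f₀ := cutC S hS.nullMeasurableSet f with hf₀
  set f₁ := cutC Sᶜ hS.nullMeasurableSet.compl f with hf₁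
  have hc₀ : ConcentratedOn f₀.1 Y := (concentratedOn_cutC _ hf).mono inter_subset_right
  have hc₁ : ConcentratedOn f₁.1 Y := (concentratedOn_cutC _ hf).mono inter_subset_right
  have hsum : f₀ + f₁ = f := cutC_add_cutC_compl S hS.nullMeasurableSet f
  have h0 := hUa f₀ hc₀
  rw [lintegral_enorm_cutC_rpow hS f ha] at h0
  have hmin : ∫⁻ x, minPow a ∞ t ‖f.1 x‖ₑ ∂μ = ∫⁻ x in S, ‖f.1 x‖ₑ ^ a ∂μ := by
    rw [← lintegral_indicator hS]
    refine lintegral_congr fun x => ?_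
    by_cases hx : ENNReal.ofReal t < ‖f.1 x‖ₑ <;> simp [minPow, indicator, hSdef, hx]
  have hnorm : eLpNorm f₁.1 ∞ μ ≤ ENNReal.ofReal t := by
    rw [eLpNorm_exponent_top]
    refine eLpNormEssSup_le_of_ae_enorm_bound ?_
    filter_upwards [coeFn_cutC Sᶜ hS.nullMeasurableSet.compl f] with x hx
    rw [hf₁, hx]
    by_cases hxS : x ∈ S
    · simp [hxS]
    · rw [indicator_of_mem (show x ∈ Sᶜ from hxS)]
      exact not_lt.1 hxS
  -- Where the truncated power does not vanish, U f / 2 exceeds κ t, while U f₁ is at most κ t; so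
  -- f₀ carries half of U f.
  have hpt : ∀ᵐ x ∂μ, (κ : ℝ≥0∞) ^ a * minPow a ∞ t (U f x / 2 / κ) ≤ U f₀ x ^ a := by
    filter_upwards [hadd f₀ f₁ hc₀ hc₁, hUb f₁ hc₁] with x hx hx1
    rw [hsum] at hx
    unfold minPow
    simp only [if_true, add_zero]
    split_ifs with hlt
    · have h1 : U f₁ x < U f x / 2 := by
        rw [ENNReal.lt_div_iff_mul_lt (Or.inl hκ0) (Or.inl ENNReal.coe_ne_top), mul_comm] at hlt
        exact (hx1.trans (by gcongr)).trans_lt hlt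
      have h2 : U f x / 2 ≤ U f₀ x := by
        by_contra! hcon
        have := (ENNReal.add_lt_add hcon h1).trans_eq (ENNReal.add_halves _)
        exact absurd hx (not_le.2 this)
      rw [← ENNReal.mul_rpow_of_nonneg _ _ ha.le, ENNReal.mul_div_cancel hκ0 ENNReal.coe_ne_top]
      gcongr
    · simp
  rw [hmin, ← lintegral_const_mul' _ _ (ENNReal.rpow_ne_top_of_nonneg ha.le ENNReal.coe_ne_top)]
  exact (lintegral_mono_ae hpt).trans h0

end StrongInterpolation

/-! ### Disjoint refinements and the Calderón–Zygmund covering -/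

section Covering

theorem exists_disjoint_refinement {X ι : Type*} [MeasurableSpace X] [Countable ι] (V : ι → Set X)
    (hV : ∀ i, MeasurableSet (V i)) : ∃ Q : ι → Set X, (∀ i, MeasurableSet (Q i)) ∧
      (∀ i, Q i ⊆ V i) ∧ Pairwise (Function.onFun Disjoint Q) ∧ ⋃ i, Q i = ⋃ i, V i := by
  obtain ⟨e, he⟩ := exists_injective_nat ι
  refine ⟨fun i => V i \ ⋃ j ∈ {j | e j < e i}, V j, fun i => (hV i).diff
    (MeasurableSet.biUnion (to_countable _) fun j _ => hV j), fun i => sdiff_subset, ?_, ?_⟩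
  · have key : ∀ i j, e i < e j → Disjoint (V i \ ⋃ k ∈ {k | e k < e i}, V k)
        (V j \ ⋃ k ∈ {k | e k < e j}, V k) := by
      intro i j hij
      refine disjoint_left.2 fun x hx hx' => hx'.2 (mem_iUnion₂.2 ⟨i, hij, hx.1⟩)
    intro i j hij
    rcases lt_trichotomy (e i) (e j) with h | h | h
    · exact key i j h
    · exact absurd (he h) hij
    · exact (key j i h).symm
  · refine subset_antisymm (iUnion_mono fun i => sdiff_subset) fun x hx => ?_
    have hne : (e '' {i | x ∈ V i}).Nonempty := by
      obtain ⟨i, hi⟩ := mem_iUnion.1 hx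
      exact ⟨e i, i, hi, rfl⟩
    -- The first index, in the enumeration e, whose set contains x.
    obtain ⟨i, hi, hie⟩ := Nat.sInf_mem hne
    refine mem_iUnion.2 ⟨i, hi, fun hcon => ?_⟩
    obtain ⟨j, hj, hxj⟩ := mem_iUnion₂.1 hcon
    have h1 : sInf (e '' {i | x ∈ V i}) ≤ e j := Nat.sInf_le ⟨j, hxj, rfl⟩
    have h2 : e j < e i := hj
    omega

variable {X : Type*} [MetricSpace X] [MeasurableSpace X] [BorelSpace X] {μ : Measure X}

/-- Lebesgue differentiation along the radii R/2^n: the averages of the norm converge to a value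
above α. -/
theorem ae_exists_lt_setLIntegral_closedBall [SecondCountableTopology X]
    [IsLocallyFiniteMeasure μ] [μ.IsOpenPosMeasure] {R : ℝ} {D : ℝ≥0}
    (hD : DoublingUpTo μ R D) (hR : 0 < R) {B : Type*} [NormedAddCommGroup B] {f : X → B}
    (hf : Integrable f μ) (α : ℝ≥0) :
    ∀ᵐ x ∂μ, α < ‖f x‖ₑ → ∃ n : ℕ, α * μ (Metric.closedBall x (R / 2 ^ n)) <
      ∫⁻ y in Metric.closedBall x (R / 2 ^ n), ‖f y‖ₑ ∂μ := by
  have := hD.isUnifLocDoublingMeasure hR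
  filter_upwards [IsUnifLocDoublingMeasure.ae_tendsto_average μ hf.norm.locallyIntegrable 1]
    with x hx hlt
  have hδ : Tendsto (fun n : ℕ => R / 2 ^ n) atTop (𝓝[>] 0) := by
    refine tendsto_nhdsWithin_iff.2 ⟨?_, Eventually.of_forall fun n => ?_⟩
    · have := (tendsto_pow_atTop_nhds_zero_of_lt_one (r := (1 / 2 : ℝ)) (by norm_num)
        (by norm_num)).const_mul R
      simpa [div_eq_mul_inv] using this
    · have : 0 < R / 2 ^ n := by positivity
      exact this
  have hlim := hx (fun _ : ℕ => x) (fun n : ℕ => R / 2 ^ n) hδ (Eventually.of_forall fun n => by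
    simp only [Metric.mem_closedBall, dist_self]; positivity)
  have hα : (α : ℝ) < ‖f x‖ := by
    have h1 : (α : ℝ≥0∞) < (‖f x‖₊ : ℝ≥0∞) := hlt
    exact_mod_cast h1
  obtain ⟨n, hn, hn1⟩ := ((hlim.eventually (lt_mem_nhds hα)).and (eventually_ge_atTop 1)).exists
  refine ⟨n, ?_⟩
  set b := Metric.closedBall x (R / 2 ^ n)
  have hpos : 0 < R / 2 ^ n := by positivity
  have hb0 : μ b ≠ 0 := (Metric.measure_closedBall_pos μ x hpos).ne'
  have hbtop : μ b ≠ ∞ := by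
    refine ((measure_mono (Metric.closedBall_subset_ball (ε₂ := 2 * R) ?_)).trans_lt
      (hD.ball_lt_top hR x le_rfl)).ne
    have : R / 2 ^ n ≤ R := div_le_self hR.le (one_le_pow₀ one_le_two)
    linarith
  have hbr : 0 < μ.real b := ENNReal.toReal_pos hb0 hbtop
  rw [setAverage_eq, smul_eq_mul, lt_inv_mul_iff₀ hbr] at hn
  rw [← ofReal_integral_norm_eq_lintegral_enorm hf.integrableOn,
    ← ENNReal.ofReal_toReal hbtop, ← ENNReal.ofReal_coe_nnreal,
    ← ENNReal.ofReal_mul α.coe_nonneg]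
  refine (ENNReal.ofReal_lt_ofReal_iff ?_).2 ?_
  · exact lt_of_le_of_lt (by positivity) hn
  · rwa [mul_comm] at hn

/-- A Calderón–Zygmund covering at height `α`, by balls with centres in `Y`. -/
theorem exists_calderonZygmund_covering [SecondCountableTopology X]
    [IsLocallyFiniteMeasure μ] [μ.IsOpenPosMeasure] {R : ℝ} {D : ℝ≥0}
    (hD : DoublingUpTo μ R D) (hR : 0 < R) {B : Type*} [NormedAddCommGroup B] {f : X → B}
    (hf : Integrable f μ) (α : ℝ≥0) (Y : Set X) (m : ℕ) (hm : 1 ≤ m)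
    (hbig : ∀ x ∈ Y, ∀ n ≤ m, ∫⁻ y in Metric.closedBall x (R / 2 ^ n), ‖f y‖ₑ ∂μ ≤
      α * μ (Metric.closedBall x (R / 2 ^ n))) :
    ∃ u ⊆ Y, ∃ ρ : X → ℝ, u.Countable ∧ (∀ x ∈ u, 0 < ρ x) ∧ (∀ x ∈ u, ρ x ≤ R / 2 ^ (m + 1)) ∧
      u.PairwiseDisjoint (fun x => Metric.closedBall x (ρ x)) ∧
      (∀ x ∈ u, α * μ (Metric.closedBall x (ρ x)) ≤
        ∫⁻ y in Metric.closedBall x (ρ x), ‖f y‖ₑ ∂μ) ∧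
      (∀ x ∈ u, ∫⁻ y in Metric.closedBall x (4 * ρ x), ‖f y‖ₑ ∂μ ≤
        α * μ (Metric.closedBall x (4 * ρ x))) ∧
      ∀ᵐ x ∂μ, x ∈ Y → x ∉ ⋃ z ∈ u, Metric.closedBall z (4 * ρ z) → ‖f x‖ₑ ≤ α := by
  classical
  let bad : X → ℕ → Prop := fun x n => α * μ (Metric.closedBall x (R / 2 ^ n)) <
      ∫⁻ y in Metric.closedBall x (R / 2 ^ n), ‖f y‖ₑ ∂μ
  let H : Set X := {x ∈ Y | ∃ n, bad x n}
  let N : X → ℕ := fun x => if h : ∃ n, bad x n then Nat.find h else 0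
  let ρ : X → ℝ := fun x => R / 2 ^ N x
  have hN : ∀ x ∈ H, bad x (N x) ∧ ∀ n < N x, ¬ bad x n := by
    intro x hx
    simp only [N, dif_pos hx.2]
    exact ⟨Nat.find_spec hx.2, fun n hn => Nat.find_min hx.2 hn⟩
  have hNm : ∀ x ∈ H, m + 1 ≤ N x := by
    intro x hx
    by_contra! hcon
    exact absurd (hN x hx).1 (not_lt.2 (hbig x hx.1 _ (by omega)))
  have hρpos : ∀ x, 0 < ρ x := fun x => by positivity
  -- The Vitali enlargement factor is taken to be 4, two dyadic steps: the enlarged ball then has a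
  -- radius preceding the stopping radius, where the average is still at most α.
  obtain ⟨u, huH, hdisj, hcov⟩ := Vitali.exists_disjoint_subfamily_covering_enlargement_closedBall
    H (fun x => x) ρ R (fun x _ => div_le_self hR.le (one_le_pow₀ one_le_two)) 4 (by norm_num)
  refine ⟨u, huH.trans fun x hx => hx.1, ρ, ?_, fun x _ => hρpos x, fun x hx => ?_, hdisj,
    fun x hx => (hN x (huH hx)).1.le, fun x hx => ?_, ?_⟩
  · refine hdisj.countable_of_nonempty_interior fun x _ => ?_
    exact ⟨x, mem_interior_iff_mem_nhds.2 (Metric.closedBall_mem_nhds x (hρpos x))⟩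
  · exact div_le_div_of_nonneg_left hR.le (by positivity)
      (pow_le_pow_right₀ one_le_two (hNm x (huH hx)))
  · have h1 := hNm x (huH hx)
    have h2 := (hN x (huH hx)).2 (N x - 2) (by omega)
    have h3 : 4 * ρ x = R / 2 ^ (N x - 2) := by
      have : (2 : ℝ) ^ N x = 2 ^ (N x - 2) * 4 := by
        rw [show (4 : ℝ) = 2 ^ 2 by norm_num, ← pow_add]; congr 1; omega
      simp only [ρ, this]
      field_simp
    rw [h3]
    exact not_lt.1 h2
  · filter_upwards [ae_exists_lt_setLIntegral_closedBall hD hR hf α] with x hx hxY hxu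
    by_contra! hcon
    have hxH : x ∈ H := ⟨hxY, hx hcon⟩
    obtain ⟨z, hz, hxz⟩ := hcov x hxH
    exact hxu (mem_iUnion₂.2 ⟨z, hz, hxz (Metric.mem_closedBall_self (hρpos x).le)⟩)

end Covering

/-! ### Abstract local Calderón–Zygmund operators -/

section WeakType

variable {X : Type*} [MetricSpace X] [MeasurableSpace X] [BorelSpace X] {μ : Measure X}
  {𝕜 : Type*} [RCLike 𝕜] {B : Type*} [NormedAddCommGroup B] [NormedSpace 𝕜 B] [NormedSpace ℝ B]

/-- A subadditive operator `U`, defined on functions concentrated on `Ω` and with values in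
functions on `E`, that satisfies the conditions of the local Calderón–Zygmund theory at scale `R`.
The functions of interest are those concentrated on `Y`. -/
structure IsLocalCZOperator (μ : Measure X) (R : ℝ) (r : ℝ≥0∞) (A C : ℝ≥0) (Y Ω E : Set X)
    (U : LinftyC 𝕜 B μ → X → ℝ≥0∞) : Prop where
  measurableSet : MeasurableSet E
  subset_ball : ∀ x ∈ Y, E ⊆ Metric.ball x R
  ball_subset : ∀ x ∈ Y, Metric.ball x (R / 8) ⊆ Ω
  aemeasurable : ∀ f, AEMeasurable (U f) μ
  subadditive : SubadditiveOn U Ω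
  eq_zero : ∀ f, ∀ᵐ x ∂μ, x ∉ E → U f x = 0
  weakType : HasWeakType U Ω r A
  atom : ∀ (G Q P : Set X) (hQ : MeasurableSet Q) (hP : IsCompact P), IsOpen G → Q ⊆ G ∩ Ω →
    P ⊆ G ∩ Ω → μ P ≠ 0 → (∀ x ∈ E \ G, ∀ y ∈ Q, ∀ y' ∈ P, 2 * dist y y' ≤ dist x y) →
    (∀ y ∈ Q, ∀ y' ∈ P, dist y y' < R) → ∀ f : LinftyC 𝕜 B μ, ConcentratedOn f.1 Ω →
    ∫⁻ x in E \ G, U (cutC Q hQ.nullMeasurableSet f -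
      indC 𝕜 μ P hP ((μ.real P)⁻¹ • ∫ y in Q, f.1 y ∂μ)) x ∂μ ≤ C * ∫⁻ y in Q, ‖f.1 y‖ₑ ∂μ
  tail : ∀ G : Set X, IsOpen G → ∃ k : X → ℝ≥0∞, ∫⁻ y in G ∩ Ω, k y ∂μ ≠ ∞ ∧ Measurable k ∧
    ∀ f : LinftyC 𝕜 B μ, ConcentratedOn f.1 (G ∩ Ω) →
      ∫⁻ x in E \ G, U f x ∂μ ≤ ∫⁻ y in G ∩ Ω, ‖f.1 y‖ₑ * k y ∂μ

/-- If |g| ≤ β, then ∫ |g|^r ≤ β^(r-1) ∫ |g|, and A β ≤ t absorbs the excess power into t^(r-1).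
This is what the good part needs. For r = ∞ the level set is null. -/
theorem HasWeakType.meas_le_of_bounded {U : LinftyC 𝕜 B μ → X → ℝ≥0∞} {Y : Set X} {r : ℝ≥0∞}
    {A : ℝ≥0} (h : HasWeakType U Y r A) (hr1 : 1 ≤ r) {g : LinftyC 𝕜 B μ}
    (hg : ConcentratedOn g.1 Y) {β : ℝ≥0∞} (hβ : ∀ᵐ x ∂μ, ‖g.1 x‖ₑ ≤ β) {t : ℝ≥0} (ht : t ≠ 0)
    (hAβ : A * β ≤ t) :
    t * μ {x | (t : ℝ≥0∞) < U g x} ≤ A * ∫⁻ x, ‖g.1 x‖ₑ ∂μ := by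
  have ht' : (t : ℝ≥0∞) ≠ 0 := by exact_mod_cast ht
  by_cases htop : r = ∞
  · have h1 := (h g hg).1 htop
    have h2 : eLpNorm g.1 ∞ μ ≤ β := by
      rw [eLpNorm_exponent_top]
      exact eLpNormEssSup_le_of_ae_enorm_bound hβ
    have h3 : ∀ᵐ x ∂μ, ¬ (t : ℝ≥0∞) < U g x := by
      filter_upwards [h1] with x hx
      exact not_lt.2 (hx.trans ((mul_le_mul_right h2 _).trans hAβ))
    have h4 : μ {x | (t : ℝ≥0∞) < U g x} = 0 := by
      simpa only [ae_iff, not_not] using h3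
    simp [h4]
  · have h1 := (h g hg).2 htop t ht
    have hs : 1 ≤ r.toReal := by
      rw [← ENNReal.toReal_one]
      exact ENNReal.toReal_mono htop hr1
    generalize r.toReal = s at h1 hs
    have hsplit : ∀ y : ℝ≥0∞, y ^ s = y ^ (s - 1) * y := by
      intro y
      have := ENNReal.rpow_add_of_nonneg (x := y) (s - 1) 1 (by linarith) zero_le_one
      rwa [sub_add_cancel, ENNReal.rpow_one] at this
    have h2 : ∫⁻ x, ‖g.1 x‖ₑ ^ s ∂μ ≤ β ^ (s - 1) * ∫⁻ x, ‖g.1 x‖ₑ ∂μ := by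
      rw [← lintegral_const_mul _ (measurable_enorm_coeFn g)]
      refine lintegral_mono_ae ?_
      filter_upwards [hβ] with x hx
      rw [hsplit]
      gcongr
    have ht0 : (t : ℝ≥0∞) ^ (s - 1) ≠ 0 := by
      simp [ENNReal.rpow_eq_zero_iff, ht']
    have htt : (t : ℝ≥0∞) ^ (s - 1) ≠ ∞ :=
      ENNReal.rpow_ne_top_of_nonneg (by linarith) ENNReal.coe_ne_top
    refine (ENNReal.mul_le_mul_iff_right ht0 htt).1 ?_
    calc (t : ℝ≥0∞) ^ (s - 1) * (t * μ {x | (t : ℝ≥0∞) < U g x})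
        = (t : ℝ≥0∞) ^ s * μ {x | (t : ℝ≥0∞) < U g x} := by rw [hsplit t, mul_assoc]
      _ ≤ (A : ℝ≥0∞) ^ s * (β ^ (s - 1) * ∫⁻ x, ‖g.1 x‖ₑ ∂μ) := h1.trans (by gcongr)
      _ = (A * β) ^ (s - 1) * (A * ∫⁻ x, ‖g.1 x‖ₑ ∂μ) := by
        rw [hsplit A, ENNReal.mul_rpow_of_nonneg _ _ (by linarith)]; ring
      _ ≤ _ := by gcongr

end WeakType

/-! ### Good part and finite sums of atoms -/

section WeakTypeOneOne

variable {X : Type*} [MetricSpace X] [MeasurableSpace X] [BorelSpace X] {μ : Measure X}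
  {𝕜 : Type*} [RCLike 𝕜] {B : Type*} [NormedAddCommGroup B] [NormedSpace 𝕜 B]

/-- Subtracting the atoms removes f on the selected Q_i and leaves the constants on P_i; the last
term removes f on the rest of O. Thus the good part never contains f on O, although only finitely
many atoms are used. -/
theorem coeFn_goodPart {ι : Type*} (s : Finset ι) {Q P : ι → Set X} {O : Set X}
    (hQ : ∀ i, MeasurableSet (Q i)) (hP : ∀ i, IsCompact (P i))
    (hQd : Pairwise (Function.onFun Disjoint Q)) (hQO : ∀ i, Q i ⊆ O)
    (hT : MeasurableSet (O \ ⋃ i ∈ s, Q i)) (f : LinftyC 𝕜 B μ) (c : ι → B) :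
    (f - ∑ i ∈ s, (cutC (Q i) (hQ i).nullMeasurableSet f - indC 𝕜 μ (P i) (hP i) (c i)) -
      cutC (O \ ⋃ i ∈ s, Q i) hT.nullMeasurableSet f).1 =ᵐ[μ]
      fun x => Oᶜ.indicator f.1 x + ∑ i ∈ s, (P i).indicator (fun _ => c i) x := by
  have h3 : ∀ᵐ x ∂μ, ∀ i ∈ s, (cutC (Q i) (hQ i).nullMeasurableSet f -
      indC 𝕜 μ (P i) (hP i) (c i)).1 x = (Q i).indicator f.1 x -
        (P i).indicator (fun _ => c i) x := by
    refine (ae_ball_iff s.countable_toSet).2 fun i _ => ?_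
    filter_upwards [coeFn_subC (cutC (Q i) (hQ i).nullMeasurableSet f)
      (indC 𝕜 μ (P i) (hP i) (c i)), coeFn_cutC (Q i) (hQ i).nullMeasurableSet f,
      coeFn_indC (𝕜 := 𝕜) (μ := μ) (hP i) (c i)] with x h1 h2 h3
    rw [h1, h2, h3]
  filter_upwards [coeFn_subC (f - ∑ i ∈ s, (cutC (Q i) (hQ i).nullMeasurableSet f -
      indC 𝕜 μ (P i) (hP i) (c i))) (cutC (O \ ⋃ i ∈ s, Q i) hT.nullMeasurableSet f),
    coeFn_subC f (∑ i ∈ s, (cutC (Q i) (hQ i).nullMeasurableSet f -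
      indC 𝕜 μ (P i) (hP i) (c i))), coeFn_sumC s (fun i =>
      cutC (Q i) (hQ i).nullMeasurableSet f - indC 𝕜 μ (P i) (hP i) (c i)),
    coeFn_cutC (O \ ⋃ i ∈ s, Q i) hT.nullMeasurableSet f, h3] with x h1 h2 h4 h5 h6
  rw [h1, h2, h4, h5, Finset.sum_congr rfl h6, Finset.sum_sub_distrib]
  have h7 : ∑ i ∈ s, (Q i).indicator f.1 x = (⋃ i ∈ s, Q i).indicator f.1 x :=
    (Finset.indicator_biUnion_apply s Q (fun i _ j _ hij => hQd hij) x).symm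
  rw [h7]
  by_cases hO : x ∈ O
  · by_cases hx : x ∈ ⋃ i ∈ s, Q i
    · simp [hO, hx, -mem_iUnion]
    · simp [hO, hx, -mem_iUnion]
  · have hx : x ∉ ⋃ i ∈ s, Q i := fun h => by
      obtain ⟨i, _, hi⟩ := mem_iUnion₂.1 h
      exact hO (hQO i hi)
    simp [hO, hx, -mem_iUnion]

/-- The P_i are disjoint and contained in O, so at most one term is nonzero at each point. -/
theorem enorm_goodPart_le {ι : Type*} (s : Finset ι) {P : ι → Set X} {O : Set X}
    (hPd : Pairwise (Function.onFun Disjoint P)) (hPO : ∀ i, P i ⊆ O) {f : X → B} {c : ι → B}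
    {β : ℝ≥0∞} (hc : ∀ i, ‖c i‖ₑ ≤ β) {x : X} (hf : x ∉ O → ‖f x‖ₑ ≤ β) :
    ‖Oᶜ.indicator f x + ∑ i ∈ s, (P i).indicator (fun _ => c i) x‖ₑ ≤ β := by
  by_cases hO : x ∈ O
  · simp only [mem_compl_iff, hO, not_true, not_false_iff, indicator_of_notMem, zero_add]
    by_cases hx : ∃ i ∈ s, x ∈ P i
    · obtain ⟨i, hi, hxi⟩ := hx
      rw [Finset.sum_eq_single i]
      · simpa [hxi] using hc i
      · intro j _ hj
        exact indicator_of_notMem (fun h => disjoint_left.1 (hPd hj) h hxi) _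
      · exact fun h => absurd hi h
    · push Not at hx
      rw [Finset.sum_eq_zero fun i hi => indicator_of_notMem (hx i hi) _]
      simp
  · rw [Finset.sum_eq_zero fun i hi => indicator_of_notMem (fun h => hO (hPO i h)) _]
    simpa [hO] using hf hO

theorem lintegral_enorm_goodPart_le {ι : Type*} (s : Finset ι) {Q P : ι → Set X} {O : Set X}
    (hQ : ∀ i, MeasurableSet (Q i)) (hP : ∀ i, IsCompact (P i)) (hO : MeasurableSet O)
    (hQd : Pairwise (Function.onFun Disjoint Q)) (hQO : ∀ i, Q i ⊆ O) {f : X → B}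
    (hf : Measurable fun x => ‖f x‖ₑ) {c : ι → B}
    (hc : ∀ i, μ (P i) * ‖c i‖ₑ ≤ ∫⁻ x in Q i, ‖f x‖ₑ ∂μ) :
    ∫⁻ x, ‖Oᶜ.indicator f x + ∑ i ∈ s, (P i).indicator (fun _ => c i) x‖ₑ ∂μ ≤
      ∫⁻ x, ‖f x‖ₑ ∂μ := by
  have h1 : ∀ x, ‖Oᶜ.indicator f x + ∑ i ∈ s, (P i).indicator (fun _ => c i) x‖ₑ ≤
      Oᶜ.indicator (fun x => ‖f x‖ₑ) x + ∑ i ∈ s, (P i).indicator (fun _ => ‖c i‖ₑ) x := by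
    intro x
    refine (enorm_add_le _ _).trans (add_le_add (le_of_eq ?_) ((enorm_sum_le _ _).trans
      (Finset.sum_le_sum fun i _ => le_of_eq ?_)))
    · exact enorm_indicator_eq_indicator_enorm _ _
    · exact enorm_indicator_eq_indicator_enorm _ _
  calc _ ≤ ∫⁻ x, (Oᶜ.indicator (fun x => ‖f x‖ₑ) x +
        ∑ i ∈ s, (P i).indicator (fun _ => ‖c i‖ₑ) x) ∂μ := lintegral_mono h1
    _ = ∫⁻ x in Oᶜ, ‖f x‖ₑ ∂μ + ∑ i ∈ s, μ (P i) * ‖c i‖ₑ := by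
      rw [lintegral_add_left (hf.indicator hO.compl), lintegral_indicator hO.compl,
        lintegral_finsetSum _ fun i _ => measurable_const.indicator (hP i).isClosed.measurableSet]
      congr 1
      refine Finset.sum_congr rfl fun i _ => ?_
      rw [lintegral_indicator_const (hP i).isClosed.measurableSet, mul_comm]
    _ ≤ ∫⁻ x in Oᶜ, ‖f x‖ₑ ∂μ + ∑ i ∈ s, ∫⁻ x in Q i, ‖f x‖ₑ ∂μ := by
      gcongr with i _
      exact hc i
    _ = ∫⁻ x in Oᶜ, ‖f x‖ₑ ∂μ + ∫⁻ x in ⋃ i ∈ s, Q i, ‖f x‖ₑ ∂μ := by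
      rw [lintegral_biUnion_finset (fun i _ j _ hij => hQd hij) fun i _ => hQ i]
    _ ≤ ∫⁻ x in Oᶜ, ‖f x‖ₑ ∂μ + ∫⁻ x in O, ‖f x‖ₑ ∂μ := by
      gcongr
      exact iUnion₂_subset fun i _ => hQO i
    _ = _ := by rw [add_comm, lintegral_add_compl _ hO]

theorem mul_enorm_average_le [NormedSpace ℝ B] {P Q : Set X} (hP0 : μ P ≠ 0) (hP : μ P ≠ ∞)
    (f : X → B) :
    μ P * ‖(μ.real P)⁻¹ • ∫ y in Q, f y ∂μ‖ₑ ≤ ∫⁻ y in Q, ‖f y‖ₑ ∂μ := by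
  have h1 : ‖(μ.real P)⁻¹‖ₑ = (μ P)⁻¹ := by
    have hPr : μ.real P ≠ 0 := (ENNReal.toReal_pos hP0 hP).ne'
    rw [enorm_inv hPr, Measure.real, Real.enorm_eq_ofReal
      ENNReal.toReal_nonneg, ENNReal.ofReal_toReal hP]
  rw [enorm_smul, h1, ← mul_assoc, ENNReal.mul_inv_cancel hP0 hP, one_mul]
  exact enorm_integral_le_lintegral_enorm _

/-- Induction by subadditivity, which is why sums must be finite. The empty sum uses `tail`, which
forces U 0 to vanish almost everywhere on E \ G. -/
theorem IsLocalCZOperator.lintegral_sum_atom_le [NormedSpace ℝ B] {R : ℝ} {r : ℝ≥0∞} {A C : ℝ≥0}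
    {Y Ω E : Set X} {U : LinftyC 𝕜 B μ → X → ℝ≥0∞} (hU : IsLocalCZOperator μ R r A C Y Ω E U)
    {G : Set X} (hG : IsOpen G) {ι : Type*} (s : Finset ι) {b : ι → LinftyC 𝕜 B μ}
    (hb : ∀ i, ConcentratedOn (b i).1 Ω) {a : ι → ℝ≥0∞}
    (h : ∀ i, ∫⁻ x in E \ G, U (b i) x ∂μ ≤ a i) :
    ConcentratedOn (∑ i ∈ s, b i).1 Ω ∧
      ∫⁻ x in E \ G, U (∑ i ∈ s, b i) x ∂μ ≤ ∑ i ∈ s, a i := by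
  classical
  induction s using Finset.induction_on with
  | empty =>
    refine ⟨concentratedOn_zero Ω, ?_⟩
    obtain ⟨k, _, _, hk⟩ := hU.tail G hG
    have h0 := hk 0 (concentratedOn_zero _)
    simp only [Finset.sum_empty]
    refine h0.trans (le_of_eq ?_)
    rw [lintegral_congr_ae (g := fun _ => 0), lintegral_zero]
    filter_upwards [ae_restrict_of_ae (AEEqFun.coeFn_zero (α := X) (β := B) (μ := μ))] with x hx
    have : ((0 : LinftyC 𝕜 B μ).1 : X → B) x = 0 := hx
    rw [this]; simp
  | insert i s hi ih =>
    rw [Finset.sum_insert hi, Finset.sum_insert hi]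
    refine ⟨(hb i).add ih.1, ?_⟩
    calc ∫⁻ x in E \ G, U (b i + ∑ j ∈ s, b j) x ∂μ
        ≤ ∫⁻ x in E \ G, (U (b i) x + U (∑ j ∈ s, b j) x) ∂μ :=
          lintegral_mono_ae (ae_restrict_of_ae (hU.subadditive _ _ (hb i) ih.1))
      _ = ∫⁻ x in E \ G, U (b i) x ∂μ + ∫⁻ x in E \ G, U (∑ j ∈ s, b j) x ∂μ :=
          lintegral_add_left' (hU.aemeasurable _).restrict _
      _ ≤ _ := add_le_add (h i) ih.2

end WeakTypeOneOne

/-! ### The weak type (1, 1) estimate -/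

section WeakTypeOneOne

variable {X : Type*} [MetricSpace X] [MeasurableSpace X] [BorelSpace X] {μ : Measure X}
  {𝕜 : Type*} [RCLike 𝕜] {B : Type*} [NormedAddCommGroup B] [NormedSpace 𝕜 B] [NormedSpace ℝ B]

theorem mul_measure_lt_le_lintegral {v : X → ℝ≥0∞} (hv : AEMeasurable v μ) (S : Set X)
    (t : ℝ≥0∞) : t * μ ({x | t < v x} ∩ S) ≤ ∫⁻ x in S, v x ∂μ := by
  refine (mul_le_mul' le_rfl ?_).trans (mul_meas_ge_le_lintegral₀ hv.restrict t)
  refine (Measure.le_restrict_apply _ _).trans (measure_mono fun x hx => ?_)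
  exact le_of_lt (show t < v x from hx)

/-- One step of the weak type estimate: good part, finitely many atoms, and a tail. -/
theorem IsLocalCZOperator.mul_measure_le_of_decomposition {R : ℝ} {r : ℝ≥0∞} {A C : ℝ≥0}
    {Y Ω E : Set X} {U : LinftyC 𝕜 B μ → X → ℝ≥0∞} (hU : IsLocalCZOperator μ R r A C Y Ω E U)
    {G : Set X} {f g b h : LinftyC 𝕜 B μ} (hgΩ : ConcentratedOn g.1 Ω)
    (hbΩ : ConcentratedOn b.1 Ω) (hhΩ : ConcentratedOn h.1 Ω) (hf : f = g + (b + h)) {t : ℝ≥0} :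
    (t : ℝ≥0∞) * μ {x | (t : ℝ≥0∞) < U f x} ≤
      t * μ {x | ((3 / 4 * t : ℝ≥0) : ℝ≥0∞) < U g x} + t * μ G +
      4 * (∫⁻ x in E \ G, U b x ∂μ + ∫⁻ x in E \ G, U h x ∂μ) := by
  -- The level is divided as 3/4 for the good part and 1/4 for atoms and tail together; the latter
  -- is the source of the factor 4.
  set t₀ : ℝ≥0∞ := ((1 / 4 * t : ℝ≥0) : ℝ≥0∞) with ht₀
  have ht : ((3 / 4 * t : ℝ≥0) : ℝ≥0∞) + t₀ = t := by
    rw [ht₀, ← ENNReal.coe_add]; congr 1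
    rw [← add_mul, show (3 / 4 + 1 / 4 : ℝ≥0) = 1 by
      rw [← add_div]; norm_num, one_mul]
  have h4 : 4 * t₀ = t := by
    rw [ht₀, show (4 : ℝ≥0∞) = ((4 : ℝ≥0) : ℝ≥0∞) by rfl, ← ENNReal.coe_mul]; congr 1
    rw [← mul_assoc]; norm_num
  have hsub : μ {x | (t : ℝ≥0∞) < U f x} ≤ μ {x | ((3 / 4 * t : ℝ≥0) : ℝ≥0∞) < U g x} + μ G +
      μ ({x | t₀ < U b x + U h x} ∩ (E \ G)) := by
    refine (measure_mono_ae ?_).trans ((measure_union_le _ _).trans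
      (add_le_add (measure_union_le _ _) le_rfl))
    filter_upwards [hU.eq_zero f, hU.subadditive g (b + h) hgΩ (hbΩ.add hhΩ),
      hU.subadditive b h hbΩ hhΩ] with x h0 h1 h2 hxt
    have hxt : (t : ℝ≥0∞) < U f x := hxt
    rw [← hf] at h1
    by_contra hcon
    have hcon' : ¬ (x ∈ ({x | ((3 / 4 * t : ℝ≥0) : ℝ≥0∞) < U g x} ∪ G) ∪
      ({x | t₀ < U b x + U h x} ∩ (E \ G))) := hcon
    simp only [mem_union, mem_inter_iff, mem_ofPred_eq, not_or, not_lt, not_and] at hcon'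
    have hxE : x ∈ E := by
      by_contra hxE
      rw [h0 hxE] at hxt
      exact absurd hxt not_lt_zero
    have h3 : U b x + U h x ≤ t₀ := by
      by_contra! h5
      exact hcon'.2 h5 ⟨hxE, hcon'.1.2⟩
    have h6 : U f x ≤ t := h1.trans ((add_le_add hcon'.1.1 (h2.trans h3)).trans ht.le)
    exact absurd hxt (not_lt.2 h6)
  have hlast : t * μ ({x | t₀ < U b x + U h x} ∩ (E \ G)) ≤
      4 * (∫⁻ x in E \ G, U b x ∂μ + ∫⁻ x in E \ G, U h x ∂μ) := by
    rw [← h4, mul_assoc, ← lintegral_add_left' (hU.aemeasurable b).restrict]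
    gcongr
    exact mul_measure_lt_le_lintegral ((hU.aemeasurable b).add (hU.aemeasurable h)) _ _
  calc _ ≤ (t : ℝ≥0∞) * (μ {x | ((3 / 4 * t : ℝ≥0) : ℝ≥0∞) < U g x} + μ G +
      μ ({x | t₀ < U b x + U h x} ∩ (E \ G))) := by gcongr
    _ = t * μ {x | ((3 / 4 * t : ℝ≥0) : ℝ≥0∞) < U g x} + t * μ G +
      t * μ ({x | t₀ < U b x + U h x} ∩ (E \ G)) := by ring
    _ ≤ _ := by gcongr

variable [SecondCountableTopology X] [μ.InnerRegular] [IsLocallyFiniteMeasure μ]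
  [μ.IsOpenPosMeasure]

/-- The weak type `(1, 1)` estimate of the local Calderón–Zygmund theory. -/
theorem IsLocalCZOperator.weakType_one {R : ℝ} {D : ℝ≥0} (hD : DoublingUpTo μ R D) (hD1 : 1 ≤ D)
    (hR : 0 < R) {r : ℝ≥0∞} (hr1 : 1 ≤ r) {A C : ℝ≥0} (hA : 0 < A)
    {Y Ω E : Set X} {U : LinftyC 𝕜 B μ → X → ℝ≥0∞} (hU : IsLocalCZOperator μ R r A C Y Ω E U)
    (f : LinftyC 𝕜 B μ) (hf : ConcentratedOn f.1 Y) (t : ℝ≥0) (ht : t ≠ 0) :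
    t * μ {x | (t : ℝ≥0∞) < U f x} ≤
      ((4 * (D ^ 9 * A + C) : ℝ≥0) : ℝ≥0∞) * ∫⁻ x, ‖f.1 x‖ₑ ∂μ := by
  have hYΩ : Y ⊆ Ω := fun x hx => hU.ball_subset x hx (Metric.mem_ball_self (by positivity))
  have hfΩ := hf.mono hYΩ
  have hfi : Integrable f.1 μ := memLp_one_iff_integrable.1 (LinftyC.memLp f 1)
  set N := ∫⁻ x, ‖f.1 x‖ₑ ∂μ with hN
  have hNtop : N ≠ ∞ := hfi.2.ne
  have hD0 : D ≠ 0 := (zero_lt_one.trans_le hD1).ne'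
  have hDe : (1 : ℝ≥0∞) ≤ D := by exact_mod_cast hD1
  have hDe0 : (D : ℝ≥0∞) ≠ 0 := by exact_mod_cast hD0
  -- The good part will be bounded by β = (4/3) D^3 α, and this height makes A β = (2/3) t, below
  -- the level (3/4) t reserved for it.
  set α : ℝ≥0 := t / (2 * A * D ^ 3) with hα
  have hα0 : α ≠ 0 := by positivity
  have htα : (t : ℝ≥0∞) = 2 * A * D ^ 3 * α := by
    rw [hα]
    norm_cast
    rw [mul_div_cancel₀]
    positivity
  -- If the mass of f is this large, μ(E) already bounds the level set, at the cost D^3 · D^6 = D^9.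
  -- Otherwise averages over balls centred in Y stay at most α down to radius R/64, so the stopping
  -- radii are at most R/128.
  by_cases htriv : α * μ E ≤ (D : ℝ≥0∞) ^ 6 * N
  · calc t * μ {x | (t : ℝ≥0∞) < U f x} ≤ t * μ E := by
          refine mul_le_mul' le_rfl (measure_mono_ae ?_)
          filter_upwards [hU.eq_zero f] with x hx hxt
          by_contra hxE
          have hxt : (t : ℝ≥0∞) < U f x := hxt
          rw [hx hxE] at hxt
          exact absurd hxt not_lt_zero
      _ = 2 * A * D ^ 3 * (α * μ E) := by rw [htα]; ring
      _ ≤ 2 * A * D ^ 3 * ((D : ℝ≥0∞) ^ 6 * N) := by gcongr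
      _ = (2 * (D ^ 9 * A)) * N := by ring
      _ ≤ _ := by
        push_cast
        gcongr
        · norm_num
        · exact le_self_add
  push Not at htriv
  have hbig : ∀ x ∈ Y, ∀ n ≤ 6, ∫⁻ y in Metric.closedBall x (R / 2 ^ n), ‖f.1 y‖ₑ ∂μ ≤
      α * μ (Metric.closedBall x (R / 2 ^ n)) := by
    intro x hx n hn
    refine (setLIntegral_le_lintegral _ _).trans ?_
    have h6 : (D : ℝ≥0∞) ^ 6 ≠ 0 := by simp [hD0]
    refine (ENNReal.mul_le_mul_iff_right h6 (by finiteness)).1 ?_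
    have hs : 2 ^ n * (R / 2 ^ n) = R := by field_simp
    calc (D : ℝ≥0∞) ^ 6 * N ≤ α * μ E := htriv.le
      _ ≤ α * μ (Metric.ball x R) := by gcongr; exact hU.subset_ball x hx
      _ ≤ α * (D ^ n * μ (Metric.ball x (R / 2 ^ n))) := by
        gcongr
        exact hD.ball_le x (by positivity) n (by rw [hs]; linarith) hs.ge
      _ ≤ α * (D ^ 6 * μ (Metric.closedBall x (R / 2 ^ n))) := by
        refine mul_le_mul' le_rfl (mul_le_mul' (pow_le_pow_right₀ hDe hn)
          (measure_mono Metric.ball_subset_closedBall))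
      _ = _ := by ring
  obtain ⟨u, huY, ρ, hucount, hρ0, hρR, hudisj, hlow, hhigh, hsmall⟩ :=
    exists_calderonZygmund_covering hD hR hfi α Y 6 (by norm_num) hbig
  have := hucount.to_subtype
  have hρR' : ∀ i : u, ρ i ≤ R / 128 := fun i => (hρR i i.2).trans_eq (by norm_num)
  have hρ0' : ∀ i : u, 0 < ρ i := fun i => hρ0 i i.2
  -- The Q_i partition O, but some may have very small measure, so averages over Q_i would not be
  -- bounded; the mass is moved to P_i instead.
  obtain ⟨Q, hQm, hQV, hQd, hQO⟩ := exists_disjoint_refinement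
    (fun i : u => Metric.closedBall (i : X) (4 * ρ i)) fun i => Metric.isClosed_closedBall.measurableSet
  -- Inner regularity gives a compact subset of the core ball with at least 3/4 of its measure. The
  -- core balls are disjoint, and the loss is the factor 4/3 in β.
  have hP : ∀ i : u, ∃ P ⊆ Metric.ball (i : X) (ρ i), IsCompact P ∧
      3 * μ (Metric.ball (i : X) (ρ i)) ≤ 4 * μ P ∧ μ P ≠ 0 := by
    intro i
    have h0 : μ (Metric.ball (i : X) (ρ i)) ≠ 0 := (Metric.measure_ball_pos μ _ (hρ0' i)).ne'
    have htop : μ (Metric.ball (i : X) (ρ i)) ≠ ∞ :=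
      (hD.ball_lt_top hR _ (by linarith [hρR' i])).ne
    have hlt : 3 / 4 * μ (Metric.ball (i : X) (ρ i)) < μ (Metric.ball (i : X) (ρ i)) := by
      conv_rhs => rw [← one_mul (μ _)]
      rw [ENNReal.mul_lt_mul_iff_left h0 htop]
      refine (ENNReal.div_lt_iff (by simp) (by simp)).2 ?_
      norm_num
    obtain ⟨P, hPb, hPc, hPlt⟩ := Metric.isOpen_ball.measurableSet.exists_lt_isCompact hlt
    refine ⟨P, hPb, hPc, ?_, (zero_le.trans_lt hPlt).ne'⟩
    calc 3 * μ (Metric.ball (i : X) (ρ i)) = 4 * (3 / 4 * μ (Metric.ball (i : X) (ρ i))) := by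
          rw [← mul_assoc, ENNReal.mul_div_cancel (by simp) (by simp)]
      _ ≤ _ := by gcongr
  choose P hPb hPc hPle hP0 using hP
  set O : Set X := ⋃ i : u, Metric.closedBall (i : X) (4 * ρ i) with hOdef
  have hOm : MeasurableSet O := MeasurableSet.iUnion fun i => Metric.isClosed_closedBall.measurableSet
  have hQsub : ∀ i, Q i ⊆ O := fun i => hQO ▸ subset_iUnion Q i
  have hPsub : ∀ i, P i ⊆ O := fun i => (hPb i).trans ((Metric.ball_subset_closedBall.trans
    (Metric.closedBall_subset_closedBall (by linarith [hρ0' i]))).trans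
    (subset_iUnion (fun i : u => Metric.closedBall (i : X) (4 * ρ i)) i))
  have hPd : Pairwise (Function.onFun Disjoint P) := fun i j hij =>
    (hudisj i.2 j.2 (fun h => hij (Subtype.ext h))).mono
      ((hPb i).trans Metric.ball_subset_closedBall) ((hPb j).trans Metric.ball_subset_closedBall)
  -- For x outside G, y in Q_i and y' in P_i, one has d(x, y) ≥ 12ρ_i, while 2 d(y, y') < 10ρ_i.
  -- This is the separation required by the regularity condition.
  set G : Set X := ⋃ i : u, Metric.ball (i : X) (16 * ρ i) with hGdef
  have hGo : IsOpen G := isOpen_iUnion fun i => Metric.isOpen_ball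
  have hball : ∀ i : u, Metric.closedBall (i : X) (4 * ρ i) ⊆ G ∩ Ω := by
    intro i
    refine subset_inter ((Metric.closedBall_subset_ball (by linarith [hρ0' i])).trans
      (subset_iUnion (fun i : u => Metric.ball (i : X) (16 * ρ i)) i))
      ((Metric.closedBall_subset_ball ?_).trans (hU.ball_subset i (huY i.2)))
    linarith [hρR' i]
  have hQG : ∀ i, Q i ⊆ G ∩ Ω := fun i => (hQV i).trans (hball i)
  have hPG : ∀ i, P i ⊆ G ∩ Ω := fun i => ((hPb i).trans (Metric.ball_subset_closedBall.trans
    (Metric.closedBall_subset_closedBall (by linarith [hρ0' i])))).trans (hball i)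
  set c : u → B := fun i => (μ.real (P i))⁻¹ • ∫ y in Q i, f.1 y ∂μ with hc
  have hPtop : ∀ i, μ (P i) ≠ ∞ := fun i => (hPc i).measure_lt_top.ne
  have hcint : ∀ i, μ (P i) * ‖c i‖ₑ ≤ ∫⁻ y in Q i, ‖f.1 y‖ₑ ∂μ := fun i =>
    mul_enorm_average_le (hP0 i) (hPtop i) f.1
  set β : ℝ≥0∞ := ((4 / 3 * D ^ 3 * α : ℝ≥0) : ℝ≥0∞) with hβ
  have h3β : 3 * β = 4 * D ^ 3 * α := by
    rw [hβ, show (3 : ℝ≥0∞) = ((3 : ℝ≥0) : ℝ≥0∞) by rfl,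
      show (4 : ℝ≥0∞) = ((4 : ℝ≥0) : ℝ≥0∞) by rfl]
    norm_cast
    rw [← mul_assoc, ← mul_assoc, mul_div_cancel₀ _ (by norm_num)]
  have hαβ : (α : ℝ≥0∞) ≤ β := by
    rw [hβ, ENNReal.coe_le_coe]
    refine le_mul_of_one_le_left zero_le ?_
    refine one_le_mul_of_one_le_of_one_le ?_ (one_le_pow₀ hD1)
    rw [le_div_iff₀ (by norm_num)]; norm_num
  have hcβ : ∀ i, ‖c i‖ₑ ≤ β := by
    intro i
    have h1 : ∫⁻ y in Q i, ‖f.1 y‖ₑ ∂μ ≤ α * (D ^ 3 * μ (Metric.ball (i : X) (ρ i))) :=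
      calc _ ≤ ∫⁻ y in Metric.closedBall (i : X) (4 * ρ i), ‖f.1 y‖ₑ ∂μ :=
            lintegral_mono_set (hQV i)
        _ ≤ α * μ (Metric.closedBall (i : X) (4 * ρ i)) := hhigh i i.2
        _ ≤ _ := by
          gcongr
          exact hD.closedBall_le _ (hρ0' i) 3 (by linarith [hρR' i]) (by linarith [hρ0' i])
    refine (ENNReal.mul_le_mul_iff_right (a := 3 * μ (P i)) (by simp [hP0 i])
      (ENNReal.mul_ne_top (by simp) (hPtop i))).1 ?_
    calc 3 * μ (P i) * ‖c i‖ₑ ≤ 3 * (α * (D ^ 3 * μ (Metric.ball (i : X) (ρ i)))) := by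
          rw [mul_assoc]
          exact mul_le_mul' le_rfl ((hcint i).trans h1)
      _ = α * D ^ 3 * (3 * μ (Metric.ball (i : X) (ρ i))) := by ring
      _ ≤ α * D ^ 3 * (4 * μ (P i)) := mul_le_mul' le_rfl (hPle i)
      _ = (4 * D ^ 3 * α) * μ (P i) := by ring
      _ = _ := by rw [← h3β]; ring
  have hfO : ∀ᵐ x ∂μ, x ∉ O → ‖f.1 x‖ₑ ≤ β := by
    filter_upwards [hsmall, hf] with x h1 h2 hxO
    by_cases hxY : x ∈ Y
    · refine (h1 hxY fun h => hxO ?_).trans hαβ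
      obtain ⟨i, hi, hxi⟩ := mem_iUnion₂.1 h
      exact mem_iUnion.2 ⟨⟨i, hi⟩, hxi⟩
    · rw [h2 hxY]; simp
  -- Four doublings lead from ρ to 16ρ, the disjoint core balls have total measure at most N/α, and
  -- t/α = 2 A D^3.
  have hμG : t * μ G ≤ 2 * A * D ^ 7 * N := by
    have h1 : ∑' i : u, α * μ (Metric.closedBall (i : X) (ρ i)) ≤ N :=
      calc _ ≤ ∑' i : u, ∫⁻ y in Metric.closedBall (i : X) (ρ i), ‖f.1 y‖ₑ ∂μ :=
            ENNReal.tsum_le_tsum fun i => hlow i i.2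
        _ = ∫⁻ y in ⋃ i : u, Metric.closedBall (i : X) (ρ i), ‖f.1 y‖ₑ ∂μ :=
            (lintegral_iUnion (s := fun i : u => Metric.closedBall (i : X) (ρ i))
              (fun i => Metric.isClosed_closedBall.measurableSet) (fun i j hij => hudisj i.2 j.2 (fun h => hij (Subtype.ext h))) _).symm
        _ ≤ N := setLIntegral_le_lintegral _ _
    calc t * μ G ≤ t * ∑' i : u, μ (Metric.ball (i : X) (16 * ρ i)) := by
          gcongr; exact measure_iUnion_le _
      _ ≤ t * ∑' i : u, (D : ℝ≥0∞) ^ 4 * μ (Metric.closedBall (i : X) (ρ i)) := by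
          gcongr with i
          refine (hD.ball_le _ (hρ0' i) 4 (by linarith [hρR' i]) (by linarith)).trans ?_
          gcongr
          exact Metric.ball_subset_closedBall
      _ = 2 * A * D ^ 7 * ∑' i : u, α * μ (Metric.closedBall (i : X) (ρ i)) := by
          rw [ENNReal.tsum_mul_left, ENNReal.tsum_mul_left, htα]; ring
      _ ≤ _ := by gcongr
  obtain ⟨k, hktop, hkm, hk⟩ := hU.tail G hGo
  obtain ⟨M, hM⟩ := LinftyC.exists_bound f
  -- The measure ν is finite by `tail`, so the sum of all ν(Q_i) converges and its remainders tend
  -- to 0.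
  set ν : Measure X := (μ.restrict (G ∩ Ω)).withDensity k with hν
  have hνuniv : ν univ ≠ ∞ := by
    rw [hν, withDensity_apply _ MeasurableSet.univ, Measure.restrict_univ]
    exact hktop
  have hνQ : ∑' i, ν (Q i) ≠ ∞ := by
    rw [← measure_iUnion hQd hQm]
    exact ((measure_mono (subset_univ _)).trans_lt hνuniv.lt_top).ne
  -- Only the atoms with index in s are removed. What is left of f on O is bounded by M, and its
  -- contribution by M times the ν-measure of the other Q_i.
  have hstep : ∀ s : Finset u, t * μ {x | (t : ℝ≥0∞) < U f x} ≤
      (4 / 3 * A + 2 * A * D ^ 7) * N + 4 * (C * N + M * ∑' i : {i // i ∉ s}, ν (Q i)) := by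
    intro s
    have hT : MeasurableSet (O \ ⋃ i ∈ s, Q i) :=
      hOm.diff (s.measurableSet_biUnion fun i _ => hQm i)
    set b : u → LinftyC 𝕜 B μ := fun i => cutC (Q i) (hQm i).nullMeasurableSet f -
      indC 𝕜 μ (P i) (hPc i) (c i) with hb
    set h : LinftyC 𝕜 B μ := cutC (O \ ⋃ i ∈ s, Q i) hT.nullMeasurableSet f with hh
    set g : LinftyC 𝕜 B μ := f - ∑ i ∈ s, b i - h with hg
    have hbΩ : ∀ i, ConcentratedOn (b i).1 Ω := fun i =>
      ((concentratedOn_cutC_self f _).mono ((hQG i).trans inter_subset_right)).sub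
        ((concentratedOn_indC (hPc i) (c i)).mono ((hPG i).trans inter_subset_right))
    have hTG : O \ ⋃ i ∈ s, Q i ⊆ G ∩ Ω :=
      sdiff_subset.trans (iUnion_subset hball)
    have hhG : ConcentratedOn h.1 (G ∩ Ω) := (concentratedOn_cutC_self f _).mono hTG
    have hhΩ : ConcentratedOn h.1 Ω := hhG.mono inter_subset_right
    obtain ⟨hsumΩ, hsumle⟩ := hU.lintegral_sum_atom_le hGo s hbΩ
      (a := fun i => C * ∫⁻ y in Q i, ‖f.1 y‖ₑ ∂μ) fun i =>
      hU.atom G (Q i) (P i) (hQm i) (hPc i) hGo (hQG i) (hPG i) (hP0 i) (by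
        intro x hx y hy y' hy'
        have h1 : 16 * ρ i ≤ dist x i := by
          by_contra! hcon
          exact hx.2 (mem_iUnion.2 ⟨i, hcon⟩)
        have h2 : dist y i ≤ 4 * ρ i := hQV i hy
        have h3 : dist y' i < ρ i := hPb i hy'
        linarith [dist_triangle x y i, dist_triangle_right y y' (i : X), hρ0' i]) (by
        intro y hy y' hy'
        have h2 : dist y i ≤ 4 * ρ i := hQV i hy
        have h3 : dist y' i < ρ i := hPb i hy'
        linarith [dist_triangle_right y y' (i : X), hρR' i]) f hfΩ
    have hgΩ : ConcentratedOn g.1 Ω := (hfΩ.sub hsumΩ).sub hhΩ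
    have hgae := coeFn_goodPart (𝕜 := 𝕜) (μ := μ) s hQm hPc hQd hQsub hT f c
    have hgβ : ∀ᵐ x ∂μ, ‖g.1 x‖ₑ ≤ β := by
      filter_upwards [hgae, hfO] with x h1 h2
      rw [show g.1 x = _ from h1]
      exact enorm_goodPart_le s hPd hPsub hcβ h2
    have hgN : ∫⁻ x, ‖g.1 x‖ₑ ∂μ ≤ N := by
      rw [lintegral_congr_ae (show (fun x => ‖g.1 x‖ₑ) =ᵐ[μ] _ from hgae.fun_comp (‖·‖ₑ))]
      exact lintegral_enorm_goodPart_le s hQm hPc hOm hQd hQsub (measurable_enorm_coeFn f) hcint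
    have hgood : t * μ {x | ((3 / 4 * t : ℝ≥0) : ℝ≥0∞) < U g x} ≤ 4 / 3 * A * N := by
      have h1 := hU.weakType.meas_le_of_bounded hr1 hgΩ hgβ (t := 3 / 4 * t) (by positivity) (by
        rw [hβ, hα]
        norm_cast
        have : A * (4 / 3 * D ^ 3 * (t / (2 * A * D ^ 3))) = 2 / 3 * t := by
          field_simp; norm_num
        rw [this]
        refine mul_le_mul' ?_ le_rfl
        rw [div_le_div_iff₀ (by norm_num) (by norm_num)]
        norm_num)
      calc t * μ {x | ((3 / 4 * t : ℝ≥0) : ℝ≥0∞) < U g x} =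
          4 / 3 * (((3 / 4 * t : ℝ≥0) : ℝ≥0∞) *
            μ {x | ((3 / 4 * t : ℝ≥0) : ℝ≥0∞) < U g x}) := by
            rw [← mul_assoc]
            congr 1
            rw [show (4 / 3 : ℝ≥0∞) = ((4 / 3 : ℝ≥0) : ℝ≥0∞) by simp, ← ENNReal.coe_mul]
            congr 1
            rw [← mul_assoc, div_mul_div_cancel₀ (by norm_num), div_self (by norm_num), one_mul]
        _ ≤ 4 / 3 * (A * N) := mul_le_mul' le_rfl (h1.trans (mul_le_mul' le_rfl hgN))
        _ = _ := by ring
    have hbN : ∑ i ∈ s, C * ∫⁻ y in Q i, ‖f.1 y‖ₑ ∂μ ≤ C * N := by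
      rw [← Finset.mul_sum, ← lintegral_biUnion_finset (fun i _ j _ hij => hQd hij)
        fun i _ => hQm i]
      gcongr
      exact setLIntegral_le_lintegral _ _
    have htail : ∫⁻ x in E \ G, U h x ∂μ ≤ M * ∑' i : {i // i ∉ s}, ν (Q i) := by
      refine (hk h hhG).trans ?_
      have h1 : ∀ᵐ x ∂μ.restrict (G ∩ Ω), ‖h.1 x‖ₑ * k x ≤
          M * (O \ ⋃ i ∈ s, Q i).indicator k x := by
        refine ae_restrict_of_ae ?_
        filter_upwards [coeFn_cutC (O \ ⋃ i ∈ s, Q i) hT.nullMeasurableSet f, hM] with x h1 h2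
        rw [show h.1 x = _ from h1]
        by_cases hx : x ∈ O \ ⋃ i ∈ s, Q i
        · rw [indicator_of_mem hx, indicator_of_mem hx]; gcongr
        · rw [indicator_of_notMem hx]; simp
      refine (lintegral_mono_ae h1).trans ?_
      rw [lintegral_const_mul _ (hkm.indicator hT), lintegral_indicator hT,
        ← withDensity_apply _ hT]
      gcongr
      refine (measure_mono (t := ⋃ i : {i // i ∉ s}, Q i) ?_).trans (measure_iUnion_le _)
      intro x hx
      have hx1 : x ∈ ⋃ i, Q i := hQO ▸ hx.1
      obtain ⟨i, hi⟩ := mem_iUnion.1 hx1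
      exact mem_iUnion.2 ⟨⟨i, fun his => hx.2 (mem_iUnion₂.2 ⟨i, his, hi⟩)⟩, hi⟩
    have hdec := hU.mul_measure_le_of_decomposition (G := G) (t := t) hgΩ hsumΩ hhΩ
      (show f = g + (∑ i ∈ s, b i + h) by rw [hg]; abel)
    refine hdec.trans ?_
    rw [add_mul]
    gcongr
    exact hsumle.trans hbN
  -- As s exhausts the index set, the tail error disappears.
  have hlim : Tendsto (fun s : Finset u => (4 / 3 * A + 2 * A * D ^ 7) * N + 4 * (C * N +
      M * ∑' i : {i // i ∉ s}, ν (Q i))) atTop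
      (𝓝 ((4 / 3 * A + 2 * A * D ^ 7) * N + 4 * (C * N + M * 0))) := by
    refine Tendsto.const_add _ (ENNReal.Tendsto.const_mul (Tendsto.const_add _
      (ENNReal.Tendsto.const_mul (ENNReal.tendsto_tsum_compl_atTop_zero hνQ)
        (Or.inr ENNReal.coe_ne_top))) (Or.inr (by simp)))
  refine (ge_of_tendsto' hlim hstep).trans ?_
  rw [mul_zero, add_zero, ← mul_assoc, ← add_mul]
  gcongr
  push_cast
  have h1 : (4 / 3 : ℝ≥0∞) ≤ 2 := by
    refine ENNReal.div_le_of_le_mul ?_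
    norm_num
  calc 4 / 3 * (A : ℝ≥0∞) + 2 * A * D ^ 7 + 4 * C
      ≤ 2 * (A * D ^ 9) + 2 * A * D ^ 9 + 4 * C := by
        gcongr
        · exact le_mul_of_one_le_right zero_le (one_le_pow₀ hDe)
        · norm_num
    _ = _ := by ring

end WeakTypeOneOne

/-! ### Cancellation in the image of an atom -/

section Atoms

variable {X : Type*} [MetricSpace X] [MeasurableSpace X] [BorelSpace X] {μ : Measure X}
  {𝕜 : Type*} [RCLike 𝕜] {B : Type*} [NormedAddCommGroup B] [NormedSpace 𝕜 B] [NormedSpace ℝ B]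
  [CompleteSpace B] {B' : Type*} [NormedAddCommGroup B'] [NormedSpace 𝕜 B'] [NormedSpace ℝ B']
  [CompleteSpace B']

theorem integrableOn_clm_apply {L : X → B →L[𝕜] B'} {S : Set X} (hL : IntegrableOn L S μ)
    (f : LinftyC 𝕜 B μ) : IntegrableOn (fun y => L y (f.1 y)) S μ := by
  obtain ⟨M, hM⟩ := LinftyC.exists_bound f
  refine Integrable.mono' (hL.norm.mul_const M) ?_ ?_
  · exact (ContinuousLinearMap.id 𝕜 (B →L[𝕜] B')).aestronglyMeasurable_comp₂ hL.1
      f.1.aestronglyMeasurable.restrict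
  · filter_upwards [ae_restrict_of_ae hM] with y hy
    refine ((L y).le_opNorm _).trans ?_
    gcongr
    have h1 : ((‖f.1 y‖₊ : ℝ≥0) : ℝ≥0∞) ≤ M := hy
    exact_mod_cast h1

/-- The atom has mean zero. After multiplication by μ(P), its image is the integral of (L y - L y')
f(y) over y in Q and y' in P: the second variable is averaged over P because the mass of f on Q was
spread there. -/
theorem measure_mul_enorm_integral_atom_le [IsFiniteMeasureOnCompacts μ] {L : X → B →L[𝕜] B'}
    {F Q P : Set X} (hQ : MeasurableSet Q) (hP : IsCompact P) (hQF : Q ⊆ F) (hPF : P ⊆ F)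
    (hP0 : μ P ≠ 0) (hL : IntegrableOn L F μ) (f : LinftyC 𝕜 B μ) :
    μ P * ‖∫ y in F, L y ((cutC Q hQ.nullMeasurableSet f -
      indC 𝕜 μ P hP ((μ.real P)⁻¹ • ∫ z in Q, f.1 z ∂μ)).1 y) ∂μ‖ₑ ≤
      ∫⁻ y' in P, ∫⁻ y in Q, ‖L y - L y'‖ₑ * ‖f.1 y‖ₑ ∂μ ∂μ := by
  set c := (μ.real P)⁻¹ • ∫ z in Q, f.1 z ∂μ with hc
  have hPm : MeasurableSet P := hP.isClosed.measurableSet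
  have hPtop : μ P ≠ ∞ := hP.measure_lt_top.ne
  have hPr : μ.real P ≠ 0 := (ENNReal.toReal_pos hP0 hPtop).ne'
  have hfi : Integrable f.1 μ := memLp_one_iff_integrable.1 (LinftyC.memLp f 1)
  have hLQ := hL.mono_set hQF
  have hLP := hL.mono_set hPF
  have hLf := integrableOn_clm_apply hLQ f
  have hLc : ∀ v : B, IntegrableOn (fun y => L y v) P μ := fun v =>
    ((ContinuousLinearMap.apply 𝕜 B' v).integrable_comp hLP)
  have hsplit : ∫ y in F, L y ((cutC Q hQ.nullMeasurableSet f - indC 𝕜 μ P hP c).1 y) ∂μ =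
      ∫ y in Q, L y (f.1 y) ∂μ - ∫ y in P, L y c ∂μ := by
    have h1 : ∀ᵐ y ∂μ.restrict F, L y ((cutC Q hQ.nullMeasurableSet f - indC 𝕜 μ P hP c).1 y) =
        Q.indicator (fun y => L y (f.1 y)) y - P.indicator (fun y => L y c) y := by
      refine ae_restrict_of_ae ?_
      filter_upwards [coeFn_subC (cutC Q hQ.nullMeasurableSet f) (indC 𝕜 μ P hP c),
        coeFn_cutC Q hQ.nullMeasurableSet f, coeFn_indC (𝕜 := 𝕜) (μ := μ) hP c] with y h1 h2 h3
      rw [h1, h2, h3, map_sub]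
      congr 1
      · by_cases hy : y ∈ Q <;> simp [hy]
      · by_cases hy : y ∈ P <;> simp [hy]
    have hI1 : Integrable (Q.indicator fun y => L y (f.1 y)) (μ.restrict F) :=
      ((integrable_indicator_iff hQ).2 hLf).mono_measure Measure.restrict_le_self
    have hI2 : Integrable (P.indicator fun y => L y c) (μ.restrict F) :=
      ((integrable_indicator_iff hPm).2 (hLc c)).mono_measure Measure.restrict_le_self
    rw [integral_congr_ae h1, integral_sub hI1 hI2, integral_indicator hQ, integral_indicator hPm,
      Measure.restrict_restrict hQ, Measure.restrict_restrict hPm, inter_eq_left.2 hQF,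
      inter_eq_left.2 hPF]
  have hdiff : ∀ y', ∫ y in Q, (L y - L y') (f.1 y) ∂μ =
      ∫ y in Q, L y (f.1 y) ∂μ - L y' (∫ y in Q, f.1 y ∂μ) := by
    intro y'
    simp only [_root_.sub_apply]
    rw [integral_sub hLf ((L y').integrable_comp hfi.integrableOn),
      (L y').integral_comp_comm hfi.integrableOn]
  have hmul : μ.real P • (∫ y in Q, L y (f.1 y) ∂μ - ∫ y in P, L y c ∂μ) =
      ∫ y' in P, ∫ y in Q, (L y - L y') (f.1 y) ∂μ ∂μ := by
    simp only [hdiff]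
    have hconst : IntegrableOn (fun _ : X => ∫ y in Q, L y (f.1 y) ∂μ) P μ :=
      integrableOn_const hPtop
    have hIc : μ.real P • ∫ y in P, L y c ∂μ = ∫ y in P, L y (∫ z in Q, f.1 z ∂μ) ∂μ := by
      rw [← integral_smul]
      refine integral_congr_ae (Eventually.of_forall fun y => ?_)
      dsimp only
      -- The real structures are not assumed compatible with those over 𝕜; a continuous additive map
      -- is real-linear nevertheless.
      have : L y c = (μ.real P)⁻¹ • L y (∫ z in Q, f.1 z ∂μ) :=
        map_real_smul (L y) (L y).continuous _ _
      rw [this, smul_smul, mul_inv_cancel₀ hPr, one_smul]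
    rw [integral_sub hconst (hLc _), setIntegral_const, smul_sub, hIc]
  have hnorm : μ P = ‖μ.real P‖ₑ := by
    rw [Measure.real, Real.enorm_eq_ofReal ENNReal.toReal_nonneg, ENNReal.ofReal_toReal hPtop]
  rw [hsplit]
  nth_rewrite 1 [hnorm]
  rw [← enorm_smul, hmul]
  refine (enorm_integral_le_lintegral_enorm _).trans (lintegral_mono fun y' => ?_)
  refine (enorm_integral_le_lintegral_enorm _).trans (lintegral_mono fun y => ?_)
  exact ContinuousLinearMap.le_opENorm _ _

end Atoms

/-! ### Strong type implies weak type -/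

section Strong

variable {X : Type*} [MetricSpace X] [MeasurableSpace X] [BorelSpace X] {μ : Measure X}
  {𝕜 : Type*} [RCLike 𝕜] {B : Type*} [NormedAddCommGroup B] [NormedSpace 𝕜 B]
  {B' : Type*} [NormedAddCommGroup B']

theorem eLpNorm_rpow_toReal {Z E : Type*} [MeasurableSpace Z] [NormedAddCommGroup E]
    {ν : Measure Z} {r : ℝ≥0∞} (h0 : r ≠ 0) (htop : r ≠ ∞) (f : Z → E) :
    eLpNorm f r ν ^ r.toReal = ∫⁻ x, ‖f x‖ₑ ^ r.toReal ∂ν := by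
  rw [eLpNorm_eq_lintegral_rpow_enorm_toReal h0 htop, ← ENNReal.rpow_mul, one_div_mul_cancel
    (ENNReal.toReal_pos h0 htop).ne', ENNReal.rpow_one]

/-- For r < ∞ this is Chebyshev's inequality. -/
theorem hasWeakType_of_strong {S : LinftyC 𝕜 B μ → (X →ₘ[μ] B')} {Y : Set X} {r : ℝ≥0∞}
    (hr : r ≠ 0) {A : ℝ≥0} (h : ∀ f : LinftyC 𝕜 B μ, ConcentratedOn f.1 Y →
      eLpNorm (S f) r μ ≤ A * eLpNorm f.1 r μ) :
    HasWeakType (fun f x => ‖S f x‖ₑ) Y r A := by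
  intro f hf
  refine ⟨fun htop => ?_, fun htop t ht => ?_⟩
  · have h1 := h f hf
    rw [htop] at h1
    filter_upwards [ae_le_eLpNormEssSup (f := S f) (μ := μ)] with x hx
    exact hx.trans ((eLpNorm_exponent_top (f := S f) (μ := μ)).symm.le.trans h1)
  · calc (t : ℝ≥0∞) ^ r.toReal * μ {x | (t : ℝ≥0∞) < ‖S f x‖ₑ}
        ≤ (t : ℝ≥0∞) ^ r.toReal * μ {x | (t : ℝ≥0∞) ≤ ‖S f x‖ₑ} :=
          mul_le_mul' le_rfl (measure_mono fun x (hx : (t : ℝ≥0∞) < ‖S f x‖ₑ) => hx.le)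
      _ ≤ eLpNorm (S f) r μ ^ r.toReal :=
          mul_meas_ge_le_pow_eLpNorm' μ hr htop (S f).aestronglyMeasurable t
      _ ≤ (A * eLpNorm f.1 r μ) ^ r.toReal := by gcongr; exact h f hf
      _ = _ := by
        rw [ENNReal.mul_rpow_of_nonneg _ _ ENNReal.toReal_nonneg, eLpNorm_rpow_toReal hr htop]

end Strong

/-! ### Direct conditions yield an abstract Calderón–Zygmund operator -/

section Direct

variable {X : Type*} [MetricSpace X] [MeasurableSpace X] [BorelSpace X] {μ : Measure X}
  {𝕜 : Type*} [RCLike 𝕜] {B₁ B₂ : Type*} [NormedAddCommGroup B₁] [NormedSpace 𝕜 B₁]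
  [NormedAddCommGroup B₂] [NormedSpace ℝ B₂] [NormedSpace 𝕜 B₂]

theorem ae_ae_swap_of_ae_prod [SFinite μ] {p : X × X → Prop} (h : ∀ᵐ z ∂μ.prod μ, p z) :
    ∀ᵐ y ∂μ, ∀ᵐ x ∂μ, p (x, y) :=
  Measure.ae_ae_of_ae_prod (Measure.measurePreserving_swap.quasiMeasurePreserving.ae h)

/-- This allows K to be replaced by a strongly measurable representative, for which Tonelli applies.
The kernel identity involves sections in y, the regularity condition sections in x, and almost all
sections of both kinds are unchanged. -/
theorem Conditions.congr_kernel [SFinite μ] {R : ℝ} {r : ℝ≥0∞} {A C : ℝ≥0} {E : Set X}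
    {S : LinftyC 𝕜 B₁ μ → (X →ₘ[μ] B₂)} {K K' : X → X → B₁ →L[𝕜] B₂}
    (h : Conditions μ R r A C E S K)
    (hK : Function.uncurry K =ᵐ[μ.prod μ] Function.uncurry K') :
    Conditions μ R r A C E S K' := by
  have h1 : ∀ᵐ x ∂μ, ∀ᵐ y ∂μ, K x y = K' x y := Measure.ae_ae_of_ae_prod hK
  have h2 : ∀ᵐ y ∂μ, ∀ᵐ x ∂μ, K x y = K' x y := ae_ae_swap_of_ae_prod hK
  refine ⟨fun F hF hFE => (h.integrable F hF hFE).congr (ae_restrict_of_ae hK),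
    fun F hF hFE f hf => ?_, h.bound, ?_⟩
  · filter_upwards [h.kernel F hF hFE f hf, h1] with x hx hx1 hxE
    rw [hx hxE]
    refine integral_congr_ae (ae_restrict_of_ae ?_)
    filter_upwards [hx1] with y hy
    rw [hy]
  · filter_upwards [h.regularity, h2] with y hy hy2
    filter_upwards [hy, h2] with y' hy' hy2' m1 m2 m3
    refine le_trans (le_of_eq (lintegral_congr_ae (ae_restrict_of_ae ?_))) (hy' m1 m2 m3)
    filter_upwards [hy2, hy2'] with x e1 e2
    rw [e1, e2]

theorem DualConditions.congr_kernel [SFinite μ] {R : ℝ} {r : ℝ≥0∞} {A C : ℝ≥0} {E : Set X}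
    {S : LinftyC 𝕜 B₁ μ → (X →ₘ[μ] B₂)} {K K' : X → X → B₁ →L[𝕜] B₂}
    (h : DualConditions μ R r A C E S K)
    (hK : Function.uncurry K =ᵐ[μ.prod μ] Function.uncurry K') :
    DualConditions μ R r A C E S K' := by
  have h1 : ∀ᵐ x ∂μ, ∀ᵐ y ∂μ, K x y = K' x y := Measure.ae_ae_of_ae_prod hK
  refine ⟨fun F hF hFE => (h.integrable F hF hFE).congr (ae_restrict_of_ae hK),
    fun F hF hFE f hf => ?_, h.bound, ?_⟩
  · filter_upwards [h.kernel F hF hFE f hf, h1] with x hx hx1 hxE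
    rw [hx hxE]
    refine integral_congr_ae (ae_restrict_of_ae ?_)
    filter_upwards [hx1] with y hy
    rw [hy]
  · filter_upwards [h.regularity, h1] with y hy hy2
    filter_upwards [hy, h1] with y' hy' hy2' m1 m2 m3
    refine le_trans (le_of_eq (lintegral_congr_ae (ae_restrict_of_ae ?_))) (hy' m1 m2 m3)
    filter_upwards [hy2, hy2'] with x e1 e2
    rw [e1, e2]

theorem subset_ball_of_mem_cthickening {E : Set X} {R : ℝ} (hR : 0 < R)
    (hE : Metric.ediam E < ENNReal.ofReal (R / 4)) {x : X} (hx : x ∈ Metric.cthickening (R / 3) E) :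
    E ⊆ Metric.ball x R := by
  intro z hz
  have hx' : x ∈ Metric.thickening (R / 2) E :=
    Metric.cthickening_subset_thickening' (by linarith) (by linarith) E hx
  obtain ⟨w, hw, hxw⟩ := Metric.mem_thickening_iff.1 hx'
  have h1 : edist z w < ENNReal.ofReal (R / 4) := (Metric.edist_le_ediam_of_mem hz hw).trans_lt hE
  rw [edist_dist, ENNReal.ofReal_lt_ofReal_iff (by linarith)] at h1
  rw [Metric.mem_ball]
  have := dist_triangle z w x
  rw [dist_comm w x] at this
  linarith

theorem ball_subset_thickening_of_mem_cthickening {E : Set X} {R : ℝ} (hR : 0 < R) {x : X}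
    (hx : x ∈ Metric.cthickening (R / 3) E) :
    Metric.ball x (R / 8) ⊆ Metric.thickening (R / 2) E := by
  intro z hz
  have hx' : x ∈ Metric.thickening (3 * R / 8) E :=
    Metric.cthickening_subset_thickening' (by linarith) (by linarith) E hx
  obtain ⟨w, hw, hxw⟩ := Metric.mem_thickening_iff.1 hx'
  refine Metric.mem_thickening_iff.2 ⟨w, hw, ?_⟩
  rw [Metric.mem_ball] at hz
  linarith [dist_triangle z x w]

theorem subadditiveOn_enorm (S : LinftyC 𝕜 B₁ μ →ₗ[𝕜] (X →ₘ[μ] B₂)) (Y : Set X) :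
    SubadditiveOn (fun f x => ‖S f x‖ₑ) Y := by
  intro f g _ _
  filter_upwards [AEEqFun.coeFn_add (S f) (S g)] with x hx
  rw [map_add, hx]
  exact enorm_add_le _ _

theorem lintegral_prod_triple_swap {ν₁ ν₂ ν₃ : Measure X} [SFinite ν₁] [SFinite ν₂] [SFinite ν₃]
    {Φ : X → X → X → ℝ≥0∞} (hΦ : Measurable fun p : X × X × X => Φ p.1 p.2.1 p.2.2) :
    ∫⁻ x, ∫⁻ y', ∫⁻ y, Φ x y' y ∂ν₃ ∂ν₂ ∂ν₁ = ∫⁻ y, ∫⁻ y', ∫⁻ x, Φ x y' y ∂ν₁ ∂ν₂ ∂ν₃ := by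
  have h1 : Measurable fun p : X × X => ∫⁻ y, Φ p.1 p.2 y ∂ν₃ :=
    Measurable.lintegral_prod_right' (f := fun q : (X × X) × X => Φ q.1.1 q.1.2 q.2)
      (hΦ.comp (by fun_prop : Measurable fun q : (X × X) × X => (q.1.1, q.1.2, q.2)))
  have h3 : Measurable fun p : X × X => ∫⁻ x, Φ x p.1 p.2 ∂ν₁ :=
    Measurable.lintegral_prod_right' (f := fun q : (X × X) × X => Φ q.2 q.1.1 q.1.2)
      (hΦ.comp (by fun_prop : Measurable fun q : (X × X) × X => (q.2, q.1.1, q.1.2)))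
  rw [lintegral_lintegral_swap h1.aemeasurable]
  have h2 : ∀ y', ∫⁻ x, ∫⁻ y, Φ x y' y ∂ν₃ ∂ν₁ = ∫⁻ y, ∫⁻ x, Φ x y' y ∂ν₁ ∂ν₃ := fun y' =>
    lintegral_lintegral_swap
      (hΦ.comp (by fun_prop : Measurable fun q : X × X => (q.1, y', q.2))).aemeasurable
  simp only [h2]
  exact lintegral_lintegral_swap h3.aemeasurable

variable [SecondCountableTopology X] [IsLocallyFiniteMeasure μ] [CompleteSpace B₁]
  [CompleteSpace B₂] [NormedSpace ℝ B₁]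

/-- The local Calderón–Zygmund conditions give a local Calderón–Zygmund operator. -/
theorem Conditions.isLocalCZOperator {R : ℝ} (hR : 0 < R) {r : ℝ≥0∞} (hr : 1 < r) {A C : ℝ≥0}
    {E : Set X} (hEm : MeasurableSet E) (hE : Metric.ediam E < ENNReal.ofReal (R / 4))
    {S : LinftyC 𝕜 B₁ μ →ₗ[𝕜] (X →ₘ[μ] B₂)} (hSE : ∀ f, ConcentratedOn (S f) E)
    {K : X → X → B₁ →L[𝕜] B₂} (hK : StronglyMeasurable (Function.uncurry K))
    (h : Conditions μ R r A C E S K) :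
    IsLocalCZOperator μ R r A C (Metric.cthickening (R / 3) E) (Metric.thickening (R / 2) E) E
      (fun f x => ‖S f x‖ₑ) := by
  set Ω := Metric.thickening (R / 2) E with hΩ
  have hKdiff : Measurable fun p : X × X × X => ‖K p.1 p.2.2 - K p.1 p.2.1‖ₑ :=
    ((hK.comp_measurable (by fun_prop : Measurable fun p : X × X × X => (p.1, p.2.2))).sub
      (hK.comp_measurable (by fun_prop : Measurable fun p : X × X × X => (p.1, p.2.1)))).enorm
  have hKm : Measurable fun p : X × X => ‖K p.1 p.2‖ₑ := hK.enorm
  refine ⟨hEm, fun x hx => subset_ball_of_mem_cthickening hR hE hx,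
    fun x hx => ball_subset_thickening_of_mem_cthickening hR hx,
    fun f => (S f).aestronglyMeasurable.enorm, subadditiveOn_enorm S Ω, fun f => ?_,
    hasWeakType_of_strong (zero_lt_one.trans hr).ne' h.bound, ?_, ?_⟩
  · filter_upwards [hSE f] with x hx hxE
    rw [hx hxE]; simp
  · intro G Q P hQ hP hG hQG hPG hP0 hgeo hdist f hf
    set F := G ∩ Ω with hF
    have hFo : IsOpen F := hG.inter Metric.isOpen_thickening
    have hFΩ : F ⊆ Ω := inter_subset_right
    have hEF : E \ G ⊆ E \ F := sdiff_subset_sdiff_right inter_subset_left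
    have hEGm : MeasurableSet (E \ G) := hEm.diff hG.measurableSet
    set b := cutC Q hQ.nullMeasurableSet f -
      indC 𝕜 μ P hP ((μ.real P)⁻¹ • ∫ y in Q, f.1 y ∂μ) with hb
    have hbF : ConcentratedOn b.1 F := ((concentratedOn_cutC_self f _).mono hQG).sub
      ((concentratedOn_indC hP _).mono hPG)
    have hint := h.integrable F hFo hFΩ
    rw [IntegrableOn, ← Measure.prod_restrict] at hint
    have hPtop : μ P ≠ ∞ := hP.measure_lt_top.ne
    have hpt : ∀ᵐ x ∂μ.restrict (E \ G), μ P * ‖S b x‖ₑ ≤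
        ∫⁻ y' in P, ∫⁻ y in Q, ‖K x y - K x y'‖ₑ * ‖f.1 y‖ₑ ∂μ ∂μ := by
      have h1 : ∀ᵐ x ∂μ.restrict (E \ G), Integrable (fun y => K x y) (μ.restrict F) :=
        ae_mono (Measure.restrict_mono hEF le_rfl) hint.prod_right_ae
      filter_upwards [h1, ae_restrict_of_ae (h.kernel F hFo hFΩ b hbF), ae_restrict_mem hEGm]
        with x h1 h2 h3
      rw [h2 (hEF h3)]
      exact measure_mul_enorm_integral_atom_le hQ hP hQG hPG hP0 h1 f
    have hreg : ∀ᵐ y ∂μ, ∀ᵐ y' ∂μ, y ∈ Q → y' ∈ P →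
        ∫⁻ x in E \ G, ‖K x y - K x y'‖ₑ ∂μ ≤ C := by
      filter_upwards [h.regularity] with y hy
      filter_upwards [hy] with y' hy' hyQ hyP
      have hsub : E \ G ⊆ E \ Metric.ball y (2 * dist y y') := by
        refine fun x hx => ⟨hx.1, ?_⟩
        rw [Metric.mem_ball, not_lt]
        exact hgeo x hx y hyQ y' hyP
      exact (lintegral_mono_set hsub).trans (hy' (hQG hyQ).2 (hPG hyP).2 (hdist y hyQ y' hyP))
    refine (ENNReal.mul_le_mul_iff_right hP0 hPtop).1 ?_
    rw [← lintegral_const_mul' _ _ hPtop]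
    -- Tonelli moves the integral over x inside, where the regularity condition bounds it by C for
    -- almost every pair (y, y').
    calc ∫⁻ x in E \ G, μ P * ‖S b x‖ₑ ∂μ
        ≤ ∫⁻ x in E \ G, ∫⁻ y' in P, ∫⁻ y in Q, ‖K x y - K x y'‖ₑ * ‖f.1 y‖ₑ ∂μ ∂μ ∂μ :=
          lintegral_mono_ae hpt
      _ = ∫⁻ y in Q, ∫⁻ y' in P, ∫⁻ x in E \ G, ‖K x y - K x y'‖ₑ * ‖f.1 y‖ₑ ∂μ ∂μ ∂μ :=
          lintegral_prod_triple_swap (Φ := fun x y' y => ‖K x y - K x y'‖ₑ * ‖f.1 y‖ₑ)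
            (hKdiff.mul ((measurable_enorm_coeFn f).comp (by fun_prop)))
      _ ≤ ∫⁻ y in Q, ∫⁻ y' in P, C * ‖f.1 y‖ₑ ∂μ ∂μ := by
          refine lintegral_mono_ae ?_
          filter_upwards [ae_restrict_of_ae hreg, ae_restrict_mem hQ] with y h1 h2
          refine lintegral_mono_ae ?_
          filter_upwards [ae_restrict_of_ae h1, ae_restrict_mem hP.isClosed.measurableSet]
            with y' h3 h4
          rw [lintegral_mul_const' _ _ enorm_ne_top]
          exact mul_le_mul' (h3 h2 h4) le_rfl
      _ = ∫⁻ y in Q, μ P * (C * ‖f.1 y‖ₑ) ∂μ := by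
          refine lintegral_congr fun y => ?_
          rw [setLIntegral_const, mul_comm]
      _ = _ := by
          rw [lintegral_const_mul' _ _ hPtop, lintegral_const_mul' _ _ ENNReal.coe_ne_top]
  · intro G hG
    set F := G ∩ Ω with hF
    have hFo : IsOpen F := hG.inter Metric.isOpen_thickening
    have hFΩ : F ⊆ Ω := inter_subset_right
    have hEF : E \ G ⊆ E \ F := sdiff_subset_sdiff_right inter_subset_left
    have hEFm : MeasurableSet (E \ F) := hEm.diff hFo.measurableSet
    have hint := h.integrable F hFo hFΩ
    rw [IntegrableOn, ← Measure.prod_restrict] at hint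
    -- The weight is the marginal of the norm of K on (E \ F) × F; its integral over F is finite
    -- because K is integrable on this product.
    refine ⟨fun y => ∫⁻ x in E \ F, ‖K x y‖ₑ ∂μ, ?_, ?_, fun f hf => ?_⟩
    · rw [← lintegral_prod_symm' (fun p : X × X => ‖K p.1 p.2‖ₑ) hKm]
      exact hint.2.ne
    · exact Measurable.lintegral_prod_left' hKm
    · calc ∫⁻ x in E \ G, ‖S f x‖ₑ ∂μ ≤ ∫⁻ x in E \ F, ‖S f x‖ₑ ∂μ := lintegral_mono_set hEF
        _ ≤ ∫⁻ x in E \ F, ∫⁻ y in F, ‖f.1 y‖ₑ * ‖K x y‖ₑ ∂μ ∂μ := by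
          refine lintegral_mono_ae ?_
          filter_upwards [ae_restrict_of_ae (h.kernel F hFo hFΩ f hf), ae_restrict_mem hEFm]
            with x h1 h2
          rw [h1 h2]
          refine (enorm_integral_le_lintegral_enorm _).trans (lintegral_mono fun y => ?_)
          rw [mul_comm]
          exact ContinuousLinearMap.le_opENorm _ _
        _ = ∫⁻ y in F, ∫⁻ x in E \ F, ‖f.1 y‖ₑ * ‖K x y‖ₑ ∂μ ∂μ :=
          lintegral_lintegral_swap
            (((measurable_enorm_coeFn f).comp measurable_snd).mul hKm).aemeasurable
        _ = _ := by
          refine lintegral_congr fun y => ?_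
          rw [lintegral_const_mul' _ _ enorm_ne_top]

end Direct

/-! ### Interpolation stated for norms -/

section NormForm

variable {X : Type*} [MetricSpace X] [MeasurableSpace X] {μ : Measure X}
  {𝕜 : Type*} [RCLike 𝕜] {B : Type*} [NormedAddCommGroup B] [NormedSpace 𝕜 B]

/-- Undoes the normalisation by 2κ. The factor 2 of the conclusion is the halving that subadditivity
required. -/
theorem rpow_lintegral_le_of_scaled {v F : X → ℝ≥0∞} (hv : AEMeasurable v μ) {a p : ℝ}
    (hp : 0 < p) {α κ : ℝ≥0} (hκ : 0 < κ)
    (h : (κ : ℝ≥0∞) ^ a * ∫⁻ x, (v x / 2 / κ) ^ p ∂μ ≤ α * ∫⁻ x, F x ^ p ∂μ) :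
    (∫⁻ x, v x ^ p ∂μ) ^ (1 / p) ≤
      2 * (((α * κ ^ (p - a)) ^ (1 / p) : ℝ≥0) : ℝ≥0∞) * (∫⁻ x, F x ^ p ∂μ) ^ (1 / p) := by
  have hκ0 : (κ : ℝ≥0∞) ≠ 0 := by exact_mod_cast hκ.ne'
  have h2κ : ∀ y : ℝ≥0∞, y ^ p = (2 * κ) ^ p * (y / 2 / κ) ^ p := by
    intro y
    rw [← ENNReal.mul_rpow_of_nonneg _ _ hp.le]
    congr 1
    rw [mul_assoc, ENNReal.mul_div_cancel hκ0 ENNReal.coe_ne_top,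
      ENNReal.mul_div_cancel two_ne_zero ENNReal.ofNat_ne_top]
  have h1 : ∫⁻ x, v x ^ p ∂μ ≤ 2 ^ p * ((α * κ ^ (p - a) : ℝ≥0) * ∫⁻ x, F x ^ p ∂μ) := by
    calc ∫⁻ x, v x ^ p ∂μ = (2 * κ) ^ p * ∫⁻ x, (v x / 2 / κ) ^ p ∂μ := by
          rw [← lintegral_const_mul'' _ (((hv.div_const _).div_const _).pow_const _)]
          exact lintegral_congr fun x => h2κ _
      _ = 2 ^ p * (κ ^ (p - a) * (κ ^ a * ∫⁻ x, (v x / 2 / κ) ^ p ∂μ)) := by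
          rw [ENNReal.mul_rpow_of_nonneg _ _ hp.le, ← mul_assoc ((κ : ℝ≥0∞) ^ (p - a)),
            ← ENNReal.rpow_add _ _ hκ0 ENNReal.coe_ne_top, sub_add_cancel, mul_assoc]
      _ ≤ 2 ^ p * (κ ^ (p - a) * (α * ∫⁻ x, F x ^ p ∂μ)) := by gcongr
      _ = _ := by
          rw [ENNReal.coe_mul, ← ENNReal.coe_rpow_of_ne_zero hκ.ne']
          ring
  calc (∫⁻ x, v x ^ p ∂μ) ^ (1 / p)
      ≤ (2 ^ p * ((α * κ ^ (p - a) : ℝ≥0) * ∫⁻ x, F x ^ p ∂μ)) ^ (1 / p) :=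
        ENNReal.rpow_le_rpow h1 (by positivity)
    _ = _ := by
      rw [ENNReal.mul_rpow_of_nonneg _ _ (by positivity),
        ENNReal.mul_rpow_of_nonneg _ _ (by positivity), ← ENNReal.rpow_mul,
        mul_one_div_cancel hp.ne', ENNReal.rpow_one,
        ENNReal.coe_rpow_of_nonneg _ (by positivity), mul_assoc]

theorem strong_interpolation_norm [SFinite μ] {U : LinftyC 𝕜 B μ → X → ℝ≥0∞} {Y : Set X}
    (hmeas : ∀ f, AEMeasurable (U f) μ) (hadd : SubadditiveOn U Y) {a p b : ℝ} (ha : 0 < a)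
    (hap : a < p) (hpb : p < b) {Ma Mb : ℝ≥0} (hMa : 0 < Ma) (hMb : 0 < Mb)
    (hUa : ∀ f : LinftyC 𝕜 B μ, ConcentratedOn f.1 Y →
      ∫⁻ x, U f x ^ a ∂μ ≤ Ma ^ a * ∫⁻ x, ‖f.1 x‖ₑ ^ a ∂μ)
    (hUb : ∀ f : LinftyC 𝕜 B μ, ConcentratedOn f.1 Y →
      ∫⁻ x, U f x ^ b ∂μ ≤ Mb ^ b * ∫⁻ x, ‖f.1 x‖ₑ ^ b ∂μ)
    (f : LinftyC 𝕜 B μ) (hf : ConcentratedOn f.1 Y) :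
    (∫⁻ x, U f x ^ p ∂μ) ^ (1 / p) ≤ 2 * ((Ma ^ (a * (b - p) / (p * (b - a))) *
      Mb ^ (b * (p - a) / (p * (b - a))) : ℝ≥0) : ℝ≥0∞) *
        (∫⁻ x, ‖f.1 x‖ₑ ^ p ∂μ) ^ (1 / p) := by
  have hp : 0 < p := ha.trans hap
  have hb : 0 < b := hp.trans hpb
  have hba : 0 < b - a := by linarith
  -- With α = Ma^a, this is the κ for which the bound at b has the required form α κ^(b-a).
  set κ : ℝ≥0 := (Mb ^ b / Ma ^ a) ^ (1 / (b - a)) with hκ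
  have hκ0 : 0 < κ := by positivity
  have hκb : Ma ^ a * κ ^ (b - a) = Mb ^ b := by
    rw [hκ, ← NNReal.rpow_mul, one_div_mul_cancel hba.ne', NNReal.rpow_one, mul_div_cancel₀]
    positivity
  have hMa' : ((Ma ^ a : ℝ≥0) : ℝ≥0∞) = (Ma : ℝ≥0∞) ^ a := ENNReal.coe_rpow_of_nonneg _ ha.le
  have key := strong_interpolation hmeas hadd ha hap hpb (α := Ma ^ a) hκ0
    (fun f hf => by rw [hMa']; exact hUa f hf) (fun f hf => by
      rw [← ENNReal.coe_rpow_of_ne_zero hκ0.ne', ← ENNReal.coe_mul, hκb,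
        ENNReal.coe_rpow_of_nonneg _ hb.le]
      exact hUb f hf) f hf
  refine (rpow_lintegral_le_of_scaled (hmeas f) hp hκ0 key).trans (le_of_eq ?_)
  congr 3
  rw [hκ, ← NNReal.rpow_mul, NNReal.div_rpow, ← NNReal.rpow_mul, ← NNReal.rpow_mul,
    div_eq_mul_inv, ← NNReal.rpow_neg, mul_left_comm, ← NNReal.rpow_add hMa.ne',
    NNReal.mul_rpow, ← NNReal.rpow_mul, ← NNReal.rpow_mul, mul_comm]
  have hne := hba.ne'
  congr 2
  · field_simp
    ring
  · field_simp

theorem strong_interpolation_top_norm [SFinite μ] {U : LinftyC 𝕜 B μ → X → ℝ≥0∞} {Y : Set X}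
    (hmeas : ∀ f, AEMeasurable (U f) μ) (hadd : SubadditiveOn U Y) {a p : ℝ} (ha : 0 < a)
    (hap : a < p) {Ma Mb : ℝ≥0} (hMb : 0 < Mb)
    (hUa : ∀ f : LinftyC 𝕜 B μ, ConcentratedOn f.1 Y →
      ∫⁻ x, U f x ^ a ∂μ ≤ Ma ^ a * ∫⁻ x, ‖f.1 x‖ₑ ^ a ∂μ)
    (hUb : ∀ f : LinftyC 𝕜 B μ, ConcentratedOn f.1 Y →
      ∀ᵐ x ∂μ, U f x ≤ Mb * eLpNorm f.1 ∞ μ)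
    (f : LinftyC 𝕜 B μ) (hf : ConcentratedOn f.1 Y) :
    (∫⁻ x, U f x ^ p ∂μ) ^ (1 / p) ≤ 2 * ((Ma ^ (a / p) * Mb ^ ((p - a) / p) : ℝ≥0) : ℝ≥0∞) *
        (∫⁻ x, ‖f.1 x‖ₑ ^ p ∂μ) ^ (1 / p) := by
  have hp : 0 < p := ha.trans hap
  have hMa' : ((Ma ^ a : ℝ≥0) : ℝ≥0∞) = (Ma : ℝ≥0∞) ^ a := ENNReal.coe_rpow_of_nonneg _ ha.le
  have key := strong_interpolation_top hmeas hadd ha hap (α := Ma ^ a) hMb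
    (fun f hf => by rw [hMa']; exact hUa f hf) hUb f hf
  refine (rpow_lintegral_le_of_scaled (hmeas f) hp hMb key).trans (le_of_eq ?_)
  congr 3
  rw [NNReal.mul_rpow, ← NNReal.rpow_mul, ← NNReal.rpow_mul, mul_one_div, mul_one_div]

end NormForm

/-! ### Real forms of the exponents and constants -/

section Exponents

theorem marcinkiewiczConst_ne_zero {r q : ℝ≥0∞} (hq : 1 < q) (hq' : q ≠ ∞) :
    marcinkiewiczConst r q ≠ 0 := by
  have : q / (q - 1) ≠ 0 :=
    (ENNReal.div_pos (zero_lt_one.trans hq).ne' (ENNReal.sub_ne_top hq')).ne'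
  simp [marcinkiewiczConst, this]

theorem marcinkiewiczConst_ne_top {r q : ℝ≥0∞} (hq : 1 < q) (hqr : q < r) :
    marcinkiewiczConst r q ≠ ∞ := by
  have hq' : q ≠ ∞ := hqr.ne_top
  refine ENNReal.add_ne_top.2 ⟨ENNReal.div_ne_top hq' (tsub_pos_of_lt hq).ne', ?_⟩
  refine ENNReal.div_ne_top ENNReal.one_ne_top (tsub_pos_of_lt ?_).ne'
  rwa [ENNReal.lt_div_iff_mul_lt (Or.inl (zero_lt_one.trans hq).ne') (Or.inl hq'), one_mul]

theorem toReal_interpolation_exponent {q p r : ℝ} (hq : 0 < q) (hqp : q < p) (hpr : p < r) :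
    ((1 / ENNReal.ofReal p - 1 / ENNReal.ofReal r) /
      (1 - ENNReal.ofReal q / ENNReal.ofReal r)).toReal = (1 / p - 1 / r) / (1 - q / r) := by
  have hp : 0 < p := hq.trans hqp
  have hr : 0 < r := hp.trans hpr
  have h1 : 0 < 1 - q / r := by rw [sub_pos, div_lt_one hr]; linarith
  have h2 : 1 / r ≤ 1 / p := one_div_le_one_div_of_le hp hpr.le
  rw [← ENNReal.ofReal_one, ← ENNReal.ofReal_div_of_pos hp, ← ENNReal.ofReal_div_of_pos hr,
    ← ENNReal.ofReal_div_of_pos hr, ← ENNReal.ofReal_sub _ (by positivity),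
    ← ENNReal.ofReal_sub _ (by positivity), ← ENNReal.ofReal_div_of_pos h1,
    ENNReal.toReal_ofReal]
  exact div_nonneg (by linarith) h1.le

theorem toReal_interpolation_exponent_top (q p : ℝ≥0∞) :
    ((1 / p - 1 / ∞) / (1 - q / ∞)).toReal = 1 / p.toReal := by
  simp [ENNReal.div_top]

theorem eLpNorm_coe_eq {Z E : Type*} [MeasurableSpace Z] [NormedAddCommGroup E] {ν : Measure Z}
    {p : ℝ≥0} (hp : (p : ℝ≥0∞) ≠ 0) (f : Z → E) :
    eLpNorm f p ν = (∫⁻ x, ‖f x‖ₑ ^ (p : ℝ) ∂ν) ^ (1 / (p : ℝ)) := by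
  rw [eLpNorm_eq_lintegral_rpow_enorm_toReal hp ENNReal.coe_ne_top, ENNReal.coe_toReal]

end Exponents

/-! ### Local L^p bound in the direct case -/

section LocalBound

variable {X : Type*} [MetricSpace X] [MeasurableSpace X] [BorelSpace X] {μ : Measure X}
  {𝕜 : Type*} [RCLike 𝕜] {B₁ B₂ : Type*} [NormedAddCommGroup B₁] [NormedSpace 𝕜 B₁]
  [NormedAddCommGroup B₂] [NormedSpace ℝ B₂] [NormedSpace 𝕜 B₂]
  [SecondCountableTopology X] [IsLocallyFiniteMeasure μ] [μ.InnerRegular] [μ.IsOpenPosMeasure]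
  [CompleteSpace B₁] [CompleteSpace B₂] [NormedSpace ℝ B₁]

/-- The weak type `(1, 1)` constant of the local Calderón–Zygmund theory. -/
def weakConst (D A C : ℝ≥0) : ℝ≥0 := 4 * (D ^ 9 * A + C)

theorem le_weakConst {D A C : ℝ≥0} (hD : 1 ≤ D) : A ≤ weakConst D A C := by
  unfold weakConst
  have h1 : A ≤ D ^ 9 * A := le_mul_of_one_le_left zero_le (one_le_pow₀ hD)
  calc A ≤ D ^ 9 * A + C := h1.trans le_self_add
    _ ≤ _ := le_mul_of_one_le_left zero_le (by norm_num)

theorem weakConst_pos {D A C : ℝ≥0} (hD : 1 ≤ D) (hA : 0 < A) : 0 < weakConst D A C :=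
  hA.trans_le (le_weakConst hD)

/-- The `L^q` bound of a local Calderón–Zygmund operator, for `1 < q < r`. -/
theorem IsLocalCZOperator.lintegral_rpow_le {B : Type*} [NormedAddCommGroup B] [NormedSpace 𝕜 B]
    [NormedSpace ℝ B] {R : ℝ} {D : ℝ≥0}
    (hD : DoublingUpTo μ R D) (hD1 : 1 ≤ D) (hR : 0 < R) {r : ℝ≥0∞} {A C : ℝ≥0}
    (hA : 0 < A) {Y Ω E : Set X} {U : LinftyC 𝕜 B μ → X → ℝ≥0∞}
    (hU : IsLocalCZOperator μ R r A C Y Ω E U) {q : ℝ} (hq : 1 < q) (hqr : ENNReal.ofReal q < r)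
    (f : LinftyC 𝕜 B μ) (hf : ConcentratedOn f.1 Y) :
    ∫⁻ x, U f x ^ q ∂μ ≤ marcinkiewiczConst r (ENNReal.ofReal q) *
      ((2 * weakConst D A C) ^ q * ∫⁻ x, ‖f.1 x‖ₑ ^ q ∂μ) := by
  have hr1 : 1 < r := (ENNReal.one_lt_ofReal.2 hq).trans hqr
  have hYΩ : Y ⊆ Ω := fun x hx => hU.ball_subset x hx (Metric.mem_ball_self (by positivity))
  exact marcinkiewicz (weakConst_pos hD1 hA) hU.aemeasurable
    (fun f g hf hg => hU.subadditive f g (hf.mono hYΩ) (hg.mono hYΩ))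
    (fun f hf t ht => hU.weakType_one hD hD1 hR hr1.le hA f hf t ht)
    (hU.weakType.mono hYΩ (le_weakConst hD1)) hq hqr f hf

/-- The local `L^p` bound for `1 < p ≤ r`. -/
theorem Conditions.eLpNorm_le {R : ℝ} {D : ℝ≥0}
    (hD : DoublingUpTo μ R D) (hD1 : 1 ≤ D) (hR : 0 < R) {r : ℝ≥0∞} {A C : ℝ≥0}
    (hA : 0 < A) {E : Set X} (hEm : MeasurableSet E) (hE : Metric.ediam E < ENNReal.ofReal (R / 4))
    {S : LinftyC 𝕜 B₁ μ →ₗ[𝕜] (X →ₘ[μ] B₂)} (hSE : ∀ f, ConcentratedOn (S f) E)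
    {K : X → X → B₁ →L[𝕜] B₂} (hK : StronglyMeasurable (Function.uncurry K))
    (h : Conditions μ R r A C E S K) {p : ℝ≥0∞} (hpr : p ≤ r) {q : ℝ≥0∞}
    (hq : 1 < q) (hqp : q < p) (f : LinftyC 𝕜 B₁ μ)
    (hf : ConcentratedOn f.1 (Metric.cthickening (R / 3) E)) :
    eLpNorm (S f) p μ ≤ 4 * weakConst D A C *
      marcinkiewiczConst r q ^ ((1 / p - 1 / r) / (1 - q / r)).toReal * eLpNorm f.1 p μ := by
  set M := weakConst D A C with hM
  have hAM : A ≤ M := le_weakConst hD1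
  have hM0 : 0 < M := weakConst_pos hD1 hA
  have hYΩ : Metric.cthickening (R / 3) E ⊆ Metric.thickening (R / 2) E :=
    Metric.cthickening_subset_thickening' (by linarith) (by linarith) E
  have hq' : q ≠ ∞ := hqp.ne_top
  -- At p = r the exponent of Φ is 0, and the assumed L^r bound suffices since A ≤ M.
  rcases hpr.eq_or_lt with rfl | hlt
  · rw [tsub_self, ENNReal.zero_div, ENNReal.toReal_zero, ENNReal.rpow_zero, mul_one]
    refine (h.bound f (hf.mono hYΩ)).trans (mul_le_mul' ?_ le_rfl)
    calc (A : ℝ≥0∞) ≤ M := by exact_mod_cast hAM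
      _ ≤ 4 * M := le_mul_of_one_le_left zero_le (by norm_num)
  have hp' : p ≠ ∞ := hlt.ne_top
  have hqr : q < r := hqp.trans hlt
  have hCZ := h.isLocalCZOperator hR (hq.trans hqr) hEm hE hSE hK
  lift q to ℝ≥0 using hq'
  lift p to ℝ≥0 using hp'
  have hΦ0 := marcinkiewiczConst_ne_zero (r := r) hq ENNReal.coe_ne_top
  have hΦt := marcinkiewiczConst_ne_top hq hqr
  have hLq : ∀ g : LinftyC 𝕜 B₁ μ, ConcentratedOn g.1 (Metric.cthickening (R / 3) E) →
      ∫⁻ x, ‖S g x‖ₑ ^ (q : ℝ) ∂μ ≤ marcinkiewiczConst r q *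
        ((2 * M) ^ (q : ℝ) * ∫⁻ x, ‖g.1 x‖ₑ ^ (q : ℝ) ∂μ) := fun g hg => by
    have := hCZ.lintegral_rpow_le hD hD1 hR hA (q := q) (by exact_mod_cast hq)
      (by rwa [ENNReal.ofReal_coe_nnreal]) g hg
    rwa [ENNReal.ofReal_coe_nnreal] at this
  lift marcinkiewiczConst r q to ℝ≥0 using hΦt with Φ hΦ
  have hΦ0' : 0 < Φ := pos_iff_ne_zero.2 (by exact_mod_cast hΦ0)
  have hq1 : (1 : ℝ) < q := by exact_mod_cast hq
  have hq0 : (0 : ℝ) < q := by linarith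
  have hqp' : (q : ℝ) < p := by exact_mod_cast hqp
  have hp0 : (0 : ℝ) < p := by linarith
  have hpne : (p : ℝ≥0∞) ≠ 0 := by exact_mod_cast (show p ≠ 0 from fun h => by simp [h] at hp0)
  -- The norm on L^q given by Marcinkiewicz. On L^r the norm A is relaxed to 2 M, so that the two
  -- endpoints differ only by the power of Φ and 2 M passes through the interpolation unchanged.
  set Ma : ℝ≥0 := 2 * M * Φ ^ (1 / (q : ℝ)) with hMa
  have hMa0 : 0 < Ma := by positivity
  have hMaq : (Ma : ℝ≥0∞) ^ (q : ℝ) = Φ * (2 * M) ^ (q : ℝ) := by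
    rw [hMa, ENNReal.coe_mul, ENNReal.mul_rpow_of_nonneg _ _ hq0.le,
      ← ENNReal.coe_rpow_of_nonneg (Φ ^ (1 / (q : ℝ))) hq0.le, ← NNReal.rpow_mul,
      one_div_mul_cancel hq0.ne', NNReal.rpow_one, mul_comm]
    simp
  have hUa : ∀ g : LinftyC 𝕜 B₁ μ, ConcentratedOn g.1 (Metric.cthickening (R / 3) E) →
      ∫⁻ x, ‖S g x‖ₑ ^ (q : ℝ) ∂μ ≤ Ma ^ (q : ℝ) * ∫⁻ x, ‖g.1 x‖ₑ ^ (q : ℝ) ∂μ := fun g hg => by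
    rw [hMaq, mul_assoc]; exact hLq g hg
  have h2M : (2 * M : ℝ≥0) ≠ 0 := by positivity
  rw [eLpNorm_coe_eq hpne, eLpNorm_coe_eq hpne]
  by_cases htop : r = ∞
  · subst htop
    have key := strong_interpolation_top_norm (U := fun g x => ‖S g x‖ₑ)
      (fun g => (S g).aestronglyMeasurable.enorm) (subadditiveOn_enorm S _) hq0 hqp'
      (Mb := 2 * M) (by positivity) hUa (fun g hg => by
        filter_upwards [((hasWeakType_of_strong ENNReal.top_ne_zero h.bound) g
          (hg.mono hYΩ)).1 rfl] with x hx
        refine hx.trans (mul_le_mul' ?_ le_rfl)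
        have : A ≤ 2 * M := hAM.trans (le_mul_of_one_le_left zero_le (by norm_num))
        exact_mod_cast this) f hf
    refine key.trans (le_of_eq ?_)
    rw [toReal_interpolation_exponent_top _ _, ENNReal.coe_toReal]
    congr 1
    rw [← ENNReal.coe_rpow_of_nonneg _ (by positivity), hMa, NNReal.mul_rpow, ← NNReal.rpow_mul,
      mul_right_comm, ← NNReal.rpow_add h2M, ← add_div, add_sub_cancel, div_self hp0.ne',
      NNReal.rpow_one, show 1 / (q : ℝ) * (q / p) = 1 / p by field_simp]
    push_cast
    ring
  · lift r to ℝ≥0 using htop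
    have hpr' : (p : ℝ) < r := by exact_mod_cast hlt
    have hr0 : (0 : ℝ) < r := by linarith
    have hrne : (r : ℝ≥0∞) ≠ 0 := by exact_mod_cast (show r ≠ 0 from fun h => by simp [h] at hr0)
    have key := strong_interpolation_norm (U := fun g x => ‖S g x‖ₑ)
      (fun g => (S g).aestronglyMeasurable.enorm) (subadditiveOn_enorm S _) hq0 hqp' hpr'
      hMa0 (Mb := 2 * M) (by positivity) hUa (fun g hg => by
        have h1 := h.bound g (hg.mono hYΩ)
        have h2 := ENNReal.rpow_le_rpow h1 hr0.le
        rw [ENNReal.mul_rpow_of_nonneg _ _ hr0.le] at h2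
        have e : ((r : ℝ≥0∞)).toReal = (r : ℝ) := ENNReal.coe_toReal r
        have e1 := eLpNorm_rpow_toReal (ν := μ) hrne ENNReal.coe_ne_top (S g)
        have e2 := eLpNorm_rpow_toReal (ν := μ) hrne ENNReal.coe_ne_top g.1
        rw [e] at e1 e2
        rw [e1, e2] at h2
        refine h2.trans (mul_le_mul' (ENNReal.rpow_le_rpow ?_ hr0.le) le_rfl)
        have : A ≤ 2 * M := hAM.trans (le_mul_of_one_le_left zero_le (by norm_num))
        exact_mod_cast this) f hf
    refine key.trans (le_of_eq ?_)
    have hexp := toReal_interpolation_exponent hq0 hqp' hpr'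
    simp only [ENNReal.ofReal_coe_nnreal] at hexp
    rw [hexp]
    congr 1
    have hrq : (r : ℝ) - q ≠ 0 := by linarith
    have hθ : (1 / (p : ℝ) - 1 / r) / (1 - q / r) = (r - p) / (p * (r - q)) := by
      have : 1 - (q : ℝ) / r ≠ 0 := by
        rw [sub_ne_zero]
        intro h0
        rw [eq_div_iff hr0.ne'] at h0
        exact hrq (by linarith)
      field_simp
    have hθ0 : 0 ≤ ((r : ℝ) - p) / (p * (r - q)) :=
      div_nonneg (by linarith) (mul_nonneg hp0.le (by linarith))
    rw [hθ, ← ENNReal.coe_rpow_of_nonneg _ hθ0, hMa, NNReal.mul_rpow, ← NNReal.rpow_mul,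
      mul_right_comm, ← NNReal.rpow_add h2M,
      show (q : ℝ) * (r - p) / (p * (r - q)) + r * (p - q) / (p * (r - q)) = 1 by
        field_simp; ring,
      NNReal.rpow_one, show 1 / (q : ℝ) * (q * (r - p) / (p * (r - q))) =
        (r - p) / (p * (r - q)) by field_simp]
    push_cast
    ring

end LocalBound

/-! ### Small pieces with bounded overlap, and passage from local to global -/

section Partition

variable {X : Type*} [MetricSpace X] [MeasurableSpace X] [BorelSpace X] {μ : Measure X}

theorem exists_maximal_separated (δ : ℝ) (hδ : 0 < δ) : ∃ N : Set X,
    (∀ y ∈ N, ∀ z ∈ N, y ≠ z → δ ≤ dist y z) ∧ ∀ x : X, ∃ y ∈ N, dist x y < δ := by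
  obtain ⟨N, hN⟩ := zorn_subset {N : Set X | ∀ y ∈ N, ∀ z ∈ N, y ≠ z → δ ≤ dist y z} (by
    intro c hc hchain
    refine ⟨⋃₀ c, ?_, fun s hs => subset_sUnion_of_mem hs⟩
    rintro y ⟨a, ha, hya⟩ z ⟨b, hb, hzb⟩ hyz
    rcases hchain.total ha hb with hab | hab
    · exact hc hb y (hab hya) z hzb hyz
    · exact hc ha y hya z (hab hzb) hyz)
  refine ⟨N, hN.prop, fun x => ?_⟩
  by_contra! hx
  have hxN : x ∉ N := fun h => by
    have := hx x h
    rw [dist_self] at this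
    linarith
  refine hxN (hN.le_of_ge (y := insert x N) ?_ (subset_insert x N) (mem_insert x N))
  intro y hy z hz hyz
  rcases hy with rfl | hy <;> rcases hz with rfl | hz
  · exact absurd rfl hyz
  · exact hx z hz
  · rw [dist_comm]; exact hx y hy
  · exact hN.prop y hy z hz hyz

/-- A countable partition into small sets whose neighbourhoods have bounded overlap. -/
theorem DoublingUpTo.exists_partition [SecondCountableTopology X] [IsLocallyFiniteMeasure μ]
    [μ.IsOpenPosMeasure] {R : ℝ} {D : ℝ≥0} (hD : DoublingUpTo μ R D) (hR : 0 < R) :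
    ∃ (N : Set X) (E : N → Set X), N.Countable ∧ (∀ j, MeasurableSet (E j)) ∧
      (∀ j, Metric.ediam (E j) < ENNReal.ofReal (R / 4)) ∧ ⋃ j, E j = univ ∧
      ∀ x, ∑' j, (Metric.cthickening (R / 3) (E j)).indicator (1 : X → ℝ≥0∞) x ≤ D ^ 5 := by
  -- Pieces inside balls of radius R/10 have diameter at most R/5 < R/4. A point within R/3 < 7R/20
  -- of a piece is within 9R/20 of its centre.
  obtain ⟨N, hsep, hcov⟩ := exists_maximal_separated (X := X) (R / 10) (by positivity)
  have hNc : N.Countable := by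
    refine PairwiseDisjoint.countable_of_isOpen (s := fun x => Metric.ball x (R / 20))
      (fun y hy z hz hyz => Metric.ball_disjoint_ball ?_) (fun _ _ => Metric.isOpen_ball)
      (fun x _ => ⟨x, Metric.mem_ball_self (by positivity)⟩)
    linarith [hsep y hy z hz hyz]
  have := hNc.to_subtype
  obtain ⟨E, hEm, hEsub, -, hEU⟩ := exists_disjoint_refinement
    (fun j : N => Metric.ball (j : X) (R / 10)) fun j => Metric.isOpen_ball.measurableSet
  refine ⟨N, E, hNc, hEm, fun j => ?_, ?_, fun x => ?_⟩
  · refine lt_of_le_of_lt (Metric.ediam_le fun y hy z hz => ?_)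
      ((ENNReal.ofReal_lt_ofReal_iff (by positivity)).2 (by linarith : R / 5 < R / 4))
    have h1 : dist y j < R / 10 := hEsub j hy
    have h2 : dist z j < R / 10 := hEsub j hz
    rw [edist_dist]
    exact ENNReal.ofReal_le_ofReal (by linarith [dist_triangle_right y z j])
  · rw [hEU, eq_univ_iff_forall]
    intro x
    obtain ⟨y, hy, hxy⟩ := hcov x
    exact mem_iUnion.2 ⟨⟨y, hy⟩, hxy⟩
  · classical
    rw [ENNReal.tsum_eq_iSup_sum]
    refine iSup_le fun s => ?_
    have h1 : ∑ j ∈ s, (Metric.cthickening (R / 3) (E j)).indicator (1 : X → ℝ≥0∞) x =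
        ((s.filter fun j => x ∈ Metric.cthickening (R / 3) (E j)).card : ℝ≥0∞) := by
      rw [Finset.card_filter]
      push_cast
      exact Finset.sum_congr rfl fun j _ => by simp [indicator_apply]
    rw [h1, ← Finset.card_map (Function.Embedding.subtype _)]
    -- Here 2ρ + σ = 19R/20 is at most 2^5 σ = 8R/5, which is at most 2R. This is the origin of the
    -- power 5.
    refine hD.card_le hR (σ := R / 20) (ρ := 9 * R / 20) (by positivity) 5 (by linarith)
      (by linarith) x _ ?_ ?_
    · intro y hy z hz hyz
      obtain ⟨j, -, rfl⟩ := Finset.mem_map.1 hy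
      obtain ⟨k, -, rfl⟩ := Finset.mem_map.1 hz
      have := hsep j j.2 k k.2 hyz
      simp only [Function.Embedding.subtype_apply]
      linarith
    · intro y hy
      obtain ⟨j, hj, rfl⟩ := Finset.mem_map.1 hy
      have hj' : x ∈ Metric.cthickening (R / 3) (E j) := (Finset.mem_filter.1 hj).2
      obtain ⟨w, hw, hxw⟩ := Metric.mem_thickening_iff.1
        (Metric.cthickening_subset_thickening' (δ₂ := 7 * R / 20) (by positivity) (by linarith)
          _ hj')
      have h2 : dist w j < R / 10 := hEsub j hw
      simp only [Function.Embedding.subtype_apply]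
      rw [dist_comm]
      linarith [dist_triangle x w j]

/-- The p-th powers add up over the pieces, and each point is counted at most N times on the right.
For p = ∞ the overlap costs nothing. -/
theorem eLpNorm_le_of_local {ι B B' : Type*} [Countable ι] [NormedAddCommGroup B]
    [NormedAddCommGroup B'] {E E' : ι → Set X} (hE : ⋃ j, E j = univ)
    (hE' : ∀ j, MeasurableSet (E' j)) {N : ℝ≥0∞}
    (hN : ∀ x, ∑' j, (E' j).indicator (1 : X → ℝ≥0∞) x ≤ N) {p : ℝ≥0∞} (hp : p ≠ 0) {M : ℝ≥0∞}
    {h : X → B} {f : X → B'} (hf : AEStronglyMeasurable f μ)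
    (hloc : ∀ j, eLpNorm h p (μ.restrict (E j)) ≤ M * eLpNorm f p (μ.restrict (E' j))) :
    eLpNorm h p μ ≤ M * N ^ (1 / p).toReal * eLpNorm f p μ := by
  by_cases htop : p = ∞
  · subst htop
    simp only [ENNReal.div_top, ENNReal.toReal_zero, ENNReal.rpow_zero, mul_one]
    simp only [eLpNorm_exponent_top] at hloc ⊢
    refine eLpNormEssSup_le_of_ae_enorm_bound ?_
    have h1 : ∀ j, ∀ᵐ x ∂μ.restrict (E j), ‖h x‖ₑ ≤ M * eLpNormEssSup f μ := fun j => by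
      filter_upwards [ae_le_eLpNormEssSup (f := h) (μ := μ.restrict (E j))] with x hx
      refine hx.trans ((hloc j).trans (mul_le_mul' le_rfl ?_))
      exact eLpNormEssSup_mono_measure _ Measure.absolutelyContinuous_restrict
    have := (ae_restrict_iUnion_iff E _).2 h1
    rwa [hE, Measure.restrict_univ] at this
  · have hp0 : 0 < p.toReal := ENNReal.toReal_pos hp htop
    have h1 : ∀ j, ∫⁻ x in E j, ‖h x‖ₑ ^ p.toReal ∂μ ≤
        M ^ p.toReal * ∫⁻ x in E' j, ‖f x‖ₑ ^ p.toReal ∂μ := fun j => by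
      rw [← eLpNorm_rpow_toReal hp htop, ← eLpNorm_rpow_toReal hp htop,
        ← ENNReal.mul_rpow_of_nonneg _ _ hp0.le]
      exact ENNReal.rpow_le_rpow (hloc j) hp0.le
    have h2 : ∫⁻ x, ‖h x‖ₑ ^ p.toReal ∂μ ≤
        M ^ p.toReal * (N * ∫⁻ x, ‖f x‖ₑ ^ p.toReal ∂μ) := by
      have hfm : AEMeasurable (fun x => ‖f x‖ₑ ^ p.toReal) μ := hf.enorm.pow_const _
      calc ∫⁻ x, ‖h x‖ₑ ^ p.toReal ∂μ = ∫⁻ x in ⋃ j, E j, ‖h x‖ₑ ^ p.toReal ∂μ := by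
            rw [hE, Measure.restrict_univ]
        _ ≤ ∑' j, ∫⁻ x in E j, ‖h x‖ₑ ^ p.toReal ∂μ := lintegral_iUnion_le _ _
        _ ≤ ∑' j, M ^ p.toReal * ∫⁻ x in E' j, ‖f x‖ₑ ^ p.toReal ∂μ := ENNReal.tsum_le_tsum h1
        _ = M ^ p.toReal * ∑' j, ∫⁻ x, (E' j).indicator 1 x * ‖f x‖ₑ ^ p.toReal ∂μ := by
          rw [ENNReal.tsum_mul_left]
          congr 2
          ext j
          rw [← lintegral_indicator (hE' j)]
          refine lintegral_congr fun x => ?_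
          by_cases hx : x ∈ E' j <;> simp [hx]
        _ = M ^ p.toReal * ∫⁻ x, (∑' j, (E' j).indicator 1 x) * ‖f x‖ₑ ^ p.toReal ∂μ := by
          simp_rw [← ENNReal.tsum_mul_right]
          rw [lintegral_tsum fun j => ?_]
          exact (measurable_one.indicator (hE' j)).aemeasurable.mul hfm
        _ ≤ M ^ p.toReal * ∫⁻ x, N * ‖f x‖ₑ ^ p.toReal ∂μ :=
          mul_le_mul' le_rfl (lintegral_mono fun x => mul_le_mul' (hN x) le_rfl)
        _ = _ := by rw [lintegral_const_mul'' _ hfm]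
    rw [← eLpNorm_rpow_toReal hp htop, ← eLpNorm_rpow_toReal hp htop] at h2
    have h3 := ENNReal.rpow_le_rpow h2 (inv_nonneg.2 hp0.le)
    rw [ENNReal.mul_rpow_of_nonneg _ _ (inv_nonneg.2 hp0.le),
      ENNReal.mul_rpow_of_nonneg _ _ (inv_nonneg.2 hp0.le), ENNReal.rpow_rpow_inv hp0.ne',
      ENNReal.rpow_rpow_inv hp0.ne', ENNReal.rpow_rpow_inv hp0.ne'] at h3
    rw [one_div, ENNReal.toReal_inv, mul_assoc]
    exact h3

end Partition

/-! ### The infimum over the intermediate exponent -/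

section Phi

/-- A nonzero finite c can be divided out before taking the infimum; for c = 0 a single q is enough.
-/
theorem le_mul_phiBelow {r p c x : ℝ≥0∞} (hp : 1 < p) (hc : c ≠ ∞)
    (h : ∀ q ∈ Ioo 1 p,
      x ≤ c * marcinkiewiczConst r q ^ ((1 / p - 1 / r) / (1 - q / r)).toReal) :
    x ≤ c * phiBelow r p := by
  rcases eq_or_ne c 0 with rfl | hc0
  · obtain ⟨q, hq⟩ := exists_between hp
    simpa using h q hq
  · rw [mul_comm, ← ENNReal.div_le_iff_le_mul (Or.inl hc0) (Or.inl hc)]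
    refine le_iInf₂ fun q hq => ?_
    rw [ENNReal.div_le_iff_le_mul (Or.inl hc0) (Or.inl hc), mul_comm]
    exact h q hq

theorem phi_of_lt_of_le {r p : ℝ≥0∞} (hp : 1 < p) (hpr : p ≤ r) : phi r p = phiBelow r p :=
  if_pos ⟨hp, hpr⟩

end Phi

/-! ### Global bound in the direct case -/

section Direct

variable {X : Type*} [MetricSpace X] [MeasurableSpace X] [BorelSpace X] {μ : Measure X}
  {𝕜 : Type*} [RCLike 𝕜] {B₁ B₂ : Type*} [NormedAddCommGroup B₁] [NormedSpace 𝕜 B₁]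
  [NormedAddCommGroup B₂] [NormedSpace ℝ B₂] [NormedSpace 𝕜 B₂]
  [SecondCountableTopology X] [IsLocallyFiniteMeasure μ] [μ.InnerRegular] [μ.IsOpenPosMeasure]
  [CompleteSpace B₁] [CompleteSpace B₂]

/-- The operator `f ↦ χ_S T (χ_Y f)`. -/
def truncate (T : LinftyC 𝕜 B₁ μ →ₗ[𝕜] (X →ₘ[μ] B₂)) {S Y : Set X}
    (hS : NullMeasurableSet S μ) (hY : NullMeasurableSet Y μ) :
    LinftyC 𝕜 B₁ μ →ₗ[𝕜] (X →ₘ[μ] B₂) where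
  toFun f := cut S hS (T (cutC Y hY f))
  map_add' f g := by rw [cutC_add, map_add, cut_add]
  map_smul' c f := by rw [cutC_smul, map_smul, cut_smul]; rfl

theorem concentratedOn_truncate (T : LinftyC 𝕜 B₁ μ →ₗ[𝕜] (X →ₘ[μ] B₂)) {S Y : Set X}
    (hS : NullMeasurableSet S μ) (hY : NullMeasurableSet Y μ) (f : LinftyC 𝕜 B₁ μ) :
    ConcentratedOn (truncate T hS hY f) S :=
  (concentratedOn_cut (Y := univ) hS (by simp [ConcentratedOn])).mono inter_subset_left

theorem eLpNorm_restrict_eq_cutC {S : Set X} (hS : MeasurableSet S) (f : LinftyC 𝕜 B₁ μ)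
    (p : ℝ≥0∞) : eLpNorm f.1 p (μ.restrict S) = eLpNorm (cutC S hS.nullMeasurableSet f).1 p μ := by
  rw [← eLpNorm_indicator_eq_eLpNorm_restrict hS]
  exact eLpNorm_congr_ae (coeFn_cutC S _ f).symm

theorem DoublingUpTo.mono {R R' : ℝ} {D : ℝ≥0} (h : DoublingUpTo μ R D) (hR : R' ≤ R) :
    DoublingUpTo μ R' D := fun x s hs hsR => h x s hs (hsR.trans hR)

/-- The two doubling constants that enter the final estimates. -/
theorem exists_doublingUpTo_pair {κ R : ℝ} (hκ : 2 < κ) (hR : 0 < R)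
    (hfin : doublingConst μ (3 * κ * R) < ∞) :
    ∃ D D' : ℝ≥0, doublingConst μ R = D ∧ doublingConst μ (3 * κ * R) = D' ∧ 1 ≤ D' ∧
      DoublingUpTo μ R D ∧ DoublingUpTo μ R D' := by
  have hle : R ≤ 3 * κ * R := by nlinarith
  obtain ⟨D', h1, h2, h3⟩ := exists_doublingUpTo (μ := μ) (hR.trans_le hle) hfin
  obtain ⟨D, h4, h5, h6⟩ := exists_doublingUpTo (μ := μ) hR
    ((doublingConst_mono hle).trans_lt hfin)
  exact ⟨D, D', h4, h1, h2, h6, h3.mono hle⟩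

/-- From local bounds with constants `4 * weakConst * Φ` to the global bound. -/
theorem eLpNorm_le_of_local_bound {R : ℝ} (hR : 0 < R) {D D' : ℝ≥0} (hD : DoublingUpTo μ R D)
    {A C : ℝ≥0} {T : LinftyC 𝕜 B₁ μ → (X →ₘ[μ] B₂)} {p Φ : ℝ≥0∞} (hp : p ≠ 0)
    (f : LinftyC 𝕜 B₁ μ)
    (h : ∀ E : Set X, MeasurableSet E → Metric.ediam E < ENNReal.ofReal (R / 4) →
      eLpNorm (T f) p (μ.restrict E) ≤ 4 * weakConst D' A C * Φ *
        eLpNorm (cutC (Metric.cthickening (R / 3) E)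
          (nullMeasurableSet_cthickening μ (R / 3) E) f).1 p μ) :
    eLpNorm (T f) p μ ≤ 16 * (D : ℝ≥0∞) ^ (5 / p).toReal * ((D' : ℝ≥0∞) ^ 9 * A + C) *
      eLpNorm f.1 p μ * Φ := by
  obtain ⟨N, E, hNc, hEm, hEd, hEU, hov⟩ := hD.exists_partition hR
  have := hNc.to_subtype
  have key := eLpNorm_le_of_local (μ := μ) (h := T f) (f := f.1) (p := p) (M := 4 * weakConst D' A C * Φ)
    hEU (fun j => Metric.isClosed_cthickening.measurableSet) hov hp
    f.1.aestronglyMeasurable (fun j => (h (E j) (hEm j) (hEd j)).trans (le_of_eq (by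
      rw [eLpNorm_restrict_eq_cutC Metric.isClosed_cthickening.measurableSet])))
  refine key.trans (le_of_eq ?_)
  have hpow : ((D : ℝ≥0∞) ^ 5) ^ (1 / p).toReal = (D : ℝ≥0∞) ^ (5 / p).toReal := by
    rw [← ENNReal.rpow_natCast, ← ENNReal.rpow_mul, div_eq_mul_inv, div_eq_mul_inv,
      ENNReal.toReal_mul, ENNReal.toReal_mul]
    simp
  rw [hpow, weakConst]
  push_cast
  ring

theorem eLpNorm_le_of_conditions {κ R : ℝ} (hκ : 2 < κ) (hR : 0 < R)
    (hD : doublingConst μ (3 * κ * R) < ∞) {r : ℝ≥0∞} {A C : ℝ≥0} (hA : 0 < A)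
    {T : LinftyC 𝕜 B₁ μ →ₗ[𝕜] (X →ₘ[μ] B₂)} {K : X → X → B₁ →L[𝕜] B₂}
    (hK : AEStronglyMeasurable (Function.uncurry K) (μ.prod μ))
    (hT : ∀ E : Set X, NullMeasurableSet E μ → Metric.ediam E < ENNReal.ofReal (R / 4) →
      ∀ f : LinftyC 𝕜 B₁ μ, ∀ᵐ x ∂μ, x ∈ E →
        T f x = T (cutC (Metric.cthickening (R / 3) E)
          (nullMeasurableSet_cthickening μ (R / 3) E) f) x)
    (h : ∀ (E : Set X) (hE : NullMeasurableSet E μ), Metric.ediam E < ENNReal.ofReal R →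
        Conditions μ R r A C E
          (fun f => cut E hE (T (cutC (Metric.thickening (R / 2) E)
            (nullMeasurableSet_thickening μ (R / 2) E) f))) K)
    {p : ℝ≥0∞} (hp : 1 < p) (hpr : p ≤ r) (f : LinftyC 𝕜 B₁ μ) :
    eLpNorm (T f) p μ ≤ 16 * phi r p * doublingConst μ R ^ (5 / p).toReal *
      (doublingConst μ (3 * κ * R) ^ 9 * A + C) * eLpNorm f.1 p μ := by
  -- The averages in the atoms need real scalars on B₁.
  let : NormedSpace ℝ B₁ := NormedSpace.restrictScalars ℝ 𝕜 B₁
  obtain ⟨D, D', hDe, hDe', hD1, hDD, hDD'⟩ := exists_doublingUpTo_pair hκ hR hD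
  have hf : eLpNorm f.1 p μ ≠ ∞ := (LinftyC.memLp f p).eLpNorm_ne_top
  have hp0 : p ≠ 0 := (zero_lt_one.trans hp).ne'
  rw [hDe, hDe', phi_of_lt_of_le hp hpr]
  have hc : 16 * (D : ℝ≥0∞) ^ (5 / p).toReal * ((D' : ℝ≥0∞) ^ 9 * A + C) * eLpNorm f.1 p μ ≠ ∞ := by
    finiteness
  refine (le_mul_phiBelow (r := r) hp hc fun q hq =>
    eLpNorm_le_of_local_bound hR hDD hp0 f fun E hEm hEd => ?_).trans (le_of_eq (by ring))
  set hEn := hEm.nullMeasurableSet (μ := μ)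
  set S := truncate T hEn (nullMeasurableSet_thickening μ (R / 2) E) with hS
  have hcond : Conditions μ R r A C E S (fun x y => hK.mk _ (x, y)) :=
    (h E hEn (hEd.trans_le (ENNReal.ofReal_le_ofReal (by linarith)))).congr_kernel hK.ae_eq_mk
  set g := cutC (Metric.cthickening (R / 3) E) (nullMeasurableSet_cthickening μ (R / 3) E) f
  have hg : ConcentratedOn g.1 (Metric.cthickening (R / 3) E) := concentratedOn_cutC_self _ _
  -- On E, T f equals T g. The cut to the R/2-neighbourhood inside S leaves g unchanged, because g
  -- lives within R/3 of E.
  have hSg : eLpNorm (T f) p (μ.restrict E) = eLpNorm (S g) p μ := by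
    rw [← eLpNorm_indicator_eq_eLpNorm_restrict hEm]
    refine eLpNorm_congr_ae ?_
    have h1 : S g = cut E hEn (T g) := by
      have : cutC (Metric.thickening (R / 2) E) (nullMeasurableSet_thickening μ (R / 2) E) g = g :=
        (hg.mono (Metric.cthickening_subset_thickening' (by linarith) (by linarith) E)).cutC_eq _
      simp only [hS, truncate, LinearMap.coe_mk, AddHom.coe_mk, this]
    rw [h1]
    filter_upwards [hT E hEn hEd f, coeFn_cut E hEn (T g)] with x h2 h3
    rw [h3]
    by_cases hx : x ∈ E
    · simp [hx, h2 hx, g]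
    · simp [hx]
  rw [hSg]
  exact Conditions.eLpNorm_le hDD' hD1 hR hA hEm hEd
    (concentratedOn_truncate T hEn _) (K := fun x y => hK.mk _ (x, y)) hK.stronglyMeasurable_mk
    hcond hpr hq.1 hq.2 g hg

end Direct

/-! ### Variation of a functional and its density -/

section Functional

variable {X : Type*} [MetricSpace X] [MeasurableSpace X] {μ : Measure X}
  {𝕜 : Type*} [RCLike 𝕜] {B : Type*} [NormedAddCommGroup B] [NormedSpace 𝕜 B]

/-- The variation on `A` of a functional on `L^∞_c`. -/
def functionalVariation (Λ : LinftyC 𝕜 B μ →ₗ[𝕜] 𝕜) (A : Set X) : ℝ≥0∞ :=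
  ⨆ (f : LinftyC 𝕜 B μ) (_ : ConcentratedOn f.1 A ∧ ∀ᵐ x ∂μ, ‖f.1 x‖ₑ ≤ 1), ‖Λ f‖ₑ

variable {Λ : LinftyC 𝕜 B μ →ₗ[𝕜] 𝕜}

theorem le_functionalVariation {A : Set X} {f : LinftyC 𝕜 B μ} (hf : ConcentratedOn f.1 A)
    (h1 : ∀ᵐ x ∂μ, ‖f.1 x‖ₑ ≤ 1) : ‖Λ f‖ₑ ≤ functionalVariation Λ A :=
  le_iSup₂_of_le f ⟨hf, h1⟩ le_rfl

theorem functionalVariation_mono {A A' : Set X} (h : A ⊆ A') :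
    functionalVariation Λ A ≤ functionalVariation Λ A' :=
  iSup₂_le fun _ hf => le_functionalVariation (hf.1.mono h) hf.2

theorem ae_enorm_cutC_le {S : Set X} (hS : NullMeasurableSet S μ) (f : LinftyC 𝕜 B μ) :
    ∀ᵐ x ∂μ, ‖(cutC S hS f).1 x‖ₑ ≤ ‖f.1 x‖ₑ := by
  filter_upwards [coeFn_cutC S hS f] with x hx
  rw [hx]
  exact enorm_indicator_le_enorm_self _ _

/-- Unimodular factors make Λ f and Λ g nonnegative, so that the norms add. The combination is still
bounded by 1 because A and A' are disjoint. -/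
theorem functionalVariation_add_le {A A' : Set X} (h : Disjoint A A') :
    functionalVariation Λ A + functionalVariation Λ A' ≤ functionalVariation Λ (A ∪ A') := by
  refine ENNReal.biSup_add_biSup_le' ⟨0, ?_⟩ ⟨0, ?_⟩ ?_
  · refine ⟨concentratedOn_zero A, ?_⟩
    filter_upwards [AEEqFun.coeFn_zero (α := X) (β := B) (μ := μ)] with x hx
    simp [hx]
  · refine ⟨concentratedOn_zero A', ?_⟩
    filter_upwards [AEEqFun.coeFn_zero (α := X) (β := B) (μ := μ)] with x hx
    simp [hx]
  · rintro f ⟨hf, hf1⟩ g ⟨hg, hg1⟩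
    obtain ⟨a, ha, hfa⟩ := RCLike.exists_norm_eq_mul_self (Λ f)
    obtain ⟨b, hb, hgb⟩ := RCLike.exists_norm_eq_mul_self (Λ g)
    have h1 : ‖Λ f‖ₑ + ‖Λ g‖ₑ = ‖Λ (a • f + b • g)‖ₑ := by
      rw [map_add, map_smul, map_smul, smul_eq_mul, smul_eq_mul, ← hfa, ← hgb, ← RCLike.ofReal_add]
      rw [← ofReal_norm ((‖Λ f‖ + ‖Λ g‖ : ℝ) : 𝕜), RCLike.norm_of_nonneg (by positivity),
        ENNReal.ofReal_add (norm_nonneg _) (norm_nonneg _), ofReal_norm, ofReal_norm]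
    rw [h1]
    refine le_functionalVariation (((hf.smul a).mono subset_union_left).add
      ((hg.smul b).mono subset_union_right)) ?_
    filter_upwards [coeFn_addC (a • f) (b • g), AEEqFun.coeFn_smul a f.1, AEEqFun.coeFn_smul b g.1,
      hf, hg, hf1, hg1] with x h1 h2 h3 h4 h5 h6 h7
    have h2' : (a • f).1 x = a • f.1 x := h2
    have h3' : (b • g).1 x = b • g.1 x := h3
    have ha' : ‖a‖ₑ = 1 := by rw [← ofReal_norm, ha, ENNReal.ofReal_one]
    have hb' : ‖b‖ₑ = 1 := by rw [← ofReal_norm, hb, ENNReal.ofReal_one]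
    rw [h1, h2', h3']
    by_cases hx : x ∈ A
    · rw [h5 (disjoint_left.1 h hx), smul_zero, add_zero, enorm_smul, ha', one_mul]
      exact h6
    · rw [h4 hx, smul_zero, zero_add, enorm_smul, hb', one_mul]
      exact h7

theorem functionalVariation_union_le {A A' : Set X} (hA : NullMeasurableSet A μ) :
    functionalVariation Λ (A ∪ A') ≤ functionalVariation Λ A + functionalVariation Λ A' := by
  refine iSup₂_le fun f hf => ?_
  rw [← cutC_add_cutC_compl A hA f, map_add]
  refine (enorm_add_le _ _).trans (add_le_add (le_functionalVariation ?_ ?_)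
    (le_functionalVariation ?_ ?_))
  · exact concentratedOn_cutC_self _ _
  · filter_upwards [ae_enorm_cutC_le hA f, hf.2] with x h1 h2 using h1.trans h2
  · refine (concentratedOn_cutC hA.compl hf.1).mono ?_
    rintro x ⟨h1, h2 | h2⟩
    · exact absurd h2 h1
    · exact h2
  · filter_upwards [ae_enorm_cutC_le hA.compl f, hf.2] with x h1 h2 using h1.trans h2

/-- Functions bounded by 1 and concentrated on A ∩ Y have L^r norm at most μ(A ∩ Y)^(1/r). This
makes the variation absolutely continuous and, for μ(Y) and c finite, finite. -/
theorem functionalVariation_le {Y : Set X} (hY : MeasurableSet Y) {r : ℝ≥0∞} (hr1 : 1 ≤ r)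
    (hr : r ≠ ∞) {c : ℝ≥0∞} (hcut : ∀ f : LinftyC 𝕜 B μ, Λ (cutC Y hY.nullMeasurableSet f) = Λ f)
    (hb : ∀ f : LinftyC 𝕜 B μ, ConcentratedOn f.1 Y → ‖Λ f‖ₑ ≤ c * eLpNorm f.1 r μ)
    {A : Set X} (hA : MeasurableSet A) :
    functionalVariation Λ A ≤ c * μ (A ∩ Y) ^ (1 / r.toReal) := by
  have hr0 : 0 < r.toReal := ENNReal.toReal_pos (zero_lt_one.trans_le hr1).ne' hr
  refine iSup₂_le fun f hf => ?_
  rw [← hcut f]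
  refine (hb _ (concentratedOn_cutC_self _ _)).trans (mul_le_mul' le_rfl ?_)
  rw [eLpNorm_eq_lintegral_rpow_enorm_toReal (zero_lt_one.trans_le hr1).ne' hr]
  refine ENNReal.rpow_le_rpow ?_ (by positivity)
  rw [← lintegral_indicator_one (hA.inter hY)]
  refine lintegral_mono_ae ?_
  filter_upwards [coeFn_cutC Y hY.nullMeasurableSet f, hf.1, hf.2] with x h1 h2 h3
  rw [h1]
  by_cases hx : x ∈ Y
  · by_cases hxA : x ∈ A
    · simpa [hx, hxA] using ENNReal.rpow_le_one h3 hr0.le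
    · simp [hx, hxA, h2 hxA, hr0]
  · simp [hx, hr0]

/-- One inequality follows from superadditivity over finite disjoint unions. For the other, finite
subadditivity leaves a remainder, whose variation tends to 0 because its part in Y has measure
tending to 0. -/
theorem functionalVariation_iUnion {Y : Set X} (hY : MeasurableSet Y) {r : ℝ≥0∞} (hr1 : 1 ≤ r)
    (hr : r ≠ ∞) {c : ℝ≥0∞} (hcut : ∀ f : LinftyC 𝕜 B μ, Λ (cutC Y hY.nullMeasurableSet f) = Λ f)
    (hb : ∀ f : LinftyC 𝕜 B μ, ConcentratedOn f.1 Y → ‖Λ f‖ₑ ≤ c * eLpNorm f.1 r μ)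
    (hYf : μ Y ≠ ∞) (hc : c ≠ ∞) {A : ℕ → Set X}
    (hA : ∀ i, MeasurableSet (A i)) (hd : Pairwise (Function.onFun Disjoint A)) :
    functionalVariation Λ (⋃ i, A i) = ∑' i, functionalVariation Λ (A i) := by
  have hr0 : 0 < r.toReal := ENNReal.toReal_pos (zero_lt_one.trans_le hr1).ne' hr
  have hV0 : functionalVariation Λ (∅ : Set X) = 0 := by
    have := functionalVariation_le hY hr1 hr hcut hb MeasurableSet.empty
    simpa [hr0] using this
  refine le_antisymm ?_ ?_
  · have hpart : ∀ n, functionalVariation Λ (⋃ i ∈ Finset.range n, A i) ≤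
        ∑ i ∈ Finset.range n, functionalVariation Λ (A i) := by
      intro n
      induction n with
      | zero => simp [hV0]
      | succ n ih =>
        rw [Finset.sum_range_succ, Finset.range_add_one, Finset.set_biUnion_insert, union_comm]
        exact (functionalVariation_union_le (Finset.measurableSet_biUnion _
          fun i _ => hA i).nullMeasurableSet).trans (add_le_add ih le_rfl)
    let Z : ℕ → Set X := fun n => ((⋃ i, A i) \ ⋃ i ∈ Finset.range n, A i) ∩ Y
    have hZm : ∀ n, MeasurableSet ((⋃ i, A i) \ ⋃ i ∈ Finset.range n, A i) := fun n =>
      (MeasurableSet.iUnion hA).diff (Finset.measurableSet_biUnion _ fun i _ => hA i)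
    have hZ : Tendsto (fun n => μ (Z n)) atTop (𝓝 0) := by
      have h1 := tendsto_measure_iInter_atTop (μ := μ) (s := Z)
        (fun n => ((hZm n).inter hY).nullMeasurableSet) (by
          intro m n hmn
          refine inter_subset_inter_left _ (sdiff_subset_sdiff_right ?_)
          exact biUnion_subset_biUnion_left (Finset.range_subset_range.2 hmn))
        ⟨0, measure_ne_top_of_subset inter_subset_right hYf⟩
      have h2 : ⋂ n, Z n = ∅ := by
        refine eq_empty_of_forall_notMem fun x hx => ?_
        rw [mem_iInter] at hx
        obtain ⟨i, hi⟩ := mem_iUnion.1 (hx 0).1.1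
        exact (hx (i + 1)).1.2 (mem_biUnion (Finset.mem_coe.2 (Finset.self_mem_range_succ i)) hi)
      rwa [h2, measure_empty] at h1
    have hlim : Tendsto (fun n => ∑' i, functionalVariation Λ (A i) +
        c * μ (Z n) ^ (1 / r.toReal)) atTop (𝓝 (∑' i, functionalVariation Λ (A i))) := by
      have h1 := ((ENNReal.continuous_rpow_const (y := 1 / r.toReal)).tendsto 0).comp hZ
      rw [ENNReal.zero_rpow_of_pos (by positivity)] at h1
      have h2 := ENNReal.Tendsto.const_mul h1 (Or.inr hc)
      rw [mul_zero] at h2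
      simpa using tendsto_const_nhds.add h2
    refine ge_of_tendsto' hlim fun n => ?_
    calc functionalVariation Λ (⋃ i, A i)
        ≤ functionalVariation Λ ((⋃ i ∈ Finset.range n, A i) ∪
          ((⋃ i, A i) \ ⋃ i ∈ Finset.range n, A i)) :=
          functionalVariation_mono (by rw [union_sdiff_self]; exact subset_union_right)
      _ ≤ _ := (functionalVariation_union_le (Finset.measurableSet_biUnion _
          fun i _ => hA i).nullMeasurableSet).trans (add_le_add
            ((hpart n).trans (ENNReal.sum_le_tsum _))
            (functionalVariation_le hY hr1 hr hcut hb (hZm n)))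
  · rw [ENNReal.tsum_eq_iSup_nat]
    refine iSup_le fun n => ?_
    suffices h : ∑ i ∈ Finset.range n, functionalVariation Λ (A i) ≤
        functionalVariation Λ (⋃ i ∈ Finset.range n, A i) from
      h.trans (functionalVariation_mono (iUnion₂_subset fun i _ => subset_iUnion A i))
    induction n with
    | zero => simp
    | succ n ih =>
      rw [Finset.sum_range_succ, Finset.range_add_one, Finset.set_biUnion_insert, union_comm]
      refine (add_le_add ih le_rfl).trans (functionalVariation_add_le ?_)
      refine disjoint_iUnion₂_left.2 fun i hi => hd ?_
      exact (Finset.mem_range.1 hi).ne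

/-- A functional that is `L^r`-continuous on a set of finite measure has a variation density. -/
theorem exists_variation_density {Y : Set X} (hY : MeasurableSet Y) {r : ℝ≥0∞} (hr1 : 1 ≤ r)
    (hr : r ≠ ∞) {c : ℝ≥0∞} (hcut : ∀ f : LinftyC 𝕜 B μ, Λ (cutC Y hY.nullMeasurableSet f) = Λ f)
    (hb : ∀ f : LinftyC 𝕜 B μ, ConcentratedOn f.1 Y → ‖Λ f‖ₑ ≤ c * eLpNorm f.1 r μ)
    [SigmaFinite μ] (hYf : μ Y ≠ ∞) (hc : c ≠ ∞) :
    ∃ w : X → ℝ≥0∞, Measurable w ∧ (∀ A, MeasurableSet A →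
        ∫⁻ x in A, w x ∂μ = functionalVariation Λ A) ∧
      ∀ f, ‖Λ f‖ₑ ≤ ∫⁻ x, ‖f.1 x‖ₑ * w x ∂μ := by
  have hr0 : 0 < r.toReal := ENNReal.toReal_pos (zero_lt_one.trans_le hr1).ne' hr
  have hle := fun {A : Set X} (hA : MeasurableSet A) =>
    functionalVariation_le hY hr1 hr hcut hb hA
  have hV0 : functionalVariation Λ (∅ : Set X) = 0 := by
    simpa [hr0] using hle MeasurableSet.empty
  set ν : Measure X := Measure.ofMeasurable (fun A _ => functionalVariation Λ A) hV0
    (fun A hA hd => functionalVariation_iUnion hY hr1 hr hcut hb hYf hc hA hd) with hν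
  have hνA : ∀ A, MeasurableSet A → ν A = functionalVariation Λ A := fun A hA =>
    Measure.ofMeasurable_apply A hA
  have hac : ν ≪ μ := Measure.AbsolutelyContinuous.mk fun A hA h0 => by
    rw [hνA A hA]
    have := hle hA
    rwa [measure_mono_null inter_subset_left h0, ENNReal.zero_rpow_of_pos (by positivity),
      mul_zero, nonpos_iff_eq_zero] at this
  have hfin : IsFiniteMeasure ν := ⟨by
    rw [hνA univ MeasurableSet.univ]
    refine (hle MeasurableSet.univ).trans_lt (ENNReal.mul_lt_top hc.lt_top ?_)
    rw [univ_inter]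
    exact ENNReal.rpow_lt_top_of_nonneg (by positivity) hYf⟩
  have hden : μ.withDensity (ν.rnDeriv μ) = ν := Measure.withDensity_rnDeriv_eq ν μ hac
  have hw : ∀ A, MeasurableSet A → ∫⁻ x in A, ν.rnDeriv μ x ∂μ = functionalVariation Λ A :=
    fun A hA => by rw [← withDensity_apply _ hA, hden, hνA A hA]
  refine ⟨ν.rnDeriv μ, Measure.measurable_rnDeriv ν μ, hw, fun f => ?_⟩
  -- Division by the bound t brings the restriction of f to A into the unit ball that defines the
  -- variation.
  have hscale : ∀ (A : Set X) (hA : MeasurableSet A) (t : ℝ≥0), t ≠ 0 →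
      (∀ x ∈ A, ‖f.1 x‖ₑ ≤ t) →
      ‖Λ (cutC A hA.nullMeasurableSet f)‖ₑ ≤ ∫⁻ x in A, t * ν.rnDeriv μ x ∂μ := by
    intro A hA t ht hfA
    rw [lintegral_const_mul _ (Measure.measurable_rnDeriv ν μ), hw A hA]
    set g := cutC A hA.nullMeasurableSet f with hg
    have ht' : ((t : ℝ) : 𝕜) ≠ 0 := by exact_mod_cast ht
    have htn : ‖((t : ℝ) : 𝕜)‖ₑ = t := by
      rw [← ofReal_norm, RCLike.norm_ofReal, abs_of_nonneg t.coe_nonneg]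
      exact ENNReal.ofReal_coe_nnreal
    have hsm : g = ((t : ℝ) : 𝕜) • (((t : ℝ) : 𝕜)⁻¹ • g) := by
      rw [smul_smul, mul_inv_cancel₀ ht', one_smul]
    rw [hsm, map_smul, smul_eq_mul, enorm_mul, htn]
    refine mul_le_mul' le_rfl (le_functionalVariation ((concentratedOn_cutC_self f _).smul _) ?_)
    filter_upwards [AEEqFun.coeFn_smul ((t : ℝ) : 𝕜)⁻¹ g.1, coeFn_cutC A hA.nullMeasurableSet f]
      with x h1 h2
    have h1' : (((t : ℝ) : 𝕜)⁻¹ • g).1 x = ((t : ℝ) : 𝕜)⁻¹ • g.1 x := h1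
    rw [h1', enorm_smul, enorm_inv ht', htn, h2, mul_comm, ← div_eq_mul_inv]
    refine ENNReal.div_le_of_le_mul ?_
    rw [one_mul]
    by_cases hx : x ∈ A
    · simpa [hx] using hfA x hx
    · simp [hx]
  -- f is sliced by the values of its norm into layers of thickness ε, on each of which the upper
  -- bound exceeds the norm by at most ε. As f is bounded, finitely many layers suffice, and
  -- linearity of Λ is all that is used.
  have hε : ∀ ε : ℝ≥0, ε ≠ 0 →
      ‖Λ f‖ₑ ≤ ∫⁻ x, ‖f.1 x‖ₑ * ν.rnDeriv μ x ∂μ + ε * ν univ := by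
    intro ε hε
    obtain ⟨M, hM⟩ := LinftyC.exists_bound f
    obtain ⟨n, hn⟩ := exists_nat_gt (M / ε)
    have hnM : M < n * ε := by rwa [div_lt_iff₀ (pos_iff_ne_zero.2 hε)] at hn
    let A : ℕ → Set X := fun k => {x | ((k * ε : ℝ≥0) : ℝ≥0∞) ≤ ‖f.1 x‖ₑ ∧
      ‖f.1 x‖ₑ < (((k + 1) * ε : ℝ≥0) : ℝ≥0∞)}
    have hAm : ∀ k, MeasurableSet (A k) := fun k =>
      (measurableSet_le measurable_const (measurable_enorm_coeFn f)).inter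
        (measurableSet_lt (measurable_enorm_coeFn f) measurable_const)
    have hAd : Pairwise (Function.onFun Disjoint A) := by
      intro j k hjk
      wlog hlt : j < k generalizing j k
      · exact (this hjk.symm (lt_of_le_of_ne (not_lt.1 hlt) hjk.symm)).symm
      refine disjoint_left.2 fun x hx hx' => ?_
      have h1 : (((j + 1) * ε : ℝ≥0) : ℝ≥0∞) ≤ ((k * ε : ℝ≥0) : ℝ≥0∞) := by
        have : ((j : ℝ≥0) + 1) ≤ k := by exact_mod_cast hlt
        exact_mod_cast mul_le_mul_of_nonneg_right this ε.2
      exact absurd (hx.2.trans_le (h1.trans hx'.1)) (lt_irrefl _)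
    have hsum : f = ∑ k ∈ Finset.range n, cutC (A k) (hAm k).nullMeasurableSet f := by
      refine Subtype.ext (AEEqFun.ext ?_)
      filter_upwards [coeFn_sumC (Finset.range n)
        (fun k => cutC (A k) (hAm k).nullMeasurableSet f), hM,
        ae_all_iff.2 fun k => coeFn_cutC (A k) (hAm k).nullMeasurableSet f] with x h1 h2 h3
      rw [h1]
      simp only [h3]
      obtain ⟨k, hk⟩ : ∃ k : ℕ, k = ⌊‖f.1 x‖₊ / ε⌋₊ := ⟨_, rfl⟩
      have hk1 : (k : ℝ≥0) * ε ≤ ‖f.1 x‖₊ := by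
        rw [← le_div_iff₀ (pos_iff_ne_zero.2 hε), hk]
        exact Nat.floor_le zero_le
      have hk2 : ‖f.1 x‖₊ < ((k : ℝ≥0) + 1) * ε := by
        rw [← div_lt_iff₀ (pos_iff_ne_zero.2 hε), hk]
        exact Nat.lt_floor_add_one _
      have hxk : x ∈ A k := ⟨by exact_mod_cast hk1, by exact_mod_cast hk2⟩
      have hkn : k ∈ Finset.range n := by
        rw [Finset.mem_range]
        have h4 : ‖f.1 x‖₊ ≤ M := by exact_mod_cast (show ((‖f.1 x‖₊ : ℝ≥0) : ℝ≥0∞) ≤ M from h2)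
        have h5 : (k : ℝ≥0) * ε < n * ε := hk1.trans_lt (h4.trans_lt hnM)
        exact_mod_cast lt_of_mul_lt_mul_right h5 ε.2
      rw [Finset.sum_eq_single_of_mem k hkn fun j _ hjk =>
        indicator_of_notMem (fun hxj => disjoint_left.1 (hAd hjk) hxj hxk) _,
        indicator_of_mem hxk]
    have hpt : ∀ k, ‖Λ (cutC (A k) (hAm k).nullMeasurableSet f)‖ₑ ≤
        ∫⁻ x in A k, (‖f.1 x‖ₑ + ε) * ν.rnDeriv μ x ∂μ := fun k => by
      refine (hscale (A k) (hAm k) ((k + 1) * ε) (by positivity) fun x hx => hx.2.le).trans ?_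
      refine setLIntegral_mono' (hAm k) fun x hx => mul_le_mul' ?_ le_rfl
      rw [add_mul, one_mul, ENNReal.coe_add]
      exact add_le_add hx.1 le_rfl
    calc ‖Λ f‖ₑ = ‖∑ k ∈ Finset.range n, Λ (cutC (A k) (hAm k).nullMeasurableSet f)‖ₑ := by
          rw [← map_sum, ← hsum]
      _ ≤ ∑ k ∈ Finset.range n, ‖Λ (cutC (A k) (hAm k).nullMeasurableSet f)‖ₑ :=
          enorm_sum_le _ _
      _ ≤ ∑ k ∈ Finset.range n, ∫⁻ x in A k, (‖f.1 x‖ₑ + ε) * ν.rnDeriv μ x ∂μ :=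
          Finset.sum_le_sum fun k _ => hpt k
      _ = ∫⁻ x in ⋃ k ∈ Finset.range n, A k, (‖f.1 x‖ₑ + ε) * ν.rnDeriv μ x ∂μ :=
          (lintegral_biUnion_finset (fun j _ k _ hjk => hAd hjk) (fun k _ => hAm k) _).symm
      _ ≤ ∫⁻ x, (‖f.1 x‖ₑ + ε) * ν.rnDeriv μ x ∂μ := setLIntegral_le_lintegral _ _
      _ = _ := by
          simp_rw [add_mul]
          rw [lintegral_add_right _ ((Measure.measurable_rnDeriv ν μ).const_mul _),
            lintegral_const_mul _ (Measure.measurable_rnDeriv ν μ), hνA univ MeasurableSet.univ,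
            ← hw univ MeasurableSet.univ, Measure.restrict_univ]
  refine ENNReal.le_of_forall_pos_le_add fun δ hδ _ => ?_
  have hN : ν univ ≠ ∞ := measure_ne_top ν univ
  lift ν univ to ℝ≥0 using hN with N
  refine (hε (δ / (N + 1)) (by positivity)).trans (add_le_add le_rfl ?_)
  rw [← ENNReal.coe_mul, ENNReal.coe_le_coe, div_mul_eq_mul_div, div_le_iff₀ (by positivity)]
  exact mul_le_mul_of_nonneg_left (by simp) δ.2

end Functional

/-! ### The pointwise norm of the transpose -/

section Transpose

variable {X : Type*} [MetricSpace X] [MeasurableSpace X] [BorelSpace X] {μ : Measure X}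
  {𝕜 : Type*} [RCLike 𝕜] {B₁ B₂ : Type*} [NormedAddCommGroup B₁] [NormedSpace 𝕜 B₁]
  [NormedAddCommGroup B₂] [NormedSpace 𝕜 B₂]

theorem lintegral_enorm_mul_le_eLpNorm {E F : Type*} [NormedAddCommGroup E]
    [NormedAddCommGroup F] {f : X → E} {g : X → F} (hf : AEStronglyMeasurable f μ)
    (hg : AEStronglyMeasurable g μ) {p q : ℝ≥0∞} (hpq : p.HolderConjugate q) :
    ∫⁻ x, ‖f x‖ₑ * ‖g x‖ₑ ∂μ ≤ eLpNorm f p μ * eLpNorm g q μ := by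
  have h := eLpNorm_le_eLpNorm_mul_eLpNorm_of_nnnorm (r := 1) hf hg
    (fun x y => ‖x‖ * ‖y‖) 1 (Eventually.of_forall fun x => by simp) (hpqr := hpq)
  rw [eLpNorm_one_eq_lintegral_enorm] at h
  simpa [enorm_mul] using h

theorem enorm_integral_pairing_le {g : X → B₂ →L[𝕜] 𝕜} {u : X → B₂}
    (hg : AEStronglyMeasurable g μ) (hu : AEStronglyMeasurable u μ) {p q : ℝ≥0∞}
    (hpq : p.HolderConjugate q) :
    ‖∫ x, g x (u x) ∂μ‖ₑ ≤ eLpNorm g p μ * eLpNorm u q μ :=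
  ((enorm_integral_le_lintegral_enorm _).trans
    (lintegral_mono fun _ => ContinuousLinearMap.le_opENorm _ _)).trans
    (lintegral_enorm_mul_le_eLpNorm hg hu hpq)

theorem integrable_pairing {g : X → B₂ →L[𝕜] 𝕜} {u : X → B₂} {p q : ℝ≥0∞}
    (hg : MemLp g p μ) (hu : MemLp u q μ) (hpq : p.HolderConjugate q) :
    Integrable (fun x => g x (u x)) μ := by
  refine ⟨(ContinuousLinearMap.id 𝕜 (B₂ →L[𝕜] 𝕜)).aestronglyMeasurable_comp₂ hg.1 hu.1, ?_⟩
  refine lt_of_le_of_lt ((lintegral_mono fun _ => ContinuousLinearMap.le_opENorm _ _).trans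
    (lintegral_enorm_mul_le_eLpNorm hg.1 hu.1 hpq)) ?_
  exact ENNReal.mul_lt_top hg.eLpNorm_lt_top hu.eLpNorm_lt_top

theorem eLpNorm_le_of_concentratedOn {f : LinftyC 𝕜 B₁ μ} {W : Set X} (hW : MeasurableSet W)
    (hf : ConcentratedOn f.1 W) (hf1 : ∀ᵐ x ∂μ, ‖f.1 x‖ₑ ≤ 1) {r : ℝ≥0∞} (hr1 : 1 ≤ r)
    (hr : r ≠ ∞) : eLpNorm f.1 r μ ≤ μ W ^ (1 / r.toReal) := by
  have hr0 : 0 < r.toReal := ENNReal.toReal_pos (zero_lt_one.trans_le hr1).ne' hr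
  rw [eLpNorm_eq_lintegral_rpow_enorm_toReal (zero_lt_one.trans_le hr1).ne' hr,
    ← lintegral_indicator_one hW]
  refine ENNReal.rpow_le_rpow (lintegral_mono_ae ?_) (by positivity)
  filter_upwards [hf, hf1] with x h2 h3
  by_cases hx : x ∈ W
  · simpa [hx] using ENNReal.rpow_le_one h3 hr0.le
  · simp [hx, h2 hx, hr0]

/-- `U g` is the pointwise norm of the image of `g` under the transpose of `S`. -/
structure IsTransposeNorm (S : LinftyC 𝕜 B₁ μ →ₗ[𝕜] (X →ₘ[μ] B₂))
    (U : LinftyC 𝕜 (B₂ →L[𝕜] 𝕜) μ → X → ℝ≥0∞) : Prop where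
  measurable : ∀ g, Measurable (U g)
  setLIntegral_le : ∀ g A, MeasurableSet A → ∀ b, (∀ f : LinftyC 𝕜 B₁ μ, ConcentratedOn f.1 A →
    (∀ᵐ x ∂μ, ‖f.1 x‖ₑ ≤ 1) → ‖∫ x, g.1 x (S f x) ∂μ‖ₑ ≤ b) → ∫⁻ x in A, U g x ∂μ ≤ b
  enorm_pairing_le : ∀ (g : LinftyC 𝕜 (B₂ →L[𝕜] 𝕜) μ) (f : LinftyC 𝕜 B₁ μ),
    ‖∫ x, g.1 x (S f x) ∂μ‖ₑ ≤ ∫⁻ x, ‖f.1 x‖ₑ * U g x ∂μ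

theorem IsTransposeNorm.enorm_pairing_le_setLIntegral
    {S : LinftyC 𝕜 B₁ μ →ₗ[𝕜] (X →ₘ[μ] B₂)} {U : LinftyC 𝕜 (B₂ →L[𝕜] 𝕜) μ → X → ℝ≥0∞}
    (hU : IsTransposeNorm S U) (g : LinftyC 𝕜 (B₂ →L[𝕜] 𝕜) μ) {f : LinftyC 𝕜 B₁ μ} {W : Set X}
    (hW : MeasurableSet W) (hf : ConcentratedOn f.1 W) (hf1 : ∀ᵐ x ∂μ, ‖f.1 x‖ₑ ≤ 1) :
    ‖∫ x, g.1 x (S f x) ∂μ‖ₑ ≤ ∫⁻ x in W, U g x ∂μ := by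
  refine (hU.enorm_pairing_le g f).trans ?_
  rw [← lintegral_indicator hW]
  refine lintegral_mono_ae ?_
  filter_upwards [hf, hf1] with x h1 h2
  by_cases hx : x ∈ W
  · simpa [hx] using mul_le_of_le_one_left zero_le h2
  · simp [hx, h1 hx]

variable [IsLocallyFiniteMeasure μ]
  {S : LinftyC 𝕜 B₁ μ →ₗ[𝕜] (X →ₘ[μ] B₂)} {Y : Set X} {r r' : ℝ≥0∞} {A : ℝ≥0}

theorem memLp_of_bound {hY : NullMeasurableSet Y μ} (hcut : ∀ f, S (cutC Y hY f) = S f)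
    (hb : ∀ f : LinftyC 𝕜 B₁ μ, ConcentratedOn f.1 Y → eLpNorm (S f) r μ ≤ A * eLpNorm f.1 r μ)
    (f : LinftyC 𝕜 B₁ μ) : MemLp (S f) r μ := by
  refine ⟨(S f).aestronglyMeasurable, ?_⟩
  rw [← hcut f]
  exact (hb _ (concentratedOn_cutC_self _ _)).trans_lt
    (ENNReal.mul_lt_top ENNReal.coe_lt_top (LinftyC.memLp _ r).eLpNorm_lt_top)

/-- U g is the density of the variation of f ↦ ∫ g (S f), a functional that is L^r-continuous by
Hölder and the bound for S. No vector-valued Radon–Nikodym theorem is involved. -/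
theorem exists_isTransposeNorm [SigmaFinite μ] (hY : MeasurableSet Y) (hYf : μ Y ≠ ∞)
    (hrr : r'.HolderConjugate r) (hr1 : 1 ≤ r) (hr : r ≠ ∞)
    (hcut : ∀ f, S (cutC Y hY.nullMeasurableSet f) = S f)
    (hb : ∀ f : LinftyC 𝕜 B₁ μ, ConcentratedOn f.1 Y → eLpNorm (S f) r μ ≤ A * eLpNorm f.1 r μ) :
    ∃ U, IsTransposeNorm S U := by
  have hint : ∀ (g : LinftyC 𝕜 (B₂ →L[𝕜] 𝕜) μ) (f : LinftyC 𝕜 B₁ μ),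
      Integrable (fun x => g.1 x (S f x)) μ := fun g f =>
    integrable_pairing (LinftyC.memLp g r') (memLp_of_bound hcut hb f) hrr
  let Λ : LinftyC 𝕜 (B₂ →L[𝕜] 𝕜) μ → LinftyC 𝕜 B₁ μ →ₗ[𝕜] 𝕜 := fun g =>
    { toFun := fun f => ∫ x, g.1 x (S f x) ∂μ
      map_add' := fun f f' => by
        rw [← integral_add (hint g f) (hint g f')]
        refine integral_congr_ae ?_
        filter_upwards [AEEqFun.coeFn_add (S f) (S f')] with x hx
        rw [map_add, hx, Pi.add_apply, map_add]
      map_smul' := fun a f => by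
        rw [RingHom.id_apply, smul_eq_mul, ← integral_const_mul]
        refine integral_congr_ae ?_
        filter_upwards [AEEqFun.coeFn_smul a (S f)] with x hx
        rw [map_smul, hx, Pi.smul_apply, map_smul, smul_eq_mul] }
  have hex : ∀ g, ∃ w : X → ℝ≥0∞, Measurable w ∧ (∀ A, MeasurableSet A →
        ∫⁻ x in A, w x ∂μ = functionalVariation (Λ g) A) ∧
      ∀ f, ‖Λ g f‖ₑ ≤ ∫⁻ x, ‖f.1 x‖ₑ * w x ∂μ := fun g => by
    refine exists_variation_density (Λ := Λ g) hY hr1 hr (c := eLpNorm g.1 r' μ * A)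
      (fun f => ?_) (fun f hf => ?_) hYf
      (ENNReal.mul_ne_top (LinftyC.memLp g r').eLpNorm_ne_top ENNReal.coe_ne_top)
    · simp only [Λ, LinearMap.coe_mk, AddHom.coe_mk, hcut]
    · rw [mul_assoc]
      exact (enorm_integral_pairing_le g.1.aestronglyMeasurable (S f).aestronglyMeasurable
        hrr).trans (mul_le_mul' le_rfl (hb f hf))
  choose U h1 h2 h3 using hex
  refine ⟨U, h1, fun g W hW b hbd => ?_, h3⟩
  rw [h2 g W hW]
  exact iSup₂_le fun f hf => hbd f hf.1 hf.2

variable {U : LinftyC 𝕜 (B₂ →L[𝕜] 𝕜) μ → X → ℝ≥0∞}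

theorem IsTransposeNorm.setLIntegral_le_rpow (hU : IsTransposeNorm S U) (hY : MeasurableSet Y)
    (hrr : r'.HolderConjugate r) (hr1 : 1 ≤ r) (hr : r ≠ ∞)
    (hcut : ∀ f, S (cutC Y hY.nullMeasurableSet f) = S f)
    (hb : ∀ f : LinftyC 𝕜 B₁ μ, ConcentratedOn f.1 Y → eLpNorm (S f) r μ ≤ A * eLpNorm f.1 r μ)
    (g : LinftyC 𝕜 (B₂ →L[𝕜] 𝕜) μ) {W : Set X} (hW : MeasurableSet W) :
    ∫⁻ x in W, U g x ∂μ ≤ A * eLpNorm g.1 r' μ * μ W ^ (1 / r.toReal) := by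
  refine hU.setLIntegral_le g W hW _ fun f hf hf1 => ?_
  rw [← hcut f]
  set f' := cutC Y hY.nullMeasurableSet f with hf'
  have h1 : ConcentratedOn f'.1 W := (concentratedOn_cutC _ hf).mono inter_subset_right
  have h2 : ∀ᵐ x ∂μ, ‖f'.1 x‖ₑ ≤ 1 := by
    filter_upwards [ae_enorm_cutC_le hY.nullMeasurableSet f, hf1] with x h1 h2 using h1.trans h2
  calc ‖∫ x, g.1 x (S f' x) ∂μ‖ₑ ≤ eLpNorm g.1 r' μ * eLpNorm (S f') r μ :=
        enorm_integral_pairing_le g.1.aestronglyMeasurable (S f').aestronglyMeasurable hrr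
    _ ≤ eLpNorm g.1 r' μ * (A * μ W ^ (1 / r.toReal)) :=
        mul_le_mul' le_rfl ((hb f' (concentratedOn_cutC_self _ _)).trans
          (mul_le_mul' le_rfl (eLpNorm_le_of_concentratedOn hW h1 h2 hr1 hr)))
    _ = _ := by ring

theorem IsTransposeNorm.ae_eq_zero (hU : IsTransposeNorm S U) (hY : MeasurableSet Y)
    (hcut : ∀ f, S (cutC Y hY.nullMeasurableSet f) = S f)
    (g : LinftyC 𝕜 (B₂ →L[𝕜] 𝕜) μ) : ∀ᵐ x ∂μ, x ∉ Y → U g x = 0 := by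
  have h1 : ∫⁻ x in Yᶜ, U g x ∂μ ≤ 0 := by
    refine hU.setLIntegral_le g Yᶜ hY.compl 0 fun f hf hf1 => ?_
    have h0 : cutC Y hY.nullMeasurableSet f = 0 := by
      refine Subtype.ext (AEEqFun.ext ?_)
      filter_upwards [coeFn_cutC Y hY.nullMeasurableSet f, hf,
        AEEqFun.coeFn_zero (α := X) (β := B₁) (μ := μ)] with x h1 h2 h3
      rw [h1]
      refine Eq.trans ?_ h3.symm
      by_cases hx : x ∈ Y
      · simp [hx, h2 (fun h => h hx)]
      · simp [hx]
    have h2 : ∫ x, g.1 x (S f x) ∂μ = 0 := by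
      rw [← hcut f, h0, map_zero]
      refine integral_eq_zero_of_ae ?_
      filter_upwards [AEEqFun.coeFn_zero (α := X) (β := B₂) (μ := μ)] with x hx
      simp [hx]
    simp [h2]
  have h2 := (lintegral_eq_zero_iff (hU.measurable g)).1 (nonpos_iff_eq_zero.1 h1)
  exact (ae_restrict_iff' hY.compl).1 h2

/-- Tested on its own level set W, the integral bound gives t μ(W) ≤ A ‖g‖ μ(W)^(1/r), and the power
of μ(W) is divided out. -/
theorem IsTransposeNorm.hasWeakType [SigmaFinite μ] (hU : IsTransposeNorm S U)
    (hY : MeasurableSet Y) (hYf : μ Y ≠ ∞)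
    (hrr : r'.HolderConjugate r) (hr1 : 1 ≤ r) (hr : r ≠ ∞)
    (hcut : ∀ f, S (cutC Y hY.nullMeasurableSet f) = S f)
    (hb : ∀ f : LinftyC 𝕜 B₁ μ, ConcentratedOn f.1 Y → eLpNorm (S f) r μ ≤ A * eLpNorm f.1 r μ)
    (Z : Set X) : HasWeakType U Z r' A := by
  intro g _
  have hle := fun {W : Set X} (hW : MeasurableSet W) =>
    hU.setLIntegral_le_rpow hY hrr hr1 hr hcut hb g hW
  have hinv : r'⁻¹ + r⁻¹ = 1 := hrr.inv_add_inv_eq_one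
  refine ⟨fun htop => ?_, fun htop t ht => ?_⟩
  · subst htop
    -- Here the bound reads ∫_W U g ≤ A ‖g‖ μ(W) for every W, which is a pointwise bound.
    have hr' : r = 1 := by simpa using hinv
    subst hr'
    refine ae_le_of_forall_setLIntegral_le_of_sigmaFinite (hU.measurable g) fun W hW _ => ?_
    rw [setLIntegral_const]
    simpa using hle hW
  · set s := r.toReal with hs
    set s' := r'.toReal with hs'
    have hr0 : r ≠ 0 := (zero_lt_one.trans_le hr1).ne'
    have hr'0 : r' ≠ 0 := by rintro rfl; simp at hinv
    have hs'0 : 0 < s' := ENNReal.toReal_pos hr'0 htop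
    have hs0 : 0 < s := ENNReal.toReal_pos hr0 hr
    have hss : 1 / s' + 1 / s = 1 := by
      have := congrArg ENNReal.toReal hinv
      rw [ENNReal.toReal_add (by simpa using hr'0) (by simpa using hr0), ENNReal.toReal_inv,
        ENNReal.toReal_inv, ENNReal.toReal_one] at this
      simpa using this
    set W := {x | (t : ℝ≥0∞) < U g x} with hW
    have hWm : MeasurableSet W := measurableSet_lt measurable_const (hU.measurable g)
    -- Finiteness, needed for the division, holds because U g vanishes outside Y.
    have hWfin : μ W ≠ ∞ := by
      refine ne_top_of_le_ne_top hYf (measure_mono_ae ?_)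
      filter_upwards [hU.ae_eq_zero hY hcut g] with x hx hxW
      by_contra hxY
      have h1 : (t : ℝ≥0∞) < U g x := hxW
      rw [hx hxY] at h1
      exact not_lt_zero h1
    rcases eq_or_ne (μ W) 0 with h0 | h0
    · rw [h0, mul_zero]; exact zero_le
    have h1 : (t : ℝ≥0∞) * μ W ≤ A * eLpNorm g.1 r' μ * μ W ^ (1 / s) := by
      refine le_trans ?_ (hle hWm)
      rw [← setLIntegral_const]
      exact setLIntegral_mono' hWm fun x (hx : (t : ℝ≥0∞) < U g x) => hx.le
    have h2 : (t : ℝ≥0∞) * μ W ^ (1 / s') ≤ A * eLpNorm g.1 r' μ := by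
      have hne0 : μ W ^ (1 / s) ≠ 0 := (ENNReal.rpow_pos (pos_iff_ne_zero.2 h0) hWfin).ne'
      have hnet : μ W ^ (1 / s) ≠ ∞ := ENNReal.rpow_ne_top_of_nonneg (by positivity) hWfin
      refine (ENNReal.mul_le_mul_iff_left hne0 hnet).1 ?_
      rwa [mul_assoc, ← ENNReal.rpow_add _ _ h0 hWfin, hss, ENNReal.rpow_one]
    have h3 := ENNReal.rpow_le_rpow h2 hs'0.le
    rwa [ENNReal.mul_rpow_of_nonneg _ _ hs'0.le, ENNReal.mul_rpow_of_nonneg _ _ hs'0.le,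
      ← ENNReal.rpow_mul, one_div_mul_cancel hs'0.ne', ENNReal.rpow_one,
      eLpNorm_rpow_toReal hr'0 htop] at h3

/-- Subadditivity is checked on integrals over arbitrary sets W, where it is the triangle inequality
for the pairing with test functions. -/
theorem IsTransposeNorm.subadditiveOn [SigmaFinite μ] (hU : IsTransposeNorm S U)
    (hS : ∀ (g : LinftyC 𝕜 (B₂ →L[𝕜] 𝕜) μ) f, Integrable (fun x => g.1 x (S f x)) μ)
    (Z : Set X) : SubadditiveOn U Z := by
  intro g g' _ _
  refine ae_le_of_forall_setLIntegral_le_of_sigmaFinite (hU.measurable _) fun W hW _ => ?_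
  rw [lintegral_add_left (hU.measurable g)]
  refine hU.setLIntegral_le _ W hW _ fun f hf hf1 => ?_
  have h1 : ∫ x, (g + g').1 x (S f x) ∂μ = ∫ x, g.1 x (S f x) ∂μ + ∫ x, g'.1 x (S f x) ∂μ := by
    rw [← integral_add (hS g f) (hS g' f)]
    refine integral_congr_ae ?_
    filter_upwards [coeFn_addC g g'] with x hx
    rw [hx, _root_.add_apply]
  rw [h1]
  exact (enorm_add_le _ _).trans (add_le_add (hU.enorm_pairing_le_setLIntegral g hW hf hf1)
    (hU.enorm_pairing_le_setLIntegral g' hW hf hf1))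

end Transpose

/-! ### Dual conditions make the transpose norm an abstract Calderón–Zygmund operator -/

section Dual

variable {X : Type*} [MetricSpace X] [MeasurableSpace X] [BorelSpace X] {μ : Measure X}
  {𝕜 : Type*} [RCLike 𝕜] {B₁ B₂ : Type*} [NormedAddCommGroup B₁] [NormedSpace 𝕜 B₁]
  [NormedAddCommGroup B₂] [NormedSpace ℝ B₂] [NormedSpace 𝕜 B₂]
  [SecondCountableTopology X] [IsLocallyFiniteMeasure μ] [CompleteSpace B₂] [CompleteSpace B₁]
  [NormedSpace ℝ B₁]

theorem integrable_prod_clm_apply {ν₁ ν₂ : Measure X} [SFinite ν₁] [SFinite ν₂]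
    {K : X → X → B₁ →L[𝕜] B₂} (hK : Integrable (Function.uncurry K) (ν₁.prod ν₂)) {f : X → B₁}
    (hf : AEStronglyMeasurable f ν₂) {M : ℝ≥0} (hM : ∀ᵐ y ∂ν₂, ‖f y‖ₑ ≤ M) :
    Integrable (fun p : X × X => K p.1 p.2 (f p.2)) (ν₁.prod ν₂) := by
  refine Integrable.mono' (hK.norm.mul_const M) ?_ ?_
  · exact (ContinuousLinearMap.id 𝕜 (B₁ →L[𝕜] B₂)).aestronglyMeasurable_comp₂ hK.1 hf.comp_snd
  · filter_upwards [Measure.quasiMeasurePreserving_snd.ae hM] with p hp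
    refine ((K p.1 p.2).le_opNorm _).trans ?_
    refine mul_le_mul_of_nonneg_left ?_ (norm_nonneg _)
    have h1 : ((‖f p.2‖₊ : ℝ≥0) : ℝ≥0∞) ≤ M := hp
    exact_mod_cast h1

theorem DualConditions.integral_pairing_eq {R : ℝ} {r : ℝ≥0∞} {A C : ℝ≥0} {E : Set X}
    {S : LinftyC 𝕜 B₁ μ → (X →ₘ[μ] B₂)} {K : X → X → B₁ →L[𝕜] B₂}
    (h : DualConditions μ R r A C E S K) {F : Set X} (hF : IsOpen F)
    (hFE : F ⊆ Metric.thickening (R / 2) E) {f : LinftyC 𝕜 B₁ μ} (hf : ConcentratedOn f.1 (E \ F))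
    {g : LinftyC 𝕜 (B₂ →L[𝕜] 𝕜) μ} (hg : ConcentratedOn g.1 F) :
    ∫ x, g.1 x (S f x) ∂μ = ∫ x in F, g.1 x (∫ y in E \ F, K x y (f.1 y) ∂μ) ∂μ := by
  have h0 : ∀ᵐ x ∂μ, x ∉ F → g.1 x (S f x) = 0 := by
    filter_upwards [hg] with x hx hxF
    rw [hx hxF, _root_.zero_apply]
  rw [← setIntegral_eq_integral_of_ae_compl_eq_zero h0]
  refine setIntegral_congr_ae hF.measurableSet ?_
  filter_upwards [h.kernel F hF hFE f hf] with x hx hxF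
  rw [hx hxF]

theorem enorm_setIntegral_clm_le {L : X → B₁ →L[𝕜] B₂} {f : X → B₁} {G Z : Set X}
    (hG : MeasurableSet G) (hf : ∀ᵐ y ∂μ, y ∉ G → f y = 0) (hf1 : ∀ᵐ y ∂μ, ‖f y‖ₑ ≤ 1) :
    ‖∫ y in Z, L y (f y) ∂μ‖ₑ ≤ ∫⁻ y in G, ‖L y‖ₑ ∂μ := by
  refine (enorm_integral_le_lintegral_enorm _).trans ((setLIntegral_le_lintegral _ _).trans ?_)
  rw [← lintegral_indicator hG]
  refine lintegral_mono_ae ?_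
  filter_upwards [hf, hf1] with y h1 h2
  by_cases hy : y ∈ G
  · rw [indicator_of_mem hy]
    exact (ContinuousLinearMap.le_opENorm _ _).trans (mul_le_of_le_one_right zero_le h2)
  · simp [hy, h1 hy]

set_option maxSynthPendingDepth 3 in
/-- The dual local Calderón–Zygmund conditions give a local Calderón–Zygmund operator. -/
theorem DualConditions.isLocalCZOperator {R : ℝ} (hR : 0 < R) {r r' : ℝ≥0∞}
    (hrr : r'.HolderConjugate r) (hr1 : 1 ≤ r) (hr : r ≠ ∞) {A C : ℝ≥0}
    {E₀ E : Set X} (hEE : E = Metric.cthickening (R / 3) E₀) (hEm : MeasurableSet E)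
    (hEf : μ E ≠ ∞) (hE : Metric.ediam E₀ < ENNReal.ofReal (R / 4))
    {S : LinftyC 𝕜 B₁ μ →ₗ[𝕜] (X →ₘ[μ] B₂)}
    (hcut : ∀ f, S (cutC E hEm.nullMeasurableSet f) = S f)
    {K : X → X → B₁ →L[𝕜] B₂} (hK : StronglyMeasurable (Function.uncurry K))
    (h : DualConditions μ R r A C E S K) {U : LinftyC 𝕜 (B₂ →L[𝕜] 𝕜) μ → X → ℝ≥0∞}
    (hU : IsTransposeNorm S U) :
    IsLocalCZOperator μ R r' A C E₀ (Metric.thickening (R / 2) E) E U := by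
  set Ω := Metric.thickening (R / 2) E with hΩ
  have hE₀ : E₀ ⊆ E := hEE ▸ Metric.self_subset_cthickening E₀
  have hKdiff : Measurable fun p : X × X × X => ‖K p.1 p.2.2 - K p.2.1 p.2.2‖ₑ :=
    ((hK.comp_measurable (by fun_prop : Measurable fun p : X × X × X => (p.1, p.2.2))).sub
      (hK.comp_measurable (by fun_prop : Measurable fun p : X × X × X =>
        (p.2.1, p.2.2)))).enorm
  have hKm : Measurable fun p : X × X => ‖K p.1 p.2‖ₑ := hK.enorm
  refine ⟨hEm, fun x hx z hz => ?_, fun x hx z hz => ?_,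
    fun g => (hU.measurable g).aemeasurable, hU.subadditiveOn (fun g f =>
      integrable_pairing (LinftyC.memLp g r') (memLp_of_bound hcut h.bound f) hrr) Ω,
    hU.ae_eq_zero hEm hcut, hU.hasWeakType hEm hEf hrr hr1 hr hcut h.bound Ω, ?_, ?_⟩
  · rw [Metric.mem_ball']
    exact subset_ball_of_mem_cthickening hR hE (hEE ▸ hz) hx
  · refine Metric.mem_thickening_iff.2 ⟨x, hE₀ hx, ?_⟩
    rw [Metric.mem_ball] at hz
    linarith
  · intro G Q P hQ hP hG hQG hPG hP0 hgeo hdist g hg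
    set F := G ∩ Ω with hF
    have hFo : IsOpen F := hG.inter Metric.isOpen_thickening
    have hFΩ : F ⊆ Ω := inter_subset_right
    have hEF : E \ G ⊆ E \ F := sdiff_subset_sdiff_right inter_subset_left
    have hEGm : MeasurableSet (E \ G) := hEm.diff hG.measurableSet
    have hEFm : MeasurableSet (E \ F) := hEm.diff hFo.measurableSet
    set b := cutC Q hQ.nullMeasurableSet g -
      indC 𝕜 μ P hP ((μ.real P)⁻¹ • ∫ y in Q, g.1 y ∂μ) with hb
    have hbF : ConcentratedOn b.1 F := ((concentratedOn_cutC_self g _).mono hQG).sub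
      ((concentratedOn_indC hP _).mono hPG)
    have hint := h.integrable F hFo hFΩ
    rw [IntegrableOn, ← Measure.prod_restrict] at hint
    have hPtop : μ P ≠ ∞ := hP.measure_lt_top.ne
    refine hU.setLIntegral_le b _ hEGm _ fun f hf hf1 => ?_
    set H : X → B₂ := fun x => ∫ y in E \ F, K x y (f.1 y) ∂μ with hH
    have hfE : ConcentratedOn f.1 (E \ F) := hf.mono hEF
    have hHint : IntegrableOn H F μ := by
      obtain ⟨M, hM⟩ := LinftyC.exists_bound f
      exact (integrable_prod_clm_apply hint f.1.aestronglyMeasurable.restrict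
        (ae_restrict_of_ae hM)).integral_prod_left
    -- For a fixed test function f, evaluation at H x acts as a scalar-valued kernel on g, so that
    -- the atom estimate of the direct case applies to it.
    set L : X → (B₂ →L[𝕜] 𝕜) →L[𝕜] 𝕜 := fun x => ContinuousLinearMap.apply 𝕜 𝕜 (H x) with hL
    have hLint : IntegrableOn L F μ := (ContinuousLinearMap.apply 𝕜 𝕜).integrable_comp hHint
    have hpair : ∫ x, b.1 x (S f x) ∂μ = ∫ x in F, L x (b.1 x) ∂μ :=
      h.integral_pairing_eq hFo hFΩ hfE hbF
    -- Since |f| ≤ 1 and f lives on E \ G, the difference is at most the integral of |K(x, y) -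
    -- K(x', y)| over y in E \ G, which the dual regularity condition bounds by C.
    have hLdiff : ∀ᵐ x ∂μ, ∀ᵐ x' ∂μ, x ∈ Q → x' ∈ P → ‖L x - L x'‖ₑ ≤ C := by
      have hx := (ae_restrict_iff' hFo.measurableSet).1 hint.prod_right_ae
      filter_upwards [h.regularity, hx] with x h1 h2
      filter_upwards [h1, hx] with x' h3 h4 hxQ hxP
      have hsub : E \ G ⊆ E \ Metric.ball x (2 * dist x x') := by
        refine fun y hy => ⟨hy.1, ?_⟩
        rw [Metric.mem_ball, not_lt]
        exact hgeo y hy x hxQ x' hxP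
      have e1 : L x - L x' = ContinuousLinearMap.apply 𝕜 𝕜 (H x - H x') := (map_sub _ _ _).symm
      have e2 : H x - H x' = ∫ y in E \ F, (K x y - K x' y) (f.1 y) ∂μ := by
        simp only [hH, _root_.sub_apply]
        exact (integral_sub (integrableOn_clm_apply (h2 (hQG hxQ)) f)
          (integrableOn_clm_apply (h4 (hPG hxP)) f)).symm
      have e3 : ∀ v : B₂, ‖ContinuousLinearMap.apply 𝕜 𝕜 v‖ₑ ≤ ‖v‖ₑ := fun v => by
        rw [enorm_le_iff_norm_le]
        refine ContinuousLinearMap.opNorm_le_bound _ (norm_nonneg v) fun ℓ => ?_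
        rw [mul_comm]
        exact ℓ.le_opNorm v
      rw [e1]
      refine (e3 _).trans ?_
      rw [e2]
      refine (enorm_setIntegral_clm_le (L := fun y => K x y - K x' y) hEGm hf hf1).trans ?_
      exact (lintegral_mono_set hsub).trans (h3 (hQG hxQ).2 (hPG hxP).2 (hdist x hxQ x' hxP))
    rw [hpair]
    refine (ENNReal.mul_le_mul_iff_right hP0 hPtop).1 ?_
    refine (measure_mul_enorm_integral_atom_le hQ hP hQG hPG hP0 hLint g).trans ?_
    rw [lintegral_lintegral_swap]
    · calc ∫⁻ y in Q, ∫⁻ y' in P, ‖L y - L y'‖ₑ * ‖g.1 y‖ₑ ∂μ ∂μ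
          ≤ ∫⁻ y in Q, ∫⁻ y' in P, C * ‖g.1 y‖ₑ ∂μ ∂μ := by
            refine lintegral_mono_ae ?_
            filter_upwards [ae_restrict_of_ae hLdiff, ae_restrict_mem hQ] with y h1 h2
            refine lintegral_mono_ae ?_
            filter_upwards [ae_restrict_of_ae h1, ae_restrict_mem hP.isClosed.measurableSet]
              with y' h3 h4
            exact mul_le_mul' (h3 h2 h4) le_rfl
        _ = ∫⁻ y in Q, μ P * (C * ‖g.1 y‖ₑ) ∂μ := by
            refine lintegral_congr fun y => ?_
            rw [setLIntegral_const, mul_comm]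
        _ = _ := by
            rw [lintegral_const_mul' _ _ hPtop, lintegral_const_mul' _ _ ENNReal.coe_ne_top]
    · have h1 : AEStronglyMeasurable L (μ.restrict Q) := (hLint.mono_set hQG).1
      have h2 : AEStronglyMeasurable L (μ.restrict P) := (hLint.mono_set hPG).1
      exact ((h1.comp_snd.sub h2.comp_fst).enorm).mul
        ((measurable_enorm_coeFn g).comp measurable_snd).aemeasurable
  · intro G hG
    set F := G ∩ Ω with hF
    have hFo : IsOpen F := hG.inter Metric.isOpen_thickening
    have hFΩ : F ⊆ Ω := inter_subset_right
    have hEF : E \ G ⊆ E \ F := sdiff_subset_sdiff_right inter_subset_left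
    have hEFm : MeasurableSet (E \ F) := hEm.diff hFo.measurableSet
    have hint := h.integrable F hFo hFΩ
    rw [IntegrableOn, ← Measure.prod_restrict] at hint
    refine ⟨fun x => ∫⁻ y in E \ F, ‖K x y‖ₑ ∂μ, ?_, ?_, fun g hg => ?_⟩
    · rw [← lintegral_prod (fun p : X × X => ‖K p.1 p.2‖ₑ) hKm.aemeasurable]
      exact hint.2.ne
    · exact Measurable.lintegral_prod_right' hKm
    · refine hU.setLIntegral_le g _ (hEm.diff hG.measurableSet) _ fun f hf hf1 => ?_
      rw [h.integral_pairing_eq hFo hFΩ (hf.mono hEF) hg]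
      refine (enorm_integral_le_lintegral_enorm _).trans (lintegral_mono fun x => ?_)
      refine (ContinuousLinearMap.le_opENorm _ _).trans (mul_le_mul' le_rfl ?_)
      exact enorm_setIntegral_clm_le hEFm (hf.mono hEF) hf1

end Dual

/-! ### A converse of Hölder's inequality -/

section Converse

variable {X : Type*} [MetricSpace X] [MeasurableSpace X] [BorelSpace X] {μ : Measure X}
  {𝕜 : Type*} [RCLike 𝕜] {B₂ : Type*} [NormedAddCommGroup B₂] [NormedSpace 𝕜 B₂]
  [IsLocallyFiniteMeasure μ]

-- h is tested against ψ times norming functionals. These cannot be chosen measurably in general, so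
-- they are taken at the values of simple approximations of h, and the limit is reached by dominated
-- convergence.
set_option maxSynthPendingDepth 3 in
theorem lintegral_mul_enorm_le_of_pairing {h : X →ₘ[μ] B₂} {E : Set X} {q : ℝ} (hq : 0 < q)
    {c : ℝ≥0∞}
    (H : ∀ g : LinftyC 𝕜 (B₂ →L[𝕜] 𝕜) μ, ConcentratedOn g.1 E →
      ‖∫ x, g.1 x (h x) ∂μ‖ₑ ≤ c * (∫⁻ x, ‖g.1 x‖ₑ ^ q ∂μ) ^ (1 / q))
    {Q : Set X} (hQ : IsCompact Q) (hint : IntegrableOn h Q μ) {ψ : X → ℝ≥0} (hψ : Measurable ψ)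
    {N : ℝ≥0} (hN : ∀ x, ψ x ≤ N) (h0 : ∀ x, x ∉ E ∩ Q → ψ x = 0) :
    ∫⁻ x, ψ x * ‖h x‖ₑ ∂μ ≤ c * (∫⁻ x, (ψ x : ℝ≥0∞) ^ q ∂μ) ^ (1 / q) := by
  choose ℓ hℓ1 hℓ2 using fun v : B₂ => exists_dual_vector'' 𝕜 v
  have hsm : StronglyMeasurable h := AEEqFun.stronglyMeasurable h
  let g : ℕ → X → B₂ →L[𝕜] 𝕜 := fun k x => ((ψ x : ℝ) : 𝕜) • ℓ (hsm.approx k x)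
  have hψn : ∀ x, ‖((ψ x : ℝ) : 𝕜)‖ = ψ x := fun x => by
    rw [RCLike.norm_ofReal, abs_of_nonneg (ψ x).coe_nonneg]
  have hgn : ∀ k x, ‖g k x‖ ≤ ψ x := fun k x => by
    rw [norm_smul, hψn]
    exact mul_le_of_le_one_right (ψ x).coe_nonneg (hℓ1 _)
  have hgm : ∀ k, StronglyMeasurable (g k) := fun k => by
    have h1 : StronglyMeasurable fun x => ((ψ x : ℝ) : 𝕜) :=
      (RCLike.continuous_ofReal.measurable.comp hψ.coe_nnreal_real).stronglyMeasurable
    exact h1.smul ((hsm.approx k).map ℓ).stronglyMeasurable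
  have hg0 : ∀ k x, ψ x = 0 → g k x = 0 := fun k x hx => by
    have := hgn k x
    rwa [hx, NNReal.coe_zero, norm_le_zero_iff] at this
  have hgmem : ∀ k, AEEqFun.mk (g k) (hgm k).aestronglyMeasurable ∈
      LinftyC 𝕜 (B₂ →L[𝕜] 𝕜) μ := fun k => by
    refine ⟨(memLp_congr_ae (AEEqFun.coeFn_mk _ _)).2 (memLp_top_of_bound
      (hgm k).aestronglyMeasurable N (Eventually.of_forall fun x =>
        (hgn k x).trans (by exact_mod_cast hN x))), Q, hQ, ?_⟩
    filter_upwards [AEEqFun.coeFn_mk (g k) (hgm k).aestronglyMeasurable (μ := μ)] with x hx hxQ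
    rw [hx, hg0 k x (h0 x fun hx => hxQ hx.2)]
  let gC : ℕ → LinftyC 𝕜 (B₂ →L[𝕜] 𝕜) μ := fun k => ⟨_, hgmem k⟩
  have hgC : ∀ k, (gC k).1 =ᵐ[μ] g k := fun k => AEEqFun.coeFn_mk _ _
  have hgE : ∀ k, ConcentratedOn (gC k).1 E := fun k => by
    filter_upwards [hgC k] with x hx hxE
    rw [hx, hg0 k x (h0 x fun hx => hxE hx.1)]
  have hdom : Integrable (fun x => (ψ x : ℝ) * ‖h x‖) μ := by
    have h1 : Integrable (Q.indicator fun x => ‖h x‖) μ :=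
      (integrable_indicator_iff hQ.isClosed.measurableSet).2 hint.norm
    refine (h1.const_mul (N : ℝ)).mono'
      (hψ.coe_nnreal_real.aestronglyMeasurable.mul hsm.norm.aestronglyMeasurable)
      (Eventually.of_forall fun x => ?_)
    rw [norm_mul, norm_norm, NNReal.norm_eq]
    by_cases hx : x ∈ Q
    · rw [indicator_of_mem hx]
      exact mul_le_mul_of_nonneg_right (by exact_mod_cast hN x) (norm_nonneg _)
    · simp [hx, h0 x fun hx' => hx hx'.2]
  have hlim : Tendsto (fun k => ∫ x, g k x (h x) ∂μ) atTop
      (𝓝 (∫ x, (((ψ x : ℝ) * ‖h x‖ : ℝ) : 𝕜) ∂μ)) := by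
    refine tendsto_integral_of_dominated_convergence (fun x => (ψ x : ℝ) * ‖h x‖) (fun k =>
      (ContinuousLinearMap.id 𝕜 (B₂ →L[𝕜] 𝕜)).aestronglyMeasurable_comp₂
        (hgm k).aestronglyMeasurable hsm.aestronglyMeasurable) hdom
      (fun k => Eventually.of_forall fun x => ?_) (Eventually.of_forall fun x => ?_)
    · exact ((g k x).le_opNorm _).trans (mul_le_mul_of_nonneg_right (hgn k x) (norm_nonneg _))
    · have h1 := hsm.tendsto_approx x
      -- The functional norms the approximant, and its value at h - approximant tends to 0 because
      -- its norm is at most 1.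
      have h2 : Tendsto (fun k => ((‖hsm.approx k x‖ : ℝ) : 𝕜) + ℓ (hsm.approx k x)
          (h x - hsm.approx k x)) atTop (𝓝 ((‖h x‖ : ℝ) : 𝕜)) := by
        have h3 : Tendsto (fun k => ((‖hsm.approx k x‖ : ℝ) : 𝕜)) atTop (𝓝 ((‖h x‖ : ℝ) : 𝕜)) :=
          (RCLike.continuous_ofReal.tendsto _).comp h1.norm
        have h4 : Tendsto (fun k => ℓ (hsm.approx k x) (h x - hsm.approx k x)) atTop (𝓝 0) := by
          refine squeeze_zero_norm (a := fun k => ‖h x - hsm.approx k x‖) (fun k => ?_) ?_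
          · exact ((ℓ _).le_opNorm _).trans (mul_le_of_le_one_left (norm_nonneg _) (hℓ1 _))
          · have := (tendsto_const_nhds (x := h x)).sub h1
            rw [sub_self] at this
            simpa using this.norm
        simpa using h3.add h4
      have h5 := h2.const_mul ((ψ x : ℝ) : 𝕜)
      rw [RCLike.ofReal_mul]
      refine h5.congr fun k => ?_
      simp only [g, _root_.smul_apply, smul_eq_mul, map_sub, hℓ2]
      ring
  have hle : ∀ k, ‖∫ x, g k x (h x) ∂μ‖ₑ ≤ c * (∫⁻ x, (ψ x : ℝ≥0∞) ^ q ∂μ) ^ (1 / q) :=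
    fun k => by
    have h1 : ∫ x, g k x (h x) ∂μ = ∫ x, (gC k).1 x (h x) ∂μ :=
      integral_congr_ae (by filter_upwards [hgC k] with x hx; rw [hx])
    rw [h1]
    refine (H (gC k) (hgE k)).trans (mul_le_mul' le_rfl (ENNReal.rpow_le_rpow
      (lintegral_mono_ae ?_) (by positivity)))
    filter_upwards [hgC k] with x hx
    rw [hx]
    refine ENNReal.rpow_le_rpow ?_ hq.le
    have : ‖g k x‖₊ ≤ ψ x := hgn k x
    exact_mod_cast ENNReal.coe_le_coe.2 this
  have hval : ‖∫ x, (((ψ x : ℝ) * ‖h x‖ : ℝ) : 𝕜) ∂μ‖ₑ = ∫⁻ x, ψ x * ‖h x‖ₑ ∂μ := by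
    have hnn : ∀ x, 0 ≤ (ψ x : ℝ) * ‖h x‖ := fun x => by positivity
    rw [integral_ofReal, ← ofReal_norm, RCLike.norm_ofReal,
      abs_of_nonneg (integral_nonneg hnn), ofReal_integral_eq_lintegral_ofReal hdom
        (Eventually.of_forall hnn)]
    refine lintegral_congr fun x => ?_
    rw [ENNReal.ofReal_mul (ψ x).coe_nonneg, ENNReal.ofReal_coe_nnreal, ofReal_norm]
  rw [← hval]
  exact le_of_tendsto' ((continuous_enorm.tendsto _).comp hlim) hle

/-- The converse of Hölder's inequality, for functions with values in a normed space. -/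
theorem setLIntegral_rpow_le_of_pairing [SigmaCompactSpace X] {h : X →ₘ[μ] B₂} {E : Set X}
    (hE : MeasurableSet E) {q s : ℝ} (hqs : q.HolderConjugate s) {c : ℝ≥0∞}
    (hint : ∀ Q, IsCompact Q → IntegrableOn h Q μ)
    (H : ∀ g : LinftyC 𝕜 (B₂ →L[𝕜] 𝕜) μ, ConcentratedOn g.1 E →
      ‖∫ x, g.1 x (h x) ∂μ‖ₑ ≤ c * (∫⁻ x, ‖g.1 x‖ₑ ^ q ∂μ) ^ (1 / q)) :
    ∫⁻ x in E, ‖h x‖ₑ ^ s ∂μ ≤ c ^ s := by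
  have hs0 : 0 < s := hqs.symm.pos
  have hs1 : 0 ≤ s - 1 := hqs.symm.sub_one_pos.le
  have hhm : Measurable fun x => ‖h x‖₊ := (AEEqFun.stronglyMeasurable h).nnnorm.measurable
  -- Truncating |h| at height n on a compact set makes the integral I of the s-th power finite, so
  -- that I ≤ c I^(1/q) may be divided by I^(1/q).
  let Z : ℕ → Set X := fun n => E ∩ compactCovering X n
  have hZm : ∀ n, MeasurableSet (Z n) := fun n =>
    hE.inter (isCompact_compactCovering X n).isClosed.measurableSet
  let m : ℕ → X → ℝ≥0 := fun n x => min ‖h x‖₊ n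
  have hmm : ∀ n, Measurable (m n) := fun n => hhm.min measurable_const
  let F : ℕ → X → ℝ≥0∞ := fun n => (Z n).indicator fun x => ((m n x ^ s : ℝ≥0) : ℝ≥0∞)
  have hFm : ∀ n, Measurable (F n) := fun n =>
    (((hmm n).pow_const s).coe_nnreal_ennreal).indicator (hZm n)
  have hFle : ∀ n, ∫⁻ x, F n x ∂μ ≤ c ^ s := fun n => by
    have hfin : ∫⁻ x, F n x ∂μ ≠ ∞ := by
      have h1 : ∫⁻ x, F n x ∂μ ≤ ∫⁻ _ in Z n, (((n : ℝ≥0) ^ s : ℝ≥0) : ℝ≥0∞) ∂μ := by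
        rw [lintegral_indicator (hZm n)]
        refine lintegral_mono fun x => ENNReal.coe_le_coe.2 ?_
        exact NNReal.rpow_le_rpow (min_le_right _ _) hs0.le
      refine ne_top_of_le_ne_top ?_ h1
      rw [setLIntegral_const]
      exact ENNReal.mul_ne_top ENNReal.coe_ne_top (measure_ne_top_of_subset inter_subset_right
        (isCompact_compactCovering X n).measure_lt_top.ne)
    -- The test function is the (s-1)-th power of the truncation, because (s-1) q = s.
    have key := lintegral_mul_enorm_le_of_pairing hqs.pos H (isCompact_compactCovering X n)
      (hint _ (isCompact_compactCovering X n)) (ψ := (Z n).indicator fun x => m n x ^ (s - 1))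
      (((hmm n).pow_const (s - 1)).indicator (hZm n)) (N := (n : ℝ≥0) ^ (s - 1)) (fun x => by
        by_cases hx : x ∈ Z n
        · rw [indicator_of_mem hx]
          exact NNReal.rpow_le_rpow (min_le_right _ _) hs1
        · simp [hx]) (fun x hx => indicator_of_notMem hx _)
    have h1 : ∫⁻ x, F n x ∂μ ≤
        ∫⁻ x, (((Z n).indicator (fun x => m n x ^ (s - 1)) x : ℝ≥0) : ℝ≥0∞) * ‖h x‖ₑ ∂μ := by
      refine lintegral_mono fun x => ?_
      by_cases hx : x ∈ Z n
      · simp only [F, indicator_of_mem hx]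
        have h2 : m n x ^ s ≤ m n x ^ (s - 1) * ‖h x‖₊ := by
          have h3 : m n x ^ s = m n x ^ (s - 1) * m n x := by
            have := NNReal.rpow_add_of_nonneg (m n x) hs1 zero_le_one
            rwa [sub_add_cancel, NNReal.rpow_one] at this
          rw [h3]
          exact mul_le_mul_of_nonneg_left (min_le_left _ _) zero_le
        rw [enorm_eq_nnnorm, ← ENNReal.coe_mul]
        exact ENNReal.coe_le_coe.2 h2
      · simp [F, hx]
    have h2 : ∫⁻ x, (((Z n).indicator (fun x => m n x ^ (s - 1)) x : ℝ≥0) : ℝ≥0∞) ^ q ∂μ =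
        ∫⁻ x, F n x ∂μ := by
      refine lintegral_congr fun x => ?_
      by_cases hx : x ∈ Z n
      · simp only [F, indicator_of_mem hx]
        rw [← ENNReal.coe_rpow_of_nonneg _ hqs.pos.le, ← NNReal.rpow_mul, hqs.symm.sub_one_mul_conj]
      · simp [F, hx, hqs.pos]
    rw [h2] at key
    have h3 := h1.trans key
    generalize ∫⁻ x, F n x ∂μ = I at h3 hfin
    rcases eq_or_ne I 0 with rfl | hI0
    · exact zero_le
    have h4 : I ^ (1 / s) ≤ c := by
      have hne0 : I ^ (1 / q) ≠ 0 := (ENNReal.rpow_pos (pos_iff_ne_zero.2 hI0) hfin).ne'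
      have hnet : I ^ (1 / q) ≠ ∞ := ENNReal.rpow_ne_top_of_nonneg hqs.one_div_nonneg hfin
      refine (ENNReal.mul_le_mul_iff_left hne0 hnet).1 ?_
      have h5 : 1 / s + 1 / q = 1 := by
        rw [one_div, one_div, add_comm, hqs.inv_add_inv_eq_one]
      rwa [← ENNReal.rpow_add _ _ hI0 hfin, h5, ENNReal.rpow_one]
    calc I = (I ^ (1 / s)) ^ s := by
          rw [← ENNReal.rpow_mul, one_div_mul_cancel hs0.ne', ENNReal.rpow_one]
      _ ≤ c ^ s := ENNReal.rpow_le_rpow h4 hs0.le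
  have hlim : Tendsto (fun n => ∫⁻ x, F n x ∂μ) atTop
      (𝓝 (∫⁻ x, E.indicator (fun x => ‖h x‖ₑ ^ s) x ∂μ)) := by
    refine lintegral_tendsto_of_tendsto_of_monotone (fun n => (hFm n).aemeasurable)
      (Eventually.of_forall fun x => ?_) (Eventually.of_forall fun x => ?_)
    · intro j k hjk
      by_cases hx : x ∈ Z j
      · have hx' : x ∈ Z k := ⟨hx.1, compactCovering_subset X hjk hx.2⟩
        simp only [F, indicator_of_mem hx, indicator_of_mem hx']
        refine ENNReal.coe_le_coe.2 (NNReal.rpow_le_rpow ?_ hs0.le)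
        exact min_le_min le_rfl (by exact_mod_cast hjk)
      · simp [F, hx]
    · by_cases hxE : x ∈ E
      · obtain ⟨n₁, hn₁⟩ := exists_mem_compactCovering x
        obtain ⟨n₂, hn₂⟩ := exists_nat_ge ‖h x‖₊
        refine tendsto_const_nhds.congr' ?_
        filter_upwards [eventually_ge_atTop n₁, eventually_ge_atTop n₂] with n h1 h2
        have hx : x ∈ Z n := ⟨hxE, compactCovering_subset X h1 hn₁⟩
        have h3 : m n x = ‖h x‖₊ := min_eq_left (hn₂.trans (by exact_mod_cast h2))
        simp only [F, indicator_of_mem hx, indicator_of_mem hxE, h3]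
        rw [ENNReal.coe_rpow_of_nonneg _ hs0.le]
        rfl
      · refine tendsto_const_nhds.congr fun n => ?_
        have hx : x ∉ Z n := fun h => hxE h.1
        simp [F, hx, hxE]
  rw [← lintegral_indicator hE]
  exact le_of_tendsto' hlim hFle

end Converse

/-! ### Conjugate exponents -/

section Exponents

theorem inv_eq_ofReal_one_sub {p p' : ℝ≥0∞} (h : p'.HolderConjugate p) (h1 : 1 ≤ p) :
    p'⁻¹ = ENNReal.ofReal (1 - p.toReal⁻¹) := by
  have hp0 : p ≠ 0 := (zero_lt_one.trans_le h1).ne'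
  have h2 : p⁻¹ ≠ ∞ := ENNReal.inv_ne_top.2 hp0
  rw [ENNReal.eq_sub_of_add_eq h2 h.inv_add_inv_eq_one, ENNReal.ofReal_sub _ (by positivity),
    ENNReal.ofReal_one, ← ENNReal.toReal_inv, ENNReal.ofReal_toReal h2]

/-- Conjugates enter only through their reciprocals 1 - 1/a and 1 - 1/p, which remain meaningful
when a = 1 and a' = ∞. -/
theorem toReal_interpolation_exponent_conj {a p q : ℝ} {a' p' q' : ℝ≥0∞} (ha : 1 ≤ a) (hap : a < p)
    (hq : 1 < q) (hqp : q * (1 - p⁻¹) < 1) (ha' : a'⁻¹ = ENNReal.ofReal (1 - a⁻¹))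
    (hp' : p'⁻¹ = ENNReal.ofReal (1 - p⁻¹)) (hq' : q' = ENNReal.ofReal q) :
    ((1 / p' - 1 / a') / (1 - q' / a')).toReal = (a⁻¹ - p⁻¹) / (1 - q * (1 - a⁻¹)) := by
  have ha0 : 0 < a := by linarith
  have h1 : p⁻¹ ≤ a⁻¹ := inv_anti₀ ha0 hap.le
  have h2 : a⁻¹ ≤ 1 := inv_le_one_of_one_le₀ ha
  have h3 : q * (1 - a⁻¹) ≤ q * (1 - p⁻¹) := by gcongr
  have h4 : 0 < 1 - q * (1 - a⁻¹) := by linarith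
  have h5 : 0 ≤ q * (1 - a⁻¹) := mul_nonneg (by linarith) (by linarith)
  rw [one_div, one_div, div_eq_mul_inv q', ha', hp', hq', ← ENNReal.ofReal_mul (by linarith),
    ← ENNReal.ofReal_one, ← ENNReal.ofReal_sub _ (by linarith), ← ENNReal.ofReal_sub _ h5,
    ← ENNReal.ofReal_div_of_pos h4, ENNReal.toReal_ofReal]
  · ring
  · exact div_nonneg (by linarith) h4.le

/-- With s = q/(q-1), the left side is the exponent in φ(r', p'), and the right side is the power of
Φ left by interpolating between L^a and L^s when Φ^(1/q) appears only in the norm on L^s. -/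
theorem interpolation_exponent_conj_eq {a p q : ℝ} (ha : 0 < a) (hp : 0 < p) (hq : 1 < q)
    (h : 0 < 1 - q * (1 - a⁻¹)) : (a⁻¹ - p⁻¹) / (1 - q * (1 - a⁻¹)) =
      1 / q * (q / (q - 1) * (p - a) / (p * (q / (q - 1) - a))) := by
  have hq1 : q - 1 ≠ 0 := by linarith
  have hq0 : q ≠ 0 := by linarith
  have e1 : 1 - q * (1 - a⁻¹) = (a - a * q + q) / a := by field_simp; ring
  have e2 : q / (q - 1) - a = (a - a * q + q) / (q - 1) := by field_simp; ring
  have hd : a - a * q + q ≠ 0 := by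
    rw [e1] at h
    exact fun h0 => by simp [h0] at h
  rw [e1, e2]
  generalize a - a * q + q = d at hd
  field_simp

end Exponents

/-! ### Local L^p bound in the dual case -/

section Dual

variable {X : Type*} [MetricSpace X] [MeasurableSpace X] [BorelSpace X] {μ : Measure X}
  {𝕜 : Type*} [RCLike 𝕜] {B₁ B₂ : Type*} [NormedAddCommGroup B₁] [NormedSpace 𝕜 B₁]
  [NormedAddCommGroup B₂] [NormedSpace ℝ B₂] [NormedSpace 𝕜 B₂]
  [SecondCountableTopology X] [IsLocallyFiniteMeasure μ] [μ.InnerRegular] [μ.IsOpenPosMeasure]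
  [CompleteSpace B₁] [CompleteSpace B₂] [SigmaCompactSpace X]

theorem eLpNorm_cutC_le {S : Set X} (hS : NullMeasurableSet S μ) (f : LinftyC 𝕜 B₁ μ) (p : ℝ≥0∞) :
    eLpNorm (cutC S hS f).1 p μ ≤ eLpNorm f.1 p μ :=
  eLpNorm_mono_enorm_ae (ae_enorm_cutC_le hS f)

/-- The bound for the exponent `s` that is dual to the Marcinkiewicz bound for the transpose. -/
theorem DualConditions.setLIntegral_rpow_le [NormedSpace ℝ B₁] {R : ℝ} {D : ℝ≥0}
    (hD : DoublingUpTo μ R D) (hD1 : 1 ≤ D) (hR : 0 < R) {r r' : ℝ≥0∞}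
    (hrr : r'.HolderConjugate r) (hr1 : 1 ≤ r) (hr : r ≠ ∞) {A C : ℝ≥0} (hA : 0 < A)
    {E₀ E : Set X} (hE₀ : MeasurableSet E₀)
    (hEE : E = Metric.cthickening (R / 3) E₀) (hEm : MeasurableSet E)
    (hEf : μ E ≠ ∞) (hE : Metric.ediam E₀ < ENNReal.ofReal (R / 4))
    {S : LinftyC 𝕜 B₁ μ →ₗ[𝕜] (X →ₘ[μ] B₂)}
    (hcut : ∀ f, S (cutC E hEm.nullMeasurableSet f) = S f)
    {K : X → X → B₁ →L[𝕜] B₂} (hK : StronglyMeasurable (Function.uncurry K))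
    (h : DualConditions μ R r A C E S K) {q s : ℝ} (hqs : q.HolderConjugate s)
    (hqr : ENNReal.ofReal q < r') {Φ : ℝ≥0}
    (hΦ : marcinkiewiczConst r' (ENNReal.ofReal q) = Φ) (f : LinftyC 𝕜 B₁ μ) :
    ∫⁻ x in E₀, ‖S f x‖ₑ ^ s ∂μ ≤
      ((2 * weakConst D A C * Φ ^ (1 / q) : ℝ≥0) : ℝ≥0∞) ^ s * ∫⁻ x, ‖f.1 x‖ₑ ^ s ∂μ := by
  obtain ⟨U, hU⟩ := exists_isTransposeNorm hEm hEf hrr hr1 hr hcut h.bound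
  have hCZ := h.isLocalCZOperator hR hrr hr1 hr hEE hEm hEf hE hcut hK hU
  set M := weakConst D A C with hM
  have hq0 : 0 < q := hqs.pos
  have hs0 : 0 < s := hqs.symm.pos
  set N : ℝ≥0 := 2 * M * Φ ^ (1 / q) with hN
  have hNq : (N : ℝ≥0∞) ^ q = Φ * (2 * M) ^ q := by
    rw [hN, ENNReal.coe_mul, ENNReal.mul_rpow_of_nonneg _ _ hq0.le,
      ← ENNReal.coe_rpow_of_nonneg (Φ ^ (1 / q)) hq0.le, ← NNReal.rpow_mul,
      one_div_mul_cancel hq0.ne', NNReal.rpow_one, mul_comm]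
    simp
  have hUq : ∀ g : LinftyC 𝕜 (B₂ →L[𝕜] 𝕜) μ, ConcentratedOn g.1 E₀ →
      (∫⁻ x, U g x ^ q ∂μ) ^ (1 / q) ≤ N * (∫⁻ x, ‖g.1 x‖ₑ ^ q ∂μ) ^ (1 / q) := fun g hg => by
    have h1 := hCZ.lintegral_rpow_le hD hD1 hR hA hqs.lt hqr g hg
    rw [hΦ, ← mul_assoc, ← hNq] at h1
    refine (ENNReal.rpow_le_rpow h1 hqs.one_div_nonneg).trans (le_of_eq ?_)
    rw [ENNReal.mul_rpow_of_nonneg _ _ hqs.one_div_nonneg, ← ENNReal.rpow_mul,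
      mul_one_div_cancel hq0.ne', ENNReal.rpow_one]
  -- The pairing of g with S f is at most ∫ |f| U g; Hölder and the L^q bound for U on functions
  -- concentrated on E₀ bound this by N times the product of the norms of f and g.
  have key := setLIntegral_rpow_le_of_pairing (h := S f) hE₀ hqs
    (c := (∫⁻ x, ‖f.1 x‖ₑ ^ s ∂μ) ^ (1 / s) * N) (fun Q hQ =>
      ((memLp_of_bound hcut h.bound f).locallyIntegrable hr1).integrableOn_isCompact hQ)
    (fun g hg => by
      refine (hU.enorm_pairing_le g f).trans ((ENNReal.lintegral_mul_le_Lp_mul_Lq μ hqs.symm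
        (measurable_enorm_coeFn f).aemeasurable (hU.measurable g).aemeasurable).trans ?_)
      rw [mul_assoc]
      exact mul_le_mul' le_rfl (hUq g hg))
  refine key.trans (le_of_eq ?_)
  rw [ENNReal.mul_rpow_of_nonneg _ _ hs0.le, ← ENNReal.rpow_mul, one_div_mul_cancel hs0.ne',
    ENNReal.rpow_one, mul_comm]

/-- The local `L^p` bound for `r < p < ∞`. -/
theorem DualConditions.eLpNorm_le [NormedSpace ℝ B₁] {R : ℝ} {D : ℝ≥0}
    (hD : DoublingUpTo μ R D) (hD1 : 1 ≤ D) (hR : 0 < R) {r r' : ℝ≥0∞}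
    (hrr : r'.HolderConjugate r) (hr1 : 1 ≤ r) {A C : ℝ≥0} (hA : 0 < A)
    {E₀ E : Set X} (hE₀ : MeasurableSet E₀)
    (hEE : E = Metric.cthickening (R / 3) E₀) (hEm : MeasurableSet E)
    (hEf : μ E ≠ ∞) (hE : Metric.ediam E₀ < ENNReal.ofReal (R / 4))
    {S : LinftyC 𝕜 B₁ μ →ₗ[𝕜] (X →ₘ[μ] B₂)}
    (hcut : ∀ f, S (cutC E hEm.nullMeasurableSet f) = S f)
    {K : X → X → B₁ →L[𝕜] B₂} (hK : StronglyMeasurable (Function.uncurry K))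
    (h : DualConditions μ R r A C E S K) {p p' : ℝ≥0∞} (hpp : p'.HolderConjugate p)
    (hrp : r < p) (hp : p ≠ ∞) {q : ℝ≥0∞} (hq : 1 < q) (hqp : q < p') (f : LinftyC 𝕜 B₁ μ) :
    eLpNorm (S f) p (μ.restrict E₀) ≤ 4 * weakConst D A C *
      marcinkiewiczConst r' q ^ ((1 / p' - 1 / r') / (1 - q / r')).toReal * eLpNorm f.1 p μ := by
  have hr : r ≠ ∞ := hrp.ne_top
  have hp1 : 1 ≤ p := hr1.trans hrp.le
  have hp'r' : p' ≤ r' := by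
    rw [← ENNReal.inv_le_inv, ENNReal.eq_sub_of_add_eq (ENNReal.inv_ne_top.2
      (zero_lt_one.trans_le hr1).ne') hrr.inv_add_inv_eq_one,
      ENNReal.eq_sub_of_add_eq (ENNReal.inv_ne_top.2 (zero_lt_one.trans_le hp1).ne')
      hpp.inv_add_inv_eq_one]
    exact tsub_le_tsub_left (ENNReal.inv_le_inv.2 hrp.le) 1
  have hr'inv := inv_eq_ofReal_one_sub hrr hr1
  have hp'inv := inv_eq_ofReal_one_sub hpp hp1
  have hqr : q < r' := hqp.trans_le hp'r'
  have hΦ0 := marcinkiewiczConst_ne_zero (r := r') hq hqr.ne_top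
  have hΦt := marcinkiewiczConst_ne_top hq hqr
  have hq' : q ≠ ∞ := hqr.ne_top
  set M := weakConst D A C with hM
  have hAM : A ≤ M := le_weakConst hD1
  have hM0 : 0 < M := weakConst_pos hD1 hA
  have hA2M : A ≤ 2 * M := hAM.trans (le_mul_of_one_le_left zero_le (by norm_num))
  obtain ⟨Q, hQ⟩ : ∃ Q : ℝ, Q = q.toReal := ⟨_, rfl⟩
  have hqQ : q = ENNReal.ofReal Q := by rw [hQ, ENNReal.ofReal_toReal hq']
  have hQ1 : 1 < Q := by rw [hqQ] at hq; exact ENNReal.one_lt_ofReal.1 hq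
  obtain ⟨Φ, hΦ⟩ : ∃ Φ : ℝ≥0, marcinkiewiczConst r' q = Φ := ⟨_, (ENNReal.coe_toNNReal hΦt).symm⟩
  have hΦ0' : 0 < Φ := pos_iff_ne_zero.2 fun h0 => hΦ0 (by rw [hΦ, h0, ENNReal.coe_zero])
  lift r to ℝ≥0 using hr
  lift p to ℝ≥0 using hp
  simp only [ENNReal.coe_toReal] at hr'inv hp'inv
  have ha1 : (1 : ℝ) ≤ r := by exact_mod_cast hr1
  have hap : (r : ℝ) < p := by exact_mod_cast hrp
  have ha0 : (0 : ℝ) < r := by linarith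
  have hp0 : (0 : ℝ) < p := by linarith
  have hrne : (r : ℝ≥0∞) ≠ 0 := (zero_lt_one.trans_le hr1).ne'
  have hpne : (p : ℝ≥0∞) ≠ 0 := (zero_lt_one.trans_le hp1).ne'
  have hQp : Q * (1 - (p : ℝ)⁻¹) < 1 := by
    have h1 := ENNReal.inv_lt_inv.2 hqp
    rw [hp'inv, hqQ, ← ENNReal.ofReal_inv_of_pos (by linarith),
      ENNReal.ofReal_lt_ofReal_iff (by positivity)] at h1
    calc Q * (1 - (p : ℝ)⁻¹) < Q * Q⁻¹ := by gcongr
      _ = 1 := mul_inv_cancel₀ (by positivity)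
  have hexp := toReal_interpolation_exponent_conj ha1 hap hQ1 hQp hr'inv hp'inv hqQ
  -- The exponent conjugate to q. The condition q < p' becomes p < s, so that p lies strictly
  -- between the two endpoints r and s.
  obtain ⟨s, hs⟩ : ∃ s : ℝ, s = Q / (Q - 1) := ⟨_, rfl⟩
  have hqs : Q.HolderConjugate s := (Real.holderConjugate_iff_eq_conjExponent hQ1).2 hs
  have hs0 : 0 < s := hqs.symm.pos
  have hQ1' : 0 < Q - 1 := by linarith
  have hps : (p : ℝ) < s := by
    rw [hs, lt_div_iff₀ hQ1']
    have h2 : Q * (1 - (p : ℝ)⁻¹) * p < 1 * p := by gcongr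
    have h3 : (p : ℝ)⁻¹ * p = 1 := inv_mul_cancel₀ hp0.ne'
    nlinarith
  have hUb : ∀ g : LinftyC 𝕜 B₁ μ, ∫⁻ x, E₀.indicator (fun x => ‖S g x‖ₑ) x ^ s ∂μ ≤
      ((2 * M * Φ ^ (1 / Q) : ℝ≥0) : ℝ≥0∞) ^ s * ∫⁻ x, ‖g.1 x‖ₑ ^ s ∂μ := fun g => by
    have h1 := h.setLIntegral_rpow_le hD hD1 hR hrr hr1 ENNReal.coe_ne_top hA hE₀ hEE hEm hEf hE hcut
      hK hqs (hqQ ▸ hqr) (hqQ ▸ hΦ) g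
    rw [← lintegral_indicator hE₀] at h1
    refine le_trans (le_of_eq (lintegral_congr fun x => ?_)) h1
    by_cases hx : x ∈ E₀ <;> simp [hx, hs0]
  have hUa : ∀ g : LinftyC 𝕜 B₁ μ, ∫⁻ x, E₀.indicator (fun x => ‖S g x‖ₑ) x ^ (r : ℝ) ∂μ ≤
      ((2 * M : ℝ≥0) : ℝ≥0∞) ^ (r : ℝ) * ∫⁻ x, ‖g.1 x‖ₑ ^ (r : ℝ) ∂μ := fun g => by
    have h1 : eLpNorm (S g) r μ ≤ (2 * M : ℝ≥0) * eLpNorm g.1 r μ := by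
      rw [← hcut g]
      exact (h.bound _ (concentratedOn_cutC_self _ _)).trans
        (mul_le_mul' (by exact_mod_cast hA2M) (eLpNorm_cutC_le _ g _))
    have h2 := ENNReal.rpow_le_rpow h1 ha0.le
    rw [ENNReal.mul_rpow_of_nonneg _ _ ha0.le] at h2
    have e1 := eLpNorm_rpow_toReal (ν := μ) hrne ENNReal.coe_ne_top (S g)
    have e2 := eLpNorm_rpow_toReal (ν := μ) hrne ENNReal.coe_ne_top g.1
    rw [ENNReal.coe_toReal] at e1 e2
    rw [e1, e2] at h2
    refine (lintegral_mono fun x => ?_).trans h2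
    by_cases hx : x ∈ E₀ <;> simp [hx, ha0]
  have key := strong_interpolation_norm (Y := univ)
    (U := fun g x => E₀.indicator (fun x => ‖S g x‖ₑ) x)
    (fun g => (S g).aestronglyMeasurable.enorm.indicator hE₀) (fun g g' hg hg' => by
      filter_upwards [subadditiveOn_enorm S univ g g' hg hg'] with x hx
      by_cases hxE : x ∈ E₀
      · simpa [hxE] using hx
      · simp [hxE]) ha0 hap hps (Ma := 2 * M) (Mb := 2 * M * Φ ^ (1 / Q)) (by positivity)
    (by positivity) (fun g _ => hUa g) (fun g _ => hUb g) f (by simp [ConcentratedOn])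
  rw [eLpNorm_coe_eq hpne, eLpNorm_coe_eq hpne, hexp, hΦ]
  have hL : ∫⁻ x, E₀.indicator (fun x => ‖S f x‖ₑ) x ^ (p : ℝ) ∂μ =
      ∫⁻ x in E₀, ‖S f x‖ₑ ^ (p : ℝ) ∂μ := by
    rw [← lintegral_indicator hE₀]
    refine lintegral_congr fun x => ?_
    by_cases hx : x ∈ E₀ <;> simp [hx, hp0]
  rw [hL] at key
  refine key.trans (le_of_eq ?_)
  congr 1
  have h2M : (2 * M : ℝ≥0) ≠ 0 := by positivity
  have hsr : s - r ≠ 0 := by linarith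
  have hpos : 0 < 1 - Q * (1 - (r : ℝ)⁻¹) := by
    have : Q * (1 - (r : ℝ)⁻¹) ≤ Q * (1 - (p : ℝ)⁻¹) := by gcongr
    linarith
  have hθ : ((r : ℝ)⁻¹ - (p : ℝ)⁻¹) / (1 - Q * (1 - (r : ℝ)⁻¹)) =
      1 / Q * (s * (p - r) / (p * (s - r))) := by
    rw [hs]
    exact interpolation_exponent_conj_eq ha0 hp0 hQ1 hpos
  have hθ0 : 0 ≤ ((r : ℝ)⁻¹ - (p : ℝ)⁻¹) / (1 - Q * (1 - (r : ℝ)⁻¹)) :=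
    div_nonneg (sub_nonneg.2 (inv_anti₀ ha0 hap.le)) hpos.le
  rw [← ENNReal.coe_rpow_of_nonneg _ hθ0, NNReal.mul_rpow (x := 2 * M) (y := Φ ^ (1 / Q)), ← NNReal.rpow_mul, ← hθ,
    ← mul_assoc, ← NNReal.rpow_add h2M,
    show (r : ℝ) * (s - p) / (p * (s - r)) + s * (p - r) / (p * (s - r)) = 1 by
      field_simp; ring, NNReal.rpow_one]
  push_cast
  ring

end Dual

/-! ### Global bound in the dual case -/

section Global

variable {X : Type*} [MetricSpace X] [MeasurableSpace X] [BorelSpace X] {μ : Measure X}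
  {𝕜 : Type*} [RCLike 𝕜] {B₁ B₂ : Type*} [NormedAddCommGroup B₁] [NormedSpace 𝕜 B₁]
  [NormedAddCommGroup B₂] [NormedSpace ℝ B₂] [NormedSpace 𝕜 B₂]
  [SecondCountableTopology X] [IsLocallyFiniteMeasure μ] [μ.InnerRegular] [μ.IsOpenPosMeasure]
  [CompleteSpace B₁] [CompleteSpace B₂] [SigmaCompactSpace X]

theorem phi_self {r : ℝ≥0∞} (h1 : 1 ≤ r) (hr : r ≠ ∞) : phi r r = 1 := by
  have key : ∀ p : ℝ≥0∞, 1 < p → phiBelow p p = 1 := fun p hp => by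
    simp only [phiBelow, tsub_self, ENNReal.zero_div, ENNReal.toReal_zero, ENNReal.rpow_zero]
    exact biInf_const (nonempty_Ioo.2 hp)
  rcases h1.eq_or_lt with rfl | hlt
  · rw [phi, if_neg (by simp)]
    exact key _ (by simp [ENNReal.conjExponent])
  · rw [phi_of_lt_of_le hlt le_rfl]
    exact key r hlt

theorem eLpNorm_le_of_dualConditions {κ R : ℝ} (hκ : 2 < κ) (hR : 0 < R)
    (hD : doublingConst μ (3 * κ * R) < ∞) {r : ℝ≥0∞} (hr1 : 1 ≤ r) {A C : ℝ≥0} (hA : 0 < A)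
    {T : LinftyC 𝕜 B₁ μ →ₗ[𝕜] (X →ₘ[μ] B₂)} {K : X → X → B₁ →L[𝕜] B₂}
    (hK : AEStronglyMeasurable (Function.uncurry K) (μ.prod μ))
    (hT : ∀ E : Set X, NullMeasurableSet E μ → Metric.ediam E < ENNReal.ofReal (R / 4) →
      ∀ f : LinftyC 𝕜 B₁ μ, ∀ᵐ x ∂μ, x ∈ E →
        T f x = T (cutC (Metric.cthickening (R / 3) E)
          (nullMeasurableSet_cthickening μ (R / 3) E) f) x)
    (h : ∀ (E : Set X) (hE : NullMeasurableSet E μ), Metric.ediam E < ENNReal.ofReal R →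
        DualConditions μ R r A C E
          (fun f => cut (Metric.thickening (R / 2) E)
            (nullMeasurableSet_thickening μ (R / 2) E) (T (cutC E hE f))) K)
    {p : ℝ≥0∞} (hrp : r ≤ p) (hp : p < ∞) (f : LinftyC 𝕜 B₁ μ) :
    eLpNorm (T f) p μ ≤ 16 * phi r p * doublingConst μ R ^ (5 / p).toReal *
      (doublingConst μ (3 * κ * R) ^ 9 * A + C) * eLpNorm f.1 p μ := by
  let : NormedSpace ℝ B₁ := NormedSpace.restrictScalars ℝ 𝕜 B₁
  obtain ⟨D, D', hDe, hDe', hD1, hDD, hDD'⟩ := exists_doublingUpTo_pair hκ hR hD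
  have hf : eLpNorm f.1 p μ ≠ ∞ := (LinftyC.memLp f p).eLpNorm_ne_top
  have hp1 : 1 ≤ p := hr1.trans hrp
  have hp0 : p ≠ 0 := (zero_lt_one.trans_le hp1).ne'
  rw [hDe, hDe']
  have hc : 16 * (D : ℝ≥0∞) ^ (5 / p).toReal * ((D' : ℝ≥0∞) ^ 9 * A + C) * eLpNorm f.1 p μ ≠ ∞ := by
    finiteness
  -- The dual truncation is taken on the closed R/3-neighbourhood of E₀: its inner cut is the one in
  -- (b), and its outer cut is invisible on E₀.
  have hlocal : ∀ E₀ : Set X, MeasurableSet E₀ → Metric.ediam E₀ < ENNReal.ofReal (R / 4) →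
      ∃ S : LinftyC 𝕜 B₁ μ →ₗ[𝕜] (X →ₘ[μ] B₂),
        (∀ g, S (cutC (Metric.cthickening (R / 3) E₀)
          Metric.isClosed_cthickening.measurableSet.nullMeasurableSet g) = S g) ∧
        DualConditions μ R r A C (Metric.cthickening (R / 3) E₀) S (fun x y => hK.mk _ (x, y)) ∧
        μ (Metric.cthickening (R / 3) E₀) ≠ ∞ ∧
        eLpNorm (T f) p (μ.restrict E₀) = eLpNorm (S f) p (μ.restrict E₀) := by
    intro E₀ hE₀ hEd
    set E := Metric.cthickening (R / 3) E₀ with hE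
    have hEn : NullMeasurableSet E μ := nullMeasurableSet_cthickening μ (R / 3) E₀
    -- R/4 + 2R/3 = 11R/12 < R.
    have hdiam : Metric.ediam E < ENNReal.ofReal R := by
      obtain ⟨ρ, hρ⟩ : ∃ ρ : ℝ≥0, (ρ : ℝ) = R / 3 := ⟨(R / 3).toNNReal, Real.coe_toNNReal _ (by positivity)⟩
      have h1 := Metric.ediam_cthickening_le (s := E₀) ρ
      rw [hρ] at h1
      refine lt_of_le_of_lt h1 ?_
      have h2 : (2 : ℝ≥0∞) * ρ = ENNReal.ofReal (2 * (R / 3)) := by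
        rw [ENNReal.ofReal_mul (by norm_num), ENNReal.ofReal_ofNat, ← hρ,
          ENNReal.ofReal_coe_nnreal]
      rw [h2]
      refine (ENNReal.add_lt_add_right ENNReal.ofReal_ne_top hEd).trans_le ?_
      rw [← ENNReal.ofReal_add (by positivity) (by positivity)]
      exact ENNReal.ofReal_le_ofReal (by linarith)
    refine ⟨truncate T (nullMeasurableSet_thickening μ (R / 2) E) hEn, fun g => ?_,
      (h E hEn hdiam).congr_kernel hK.ae_eq_mk, ?_, ?_⟩
    · simp only [truncate, LinearMap.coe_mk, AddHom.coe_mk]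
      rw [(concentratedOn_cutC_self g _).cutC_eq]
    · rcases E₀.eq_empty_or_nonempty with h0 | ⟨x, hx⟩
      · simp [h0]
      · refine ((measure_mono fun z hz => ?_).trans_lt
          (hDD.ball_lt_top hR x (t := R) (by linarith))).ne
        rw [Metric.mem_ball']
        exact subset_ball_of_mem_cthickening hR hEd hz hx
    · refine eLpNorm_congr_ae ?_
      filter_upwards [ae_restrict_mem hE₀, ae_restrict_of_ae (hT E₀ hE₀.nullMeasurableSet hEd f),
        ae_restrict_of_ae (coeFn_cut (Metric.thickening (R / 2) E)
          (nullMeasurableSet_thickening μ (R / 2) E) (T (cutC E hEn f)))] with x h1 h2 h3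
      have h4 : x ∈ Metric.thickening (R / 2) E := Metric.self_subset_thickening (by positivity) _
        (Metric.self_subset_cthickening _ h1)
      rw [h2 h1]
      exact ((h3.trans (indicator_of_mem h4 _))).symm
  -- The interpolation argument needs r < p strictly; at p = r the assumed L^r bound is used
  -- directly, with φ(r, r) = 1.
  rcases hrp.eq_or_lt with rfl | hlt
  · rw [phi_self hr1 hp.ne]
    refine (eLpNorm_le_of_local_bound (A := A) (C := C) (D' := D') (Φ := 1) hR hDD hp0 f
      fun E₀ hE₀ hEd => ?_).trans (le_of_eq (by ring))
    obtain ⟨S, hcut, hcond, -, hTS⟩ := hlocal E₀ hE₀ hEd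
    rw [hTS, ← hcut f, mul_one]
    refine (eLpNorm_mono_measure _ Measure.restrict_le_self).trans
      ((hcond.bound _ (concentratedOn_cutC_self _ _)).trans (mul_le_mul' ?_ le_rfl))
    calc (A : ℝ≥0∞) ≤ weakConst D' A C := by exact_mod_cast le_weakConst hD1
      _ ≤ 4 * weakConst D' A C := le_mul_of_one_le_left zero_le (by norm_num)
  · have hrr := (ENNReal.HolderConjugate.conjExponent hr1).symm
    have hpp := (ENNReal.HolderConjugate.conjExponent hp1).symm
    have hp'1 : 1 < p.conjExponent := by
      rw [ENNReal.conjExponent]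
      refine ENNReal.lt_add_right ENNReal.one_ne_top (ENNReal.inv_ne_zero.2 ?_)
      exact ENNReal.sub_ne_top hp.ne
    rw [phi, if_neg fun h => absurd h.2 (not_le.2 hlt)]
    refine (le_mul_phiBelow (r := r.conjExponent) hp'1 hc fun q hq =>
      eLpNorm_le_of_local_bound hR hDD hp0 f fun E₀ hE₀ hEd => ?_).trans (le_of_eq (by ring))
    obtain ⟨S, hcut, hcond, hfin, hTS⟩ := hlocal E₀ hE₀ hEd
    rw [hTS, ← hcut f]
    exact DualConditions.eLpNorm_le hDD' hD1 hR hrr hr1 hA hE₀ rfl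
      Metric.isClosed_cthickening.measurableSet hfin hEd hcut (K := fun x y => hK.mk _ (x, y))
      hK.stronglyMeasurable_mk hcond hpp hlt hp.ne hq.1 hq.2 _

end Global

end LocalCZ

end

end

theorem corollary17 {𝕜 X B₁ B₂ : Type*} [RCLike 𝕜]
    [MetricSpace X] [LocallyCompactSpace X] [ConnectedSpace X] [MeasurableSpace X] [BorelSpace X]
    [NormedAddCommGroup B₁] [NormedSpace 𝕜 B₁] [CompleteSpace B₁]
    [NormedAddCommGroup B₂] [NormedSpace ℝ B₂] [NormedSpace 𝕜 B₂] [CompleteSpace B₂]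
    (μ : Measure X) [μ.InnerRegular] [IsLocallyFiniteMeasure μ] [μ.IsOpenPosMeasure]
    (κ R : ℝ) (hκ : 2 < κ) (hR : 0 < R)
    (hD : LocalCZ.doublingConst μ (3 * κ * R) < ∞)
    (r : ℝ≥0∞) (A C : ℝ≥0) (hA : 0 < A) (hC : 0 < C)
    (T : LocalCZ.LinftyC 𝕜 B₁ μ →ₗ[𝕜] (X →ₘ[μ] B₂))
    (K : X → X → B₁ →L[𝕜] B₂)
    (hK : AEStronglyMeasurable (Function.uncurry K) (μ.prod μ))
    (hT : ∀ E : Set X, NullMeasurableSet E μ → Metric.ediam E < ENNReal.ofReal (R / 4) →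
      ∀ f : LocalCZ.LinftyC 𝕜 B₁ μ, ∀ᵐ x ∂μ, x ∈ E →
        T f x = T (LocalCZ.cutC (Metric.cthickening (R / 3) E)
          (LocalCZ.nullMeasurableSet_cthickening μ (R / 3) E) f) x) :
    (1 < r →
      (∀ (E : Set X) (hE : NullMeasurableSet E μ), Metric.ediam E < ENNReal.ofReal R →
        LocalCZ.Conditions μ R r A C E
          (fun f => LocalCZ.cut E hE (T (LocalCZ.cutC (Metric.thickening (R / 2) E)
            (LocalCZ.nullMeasurableSet_thickening μ (R / 2) E) f))) K) →
      ∀ p : ℝ≥0∞, 1 < p → p ≤ r → ∀ f : LocalCZ.LinftyC 𝕜 B₁ μ,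
        eLpNorm (T f) p μ ≤
          16 * LocalCZ.phi r p * LocalCZ.doublingConst μ R ^ (5 / p).toReal *
            (LocalCZ.doublingConst μ (3 * κ * R) ^ 9 * A + C) * eLpNorm f.1 p μ) ∧
    (1 ≤ r → r < ∞ →
      (∀ (E : Set X) (hE : NullMeasurableSet E μ), Metric.ediam E < ENNReal.ofReal R →
        LocalCZ.DualConditions μ R r A C E
          (fun f => LocalCZ.cut (Metric.thickening (R / 2) E)
            (LocalCZ.nullMeasurableSet_thickening μ (R / 2) E) (T (LocalCZ.cutC E hE f))) K) →
      ∀ p : ℝ≥0∞, r ≤ p → p < ∞ → ∀ f : LocalCZ.LinftyC 𝕜 B₁ μ,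
        eLpNorm (T f) p μ ≤
          16 * LocalCZ.phi r p * LocalCZ.doublingConst μ R ^ (5 / p).toReal *
            (LocalCZ.doublingConst μ (3 * κ * R) ^ 9 * A + C) * eLpNorm f.1 p μ) := by
  have hle : R ≤ 3 * κ * R := by nlinarith
  obtain ⟨D, -, -, hDD⟩ := LocalCZ.exists_doublingUpTo hR
    ((LocalCZ.doublingConst_mono (μ := μ) hle).trans_lt hD)
  -- Connectedness is used only here. Second countability gives σ-finiteness of μ and, with local
  -- compactness, the σ-compactness required by the converse of Hölder's inequality.
  have := hDD.secondCountableTopology hR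
  exact ⟨fun _ h p hp hpr f => LocalCZ.eLpNorm_le_of_conditions hκ hR hD hA hK hT h hp hpr f,
    fun hr1 _ h p hrp hp f =>
      LocalCZ.eLpNorm_le_of_dualConditions hκ hR hD hr1 hA hK hT h hrp hp f⟩
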